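/- Let $\mu>0$ and let $V:(0,\infty)\to\mathbb{R}$ be measurable with $\int_0^\infty r(1+r)|V(r)|\,dr<\infty$. For $k\in\mathbb{C}$ with $\Im k\ge 0$, $k\ne 0$, consider on $(0,\infty)$ the radial equation $$-\psi''+\frac{\mu^2-\frac14}{r^2}\,\psi+V\psi=k^2\psi ,$$ where $\psi$ is differentiable, $\psi'$ is locally absolutely continuous and the equation holds almost everywhere. Let $\phi(\cdot\,;k,\mu)$ be its regular solution, normalized by $$\lim_{r\to0}\Bigl(\frac{2}{kr}\Bigr)^{\mu+\frac12}\frac{\Gamma(\mu+1)}{\sqrt{\pi}}\,\phi(r;k,\mu)=1$$ (powers of $k$ being taken with $\arg k\in[0,\pi]$), and let $\chi^+(\cdot\,;k,\mu)$ be its Jost solution, normalized by $$\lim_{r\to\infty}e^{-i(kr-\frac{\pi}{2}\mu+\frac{\pi}{4})}\chi^+(r;k,\mu)=1 .$$ These solutions exist and are unique, the Wronskian $W(\chi^+,\phi)=\chi^+\,\partial_r\phi-\phi\,\partial_r\chi^+$ does not depend on $r$, and the Jost function $F(k,\mu)=k^{-1}W(\chi^+,\phi)$ is analytic in $k$ in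 the open upper half plane $\{\Im k>0\}$ and continuous on $\{\Im k\ge0,\ k\ne0\}$. If moreover $\int_0^\infty r|V(r)|e^{\eta r}\,dr<\infty$ for some $\eta>0$, then $F(\cdot,\mu)$ extends from $\{\Im k\ge0,\ k\neq 0\}$ to an analytic function on $\{\Im k>-\eta/2\}\setminus\{-it: t\ge0\}$. For $0<k<\eta/2$ this extension has boundary values $F(-ik-0,\mu)$ and $F(-ik+0,\mu)$ at $-ik$ from the left ($\Re<0$) and from the right ($\Re>0$) side of the cut, and they satisfy $$F(-ik-0,\mu)=-e^{2i\pi\mu}F(-ik+0,\mu)+2\cos(\pi\mu)\,e^{i\pi\mu}\,F(ik,\mu).$$ -/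

import Mathlib

open MeasureTheory Set Filter Topology

noncomputable section

/-- `ψ` solves the radial Schroedinger equation
`-ψ'' + ((μ² - 1/4) / r²) ψ + V ψ = k² ψ` on `(0, ∞)`. Since `V` is only an integrable function, the
equation is meant in the usual Caratheodory sense: `ψ` is differentiable, its derivative is locally
absolutely continuous and the equation holds almost everywhere; equivalently, `ψ'` is a locally
integrable antiderivative of the right-hand side below. -/
def IsRadialSolution (V : ℝ → ℝ) (μ : ℝ) (k : ℂ) (ψ : ℝ → ℂ) : Prop :=
  (∀ r : ℝ, 0 < r → DifferentiableAt ℝ ψ r) ∧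
  ∀ a b : ℝ, 0 < a → a ≤ b →
    IntervalIntegrable
      (fun r : ℝ => (((μ ^ 2 - 1 / 4) / r ^ 2 + V r : ℝ) - k ^ 2 : ℂ) * ψ r) volume a b ∧
    deriv ψ b - deriv ψ a =
      ∫ r in a..b, (((μ ^ 2 - 1 / 4) / r ^ 2 + V r : ℝ) - k ^ 2 : ℂ) * ψ r

/-- The regular solution `φ(r; k, μ)`, for `Im k ≥ 0`, `k ≠ 0`: normalized by
`(2 / (k r)) ^ (μ + 1/2) * Γ(μ + 1) / √π * φ → 1` as `r → 0`. The power of `k r / 2` has its argument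
in `[0, π]` for these `k` (the branch with its cut along the negative imaginary axis); it is written
as an inverse so that this is also the branch used for negative real `k`. -/
def IsRegularSolution (V : ℝ → ℝ) (μ : ℝ) (k : ℂ) (φ : ℝ → ℂ) : Prop :=
  IsRadialSolution V μ k φ ∧
  Tendsto (fun r : ℝ =>
      ((k * (r : ℂ) / 2) ^ ((μ : ℂ) + 1 / 2))⁻¹ *
        ((Real.Gamma (μ + 1) / √Real.pi : ℝ) : ℂ) * φ r)
    (𝓝[>] 0) (𝓝 1)

/-- The Jost solution `χ⁺(r; k, μ)`, for `Im k ≥ 0`, `k ≠ 0`: normalized at infinity by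
`exp (-i (k r - π μ / 2 + π / 4)) * χ⁺ → 1`. -/
def IsJostSolution (V : ℝ → ℝ) (μ : ℝ) (k : ℂ) (χ : ℝ → ℂ) : Prop :=
  IsRadialSolution V μ k χ ∧
  Tendsto (fun r : ℝ =>
      Complex.exp (-Complex.I * (k * (r : ℂ) - (Real.pi : ℂ) / 2 * (μ : ℂ) + (Real.pi : ℂ) / 4)) *
        χ r)
    atTop (𝓝 1)

/-- The Wronskian `ψ₁ ψ₂' - ψ₂ ψ₁'` at `r`. -/
def wronskianAt (ψ₁ ψ₂ : ℝ → ℂ) (r : ℝ) : ℂ :=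
  ψ₁ r * deriv ψ₂ r - ψ₂ r * deriv ψ₁ r

/-- The closed upper half plane without the origin. -/
def closedUpperPunctured : Set ℂ := {k : ℂ | 0 ≤ k.im ∧ k ≠ 0}

/-- The half plane `Im k > -η / 2` cut along the negative imaginary axis (origin included). -/
def cutHalfPlane (η : ℝ) : Set ℂ :=
  {k : ℂ | -(η / 2) < k.im} \ {k : ℂ | k.re = 0 ∧ k.im ≤ 0}

/-- `F` is, on `Im k ≥ 0`, `k ≠ 0`, the Jost function `F(k, μ) = k⁻¹ W(χ⁺, φ)`: the two solutions exist
there, they are unique on `(0, ∞)`, and the Wronskian of any representatives, taken at any radius,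
gives the value of `F`. -/
def IsJostFunction (V : ℝ → ℝ) (μ : ℝ) (F : ℂ → ℂ) : Prop :=
  ∀ k ∈ closedUpperPunctured,
    (∃ φ : ℝ → ℂ, IsRegularSolution V μ k φ ∧
      ∀ φ' : ℝ → ℂ, IsRegularSolution V μ k φ' → EqOn φ' φ (Ioi 0)) ∧
    (∃ χ : ℝ → ℂ, IsJostSolution V μ k χ ∧
      ∀ χ' : ℝ → ℂ, IsJostSolution V μ k χ' → EqOn χ' χ (Ioi 0)) ∧
    ∀ φ χ : ℝ → ℂ, IsRegularSolution V μ k φ → IsJostSolution V μ k χ →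
      ∀ r : ℝ, 0 < r → F k = k⁻¹ * wronskianAt χ φ r

end

/-! Put z = -ik, so that the closed upper half plane becomes Re z ≥ 0 and the cut becomes the
negative real axis. Up to the factor r^(1/2+μ) the regular solution solves a Volterra equation whose
kernel is affine in z², so, once the power of k in its normalization is removed, it is entire in z².
All multivaluedness of the Jost function therefore comes from that power and from the solution at
infinity.

For V = 0 the solution at infinity is explicit. With a = μ - 1/2, `freeJost` is E(z,r) = e^{-zr} ∫
e^{-t} t^a (1 + t/(2zr))^a dt, which is Γ(a+1) times the recessive solution. For Re z ≥ 0 the true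
Jost solution u agrees with E/Γ(a+1) up to o(e^{-zr}), together with derivatives, while the regular
solution φ is O(e^{Re z · r}). The constant W(u,φ) is thus the limit at infinity of W(E,φ)/Γ(a+1)
(`wronskian_jost_regular`). A cutoff θ rising from 0 at r = 1 to 1 at r = 2 turns this limit into
the integral `jostPairing` = ∫_1^∞ E(z,r) S(z²,r) dr with S = 2θ'φ' + (θ'' + θV)φ. The true Jost
solution has disappeared, and only the explicit E has to be continued.

Continuation: |E| is at most C e^{-Re z · r} and |φ| at most C e^{|Re z| r}, with |Re z| - Re z ≤ η
when Re z ≥ -η/2. Exponential decay of V then dominates the integrand, locally uniformly in z off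
the cut and uniformly up to the cut away from 0.

Jump: at w = -b the two boundary values of (1 + tw)^a differ only for t > 1/b. The shift t = s + 1/b
reproduces the same integral at w = b with factor e^{-1/b}. With 1/b = 2κr this turns e^{κr} into
e^{-κr}, so the jump of E at z = -κ is a constant times E(κ,r). As S is even in z, `jostPairing`
jumps by that constant times its value at κ (`exists_tendsto_jostPairing`). The boundary values of
z^(μ+1/2) supply the remaining phases. -/

noncomputable section

open scoped ENNReal

/-! ### Carathéodory calculus: primitives, product rule, variation of constants, Wronskians -/

/-- `g` is a locally integrable derivative of `A` on `(0, ∞)`. -/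
def HasPrimitive (A g : ℝ → ℂ) : Prop :=
  ∀ a b : ℝ, 0 < a → a ≤ b → IntervalIntegrable g volume a b ∧ A b - A a = ∫ r in a..b, g r

/-- `u` is a Caratheodory solution on `(0, ∞)` of the equation with second derivative `Q u`, and
the second function is its derivative. -/
structure IsSol (Q u u' : ℝ → ℂ) : Prop where
  hasDerivAt : ∀ r : ℝ, 0 < r → HasDerivAt u (u' r) r
  prim : HasPrimitive u' (fun r => Q r * u r)

lemma uIcc_subset_Ioi_zero {a b : ℝ} (ha : 0 < a) (hb : 0 < b) : uIcc a b ⊆ Ioi (0 : ℝ) :=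
  fun _ hx => lt_of_lt_of_le (lt_min ha hb) hx.1

namespace HasPrimitive

variable {A B f g : ℝ → ℂ}

lemma intervalIntegrable (h : HasPrimitive A g) {a b : ℝ} (ha : 0 < a) (hb : 0 < b) :
    IntervalIntegrable g volume a b := by
  rcases le_total a b with hab | hab
  · exact (h a b ha hab).1
  · exact (h b a hb hab).1.symm

lemma sub_eq (h : HasPrimitive A g) {a b : ℝ} (ha : 0 < a) (hb : 0 < b) :
    A b - A a = ∫ r in a..b, g r := by
  rcases le_total a b with hab | hab
  · exact (h a b ha hab).2
  · rw [intervalIntegral.integral_symm, ← (h b a hb hab).2]; ring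

lemma continuousOn (h : HasPrimitive A g) : ContinuousOn A (Ioi 0) := by
  intro r hr
  have hr : 0 < r := hr
  have h1 : ContinuousOn (fun x => ∫ t in (r / 2)..x, g t) (uIcc (r / 2) (r + 1)) :=
    intervalIntegral.continuousOn_primitive_interval
      ((intervalIntegrable_iff_integrableOn_Icc_of_le (by linarith)).1
        (h.intervalIntegrable (a := r / 2) (b := r + 1) (by linarith) (by linarith)) |>.mono_set
          (by rw [uIcc_of_le (by linarith)]))
  have h2 : ContinuousAt (fun x => ∫ t in (r / 2)..x, g t) r :=
    h1.continuousAt (by rw [uIcc_of_le (by linarith)]; exact Icc_mem_nhds (by linarith) (by linarith))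
  have h3 : ContinuousAt (fun x => (∫ t in (r / 2)..x, g t) + A (r / 2)) r :=
    h2.add continuousAt_const
  refine (h3.congr ?_).continuousWithinAt
  filter_upwards [Ioi_mem_nhds hr] with x hx
  rw [← h.sub_eq (by linarith) hx]; ring

lemma continuousAt (h : HasPrimitive A g) {r : ℝ} (hr : 0 < r) : ContinuousAt A r :=
  h.continuousOn.continuousAt (Ioi_mem_nhds hr)

lemma add (hA : HasPrimitive A f) (hB : HasPrimitive B g) :
    HasPrimitive (fun r => A r + B r) (fun r => f r + g r) := by
  intro a b ha hab
  refine ⟨(hA a b ha hab).1.add (hB a b ha hab).1, ?_⟩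
  rw [intervalIntegral.integral_add (hA a b ha hab).1 (hB a b ha hab).1,
    ← (hA a b ha hab).2, ← (hB a b ha hab).2]; ring

lemma const_mul (hA : HasPrimitive A f) (c : ℂ) :
    HasPrimitive (fun r => c * A r) (fun r => c * f r) := by
  intro a b ha hab
  refine ⟨(hA a b ha hab).1.const_mul c, ?_⟩
  rw [intervalIntegral.integral_const_mul, ← (hA a b ha hab).2]; ring

lemma congr (hA : HasPrimitive A f) (hAB : EqOn A B (Ioi 0)) (hfg : EqOn f g (Ioi 0)) :
    HasPrimitive B g := by
  intro a b ha hab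
  have hs : EqOn f g (uIoc a b) := fun x hx =>
    hfg (uIcc_subset_Ioi_zero ha (ha.trans_le hab) (uIoc_subset_uIcc hx))
  refine ⟨(hA a b ha hab).1.congr hs, ?_⟩
  rw [← hAB (mem_Ioi.2 ha), ← hAB (mem_Ioi.2 (ha.trans_le hab)), (hA a b ha hab).2]
  exact intervalIntegral.integral_congr
    fun x hx => hfg (uIcc_subset_Ioi_zero ha (ha.trans_le hab) hx)

lemma of_hasDerivAt (h : ∀ r, 0 < r → HasDerivAt A (f r) r) (hf : ContinuousOn f (Ioi 0)) :
    HasPrimitive A f := by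
  intro a b ha hab
  have hs := uIcc_subset_Ioi_zero ha (ha.trans_le hab)
  have hi : IntervalIntegrable f volume a b := (hf.mono hs).intervalIntegrable
  exact ⟨hi, (intervalIntegral.integral_eq_sub_of_hasDerivAt (fun x hx => h x (hs hx)) hi).symm⟩

end HasPrimitive

/-- The primitive of `k g`, where `k` vanishes to first order at `r` and `g` is integrable,
has derivative zero at `r`. -/
lemma hasDerivAt_integral_mul_zero {k g : ℝ → ℂ} {r c d : ℝ} (hc : c < r) (hd : r < d)
    (hg : IntervalIntegrable g volume c d) {k' : ℂ} (hk : HasDerivAt k k' r) (hk0 : k r = 0) :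
    HasDerivAt (fun x => ∫ s in r..x, k s * g s) 0 r := by
  have hO : k =O[𝓝 r] fun s => s - r := by simpa [hk0] using hk.isBigO_sub
  obtain ⟨C, hC, hCb⟩ := hO.exists_pos
  obtain ⟨ε, hε, hεb⟩ := Metric.eventually_nhds_iff.1 hCb.bound
  have hgn : IntegrableOn (fun s => ‖g s‖) (Icc c d) :=
    ((intervalIntegrable_iff_integrableOn_Icc_of_le (hc.trans hd).le).1 hg).norm
  have hcont : ContinuousAt (fun x => ∫ s in r..x, ‖g s‖) r := by
    have h1 : ContinuousOn (fun x => ∫ s in c..x, ‖g s‖) (uIcc c d) :=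
      intervalIntegral.continuousOn_primitive_interval (by rwa [uIcc_of_le (hc.trans hd).le])
    have h2 : ContinuousAt (fun x => ∫ s in c..x, ‖g s‖) r :=
      h1.continuousAt (by rw [uIcc_of_le (hc.trans hd).le]; exact Icc_mem_nhds hc hd)
    refine (h2.sub (continuousAt_const (y := ∫ s in c..r, ‖g s‖))).congr ?_
    filter_upwards [Ioo_mem_nhds hc hd] with x hx
    refine intervalIntegral.integral_interval_sub_left ?_ ?_
    · exact (intervalIntegrable_iff_integrableOn_Icc_of_le hx.1.le).2
        (hgn.mono_set (Icc_subset_Icc_right hx.2.le))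
    · exact (intervalIntegrable_iff_integrableOn_Icc_of_le hc.le).2
        (hgn.mono_set (Icc_subset_Icc_right hd.le))
  rw [hasDerivAt_iff_isLittleO]
  simp only [intervalIntegral.integral_same, sub_zero, smul_zero]
  rw [Asymptotics.isLittleO_iff]
  intro δ hδ
  -- On [r, x] the factor k is at most C|x - r|, and the integral of |g| there tends to 0. So the
  -- primitive is o(x - r), whether or not g has a Lebesgue point at r.
  have hsmall : ∀ᶠ x in 𝓝 r, |∫ s in r..x, ‖g s‖| < δ / C := by
    have h0 : Tendsto (fun x => |∫ s in r..x, ‖g s‖|) (𝓝 r) (𝓝 0) := by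
      simpa using hcont.abs.tendsto
    exact h0.eventually (gt_mem_nhds (by positivity))
  filter_upwards [hsmall, Metric.ball_mem_nhds r hε, Ioo_mem_nhds hc hd] with x hx hxε hxcd
  have hsub : uIoc r x ⊆ Icc c d := fun s hs =>
    ⟨(le_min hc.le hxcd.1.le).trans hs.1.le, hs.2.trans (max_le hd.le hxcd.2.le)⟩
  have hgi : IntegrableOn (fun s => ‖g s‖) (uIoc r x) := hgn.mono_set hsub
  calc ‖∫ s in r..x, k s * g s‖ ≤ ∫ s in uIoc r x, ‖k s * g s‖ :=
        intervalIntegral.norm_integral_le_integral_norm_uIoc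
    _ ≤ ∫ s in uIoc r x, C * ‖x - r‖ * ‖g s‖ := by
        refine integral_mono_of_nonneg (ae_of_all _ fun _ => norm_nonneg _) (hgi.const_mul _) ?_
        filter_upwards [ae_restrict_mem measurableSet_uIoc] with s hs
        have hsr : |s - r| ≤ |x - r| := abs_sub_left_of_mem_uIcc (uIoc_subset_uIcc hs)
        have hsε : dist s r < ε := by
          rw [Real.dist_eq]; exact hsr.trans_lt (by simpa [Real.dist_eq] using hxε)
        rw [norm_mul]
        refine mul_le_mul_of_nonneg_right ((hεb hsε).trans ?_) (norm_nonneg _)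
        exact mul_le_mul_of_nonneg_left hsr hC.le
    _ = C * ‖x - r‖ * |∫ s in r..x, ‖g s‖| := by
        rw [integral_const_mul, intervalIntegral.abs_integral_eq_abs_integral_uIoc,
          abs_of_nonneg (integral_nonneg fun _ => norm_nonneg _)]
    _ ≤ C * ‖x - r‖ * (δ / C) := by gcongr
    _ = δ * ‖x - r‖ := by field_simp

/-- Since g vanishes at r, the slope of the product is h(x) times the slope of g, so continuity of h
is enough. -/
lemma HasDerivAt.continuousAt_mul_of_eq_zero {h g : ℝ → ℂ} {g' : ℂ} {r : ℝ}
    (hg : HasDerivAt g g' r) (hg0 : g r = 0) (hh : ContinuousAt h r) :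
    HasDerivAt (fun x => h x * g x) (h r * g') r := by
  rw [hasDerivAt_iff_tendsto_slope] at hg ⊢
  refine ((hh.tendsto.mono_left nhdsWithin_le_nhds).mul hg).congr fun x => ?_
  simp only [slope, vsub_eq_sub, hg0, mul_zero, sub_zero, Complex.real_smul]
  ring

namespace HasPrimitive

variable {A B f g : ℝ → ℂ}

/-- A is only an integral, so pA need not be differentiable everywhere. Its difference with the
claimed primitive is nevertheless differentiable at every point, with derivative zero. Near r it
equals A(x)(p(x) - p(r)) minus the integral of p'A plus the integral of (p(r) - p(t)) g(t), up to a
constant: the first two derivatives cancel, and the last integrand has a coefficient vanishing at r.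
-/
lemma mul {p p' : ℝ → ℂ} (hA : HasPrimitive A g) (hp : ∀ r, 0 < r → HasDerivAt p (p' r) r)
    (hp' : ContinuousOn p' (Ioi 0)) :
    HasPrimitive (fun r => p r * A r) (fun r => p' r * A r + p r * g r) := by
  have hpc : ContinuousOn p (Ioi 0) := fun r hr => (hp r hr).continuousAt.continuousWithinAt
  have hpA : ContinuousOn (fun r => p' r * A r) (Ioi 0) := hp'.mul hA.continuousOn
  intro a b ha hab
  have hb := ha.trans_le hab
  have hi1 : ∀ {c d}, 0 < c → 0 < d → IntervalIntegrable (fun r => p' r * A r) volume c d :=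
    fun hc hd => (hpA.mono (uIcc_subset_Ioi_zero hc hd)).intervalIntegrable
  have hi2 : ∀ {c d}, 0 < c → 0 < d → IntervalIntegrable (fun r => p r * g r) volume c d :=
    fun hc hd => (hA.intervalIntegrable hc hd).continuousOn_mul
      (hpc.mono (uIcc_subset_Ioi_zero hc hd))
  have hi : ∀ {c d}, 0 < c → 0 < d →
      IntervalIntegrable (fun r => p' r * A r + p r * g r) volume c d :=
    fun hc hd => (hi1 hc hd).add (hi2 hc hd)
  refine ⟨hi ha hb, ?_⟩
  have key : ∀ r, 0 < r →
      HasDerivAt (fun x => p x * A x - ∫ t in a..x, (p' t * A t + p t * g t)) 0 r := by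
    intro r hr
    have d1 : HasDerivAt (fun x => A x * (p x - p r)) (A r * p' r) r :=
      HasDerivAt.continuousAt_mul_of_eq_zero ((hp r hr).sub_const _) (sub_self _)
        (hA.continuousAt hr)
    have d2 : HasDerivAt (fun x => ∫ t in r..x, p' t * A t) (p' r * A r) r :=
      intervalIntegral.integral_hasDerivAt_right (hi1 hr hr)
        (hpA.stronglyMeasurableAtFilter isOpen_Ioi r hr)
        (hpA.continuousAt (Ioi_mem_nhds hr))
    have d3 : HasDerivAt (fun x => ∫ t in r..x, (p r - p t) * g t) 0 r :=
      hasDerivAt_integral_mul_zero (c := r / 2) (d := r + 1) (by linarith) (by linarith)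
        (hA.intervalIntegrable (by linarith) (by linarith)) ((hp r hr).const_sub _) (sub_self _)
    have d4 := (((d1.sub d2).add d3).add_const (p r * A r - ∫ t in a..r, (p' t * A t + p t * g t)))
    have h0 : A r * p' r - p' r * A r + 0 = 0 := by ring
    rw [h0] at d4
    refine d4.congr_of_eventuallyEq ?_
    filter_upwards [Ioi_mem_nhds hr] with x hx
    have hx : 0 < x := hx
    have e1 : ∫ t in r..x, (p r - p t) * g t = p r * (A x - A r) - ∫ t in r..x, p t * g t := by
      rw [hA.sub_eq hr hx, ← intervalIntegral.integral_const_mul,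
        ← intervalIntegral.integral_sub ((hA.intervalIntegrable hr hx).const_mul _) (hi2 hr hx)]
      congr 1; ext t; ring
    have e2 := intervalIntegral.integral_add (hi1 hr hx) (hi2 hr hx)
    have e3 := intervalIntegral.integral_add_adjacent_intervals (hi ha hr) (hi hr hx)
    simp only [Pi.add_apply, Pi.sub_apply]
    rw [e1, ← e3, e2]; ring
  have hconst := (convex_Ioi (0 : ℝ)).is_const_of_fderivWithin_eq_zero (𝕜 := ℝ)
    (f := fun x => p x * A x - ∫ t in a..x, (p' t * A t + p t * g t))
    (fun r hr => (key r hr).differentiableAt.differentiableWithinAt)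
    (fun r hr => by
      rw [(key r hr).hasFDerivAt.hasFDerivWithinAt.fderivWithin
        (isOpen_Ioi.uniqueDiffWithinAt hr)]
      ext; simp) (mem_Ioi.2 ha) (mem_Ioi.2 hb)
  simp only [intervalIntegral.integral_same, sub_zero] at hconst
  change p b * A b - p a * A a = _
  rw [hconst]; ring

end HasPrimitive

/-- Variation of constants: differentiability of `α p + β q`. -/
lemma hasDerivAt_variation {p q p' q' f α β : ℝ → ℂ}
    (hp : ∀ r, 0 < r → HasDerivAt p (p' r) r) (hq : ∀ r, 0 < r → HasDerivAt q (q' r) r)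
    (hf : ∀ a b : ℝ, 0 < a → 0 < b → IntervalIntegrable f volume a b)
    (hα : HasPrimitive α (fun s => -(q s * f s))) (hβ : HasPrimitive β (fun s => p s * f s))
    {r : ℝ} (hr : 0 < r) :
    HasDerivAt (fun x => α x * p x + β x * q x) (α r * p' r + β r * q' r) r := by
  have d1 : HasDerivAt (fun x => α x * (p x - p r)) (α r * p' r) r :=
    HasDerivAt.continuousAt_mul_of_eq_zero ((hp r hr).sub_const _) (sub_self _)
      (hα.continuousAt hr)
  have d2 : HasDerivAt (fun x => β x * (q x - q r)) (β r * q' r) r :=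
    HasDerivAt.continuousAt_mul_of_eq_zero ((hq r hr).sub_const _) (sub_self _)
      (hβ.continuousAt hr)
  -- Formally α'p + β'q = 0. With p and q frozen at r, the increments of α and β combine into one
  -- integral whose coefficient vanishes at t = r.
  have d3 : HasDerivAt (fun x => ∫ t in r..x, (q r * p t - p r * q t) * f t) 0 r :=
    hasDerivAt_integral_mul_zero (c := r / 2) (d := r + 1) (by linarith) (by linarith)
      (hf _ _ (by linarith) (by linarith)) (((hp r hr).const_mul _).sub ((hq r hr).const_mul _))
      (by ring)
  have d4 := ((d1.add d2).add d3).add_const (α r * p r + β r * q r)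
  rw [add_zero] at d4
  refine d4.congr_of_eventuallyEq ?_
  filter_upwards [Ioi_mem_nhds hr] with x hx
  have hx : 0 < x := hx
  have e1 : ∫ t in r..x, (q r * p t - p r * q t) * f t
      = q r * (β x - β r) + p r * (α x - α r) := by
    rw [hα.sub_eq hr hx, hβ.sub_eq hr hx, ← intervalIntegral.integral_const_mul,
      ← intervalIntegral.integral_const_mul, ← intervalIntegral.integral_add
        ((hβ.intervalIntegrable hr hx).const_mul _) ((hα.intervalIntegrable hr hx).const_mul _)]
    congr 1; ext t; ring
  simp only [Pi.add_apply]
  rw [e1]; ring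

/-- Bridge from Volterra equations to differential equations: p and q span the unperturbed
solutions, and f is the perturbation (Q - Q₀)u divided by their Wronskian. -/
lemma IsSol.of_variation {Q Q₀ p q p' q' f α β : ℝ → ℂ}
    (hp : ∀ r, 0 < r → HasDerivAt p (p' r) r) (hq : ∀ r, 0 < r → HasDerivAt q (q' r) r)
    (hp' : ∀ r, 0 < r → HasDerivAt p' (Q₀ r * p r) r)
    (hq' : ∀ r, 0 < r → HasDerivAt q' (Q₀ r * q r) r) (hQ₀ : ContinuousOn Q₀ (Ioi 0))
    (hf : ∀ a b : ℝ, 0 < a → 0 < b → IntervalIntegrable f volume a b)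
    (hα : HasPrimitive α (fun s => -(q s * f s))) (hβ : HasPrimitive β (fun s => p s * f s))
    (hw : ∀ r, 0 < r →
      (p r * q' r - q r * p' r) * f r = (Q r - Q₀ r) * (α r * p r + β r * q r)) :
    IsSol Q (fun r => α r * p r + β r * q r) (fun r => α r * p' r + β r * q' r) where
  hasDerivAt _ hr := hasDerivAt_variation hp hq hf hα hβ hr
  prim := by
    have hpc : ContinuousOn p (Ioi 0) := fun r hr => (hp r hr).continuousAt.continuousWithinAt
    have hqc : ContinuousOn q (Ioi 0) := fun r hr => (hq r hr).continuousAt.continuousWithinAt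
    refine ((hα.mul hp' (hQ₀.mul hpc)).add (hβ.mul hq' (hQ₀.mul hqc))).congr
      (fun r _ => by ring) fun r hr => ?_
    linear_combination hw r hr

namespace IsSol

variable {Q Q₁ Q₂ u u' v v' : ℝ → ℂ}

lemma continuousOn (h : IsSol Q u u') : ContinuousOn u (Ioi 0) :=
  fun r hr => (h.hasDerivAt r hr).continuousAt.continuousWithinAt

lemma continuousOn' (h : IsSol Q u u') : ContinuousOn u' (Ioi 0) := h.prim.continuousOn

lemma const_mul (h : IsSol Q u u') (c : ℂ) :
    IsSol Q (fun r => c * u r) (fun r => c * u' r) where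
  hasDerivAt r hr := (h.hasDerivAt r hr).const_mul c
  prim := (h.prim.const_mul c).congr (fun _ _ => rfl) fun _ _ => by ring

lemma sub (hu : IsSol Q u u') (hv : IsSol Q v v') :
    IsSol Q (fun r => u r - v r) (fun r => u' r - v' r) where
  hasDerivAt r hr := (hu.hasDerivAt r hr).sub (hv.hasDerivAt r hr)
  prim := (hu.prim.add (hv.prim.const_mul (-1))).congr (fun _ _ => by ring) fun _ _ => by ring

lemma wronskian (hu : IsSol Q₁ u u') (hv : IsSol Q₂ v v') :
    HasPrimitive (fun r => u r * v' r - v r * u' r) (fun r => (Q₂ r - Q₁ r) * (u r * v r)) :=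
  ((hv.prim.mul hu.hasDerivAt hu.continuousOn').add
    ((hu.prim.mul hv.hasDerivAt hv.continuousOn').const_mul (-1))).congr
      (fun _ _ => by ring) fun _ _ => by ring

lemma wronskian_const (hu : IsSol Q u u') (hv : IsSol Q v v') {a b : ℝ} (ha : 0 < a)
    (hb : 0 < b) : u a * v' a - v a * u' a = u b * v' b - v b * u' b := by
  have := (hu.wronskian hv).sub_eq hb ha
  simpa [sub_eq_zero] using this

end IsSol

lemma isRadialSolution_iff {V : ℝ → ℝ} {μ : ℝ} {k : ℂ} {ψ : ℝ → ℂ} :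
    IsRadialSolution V μ k ψ ↔
      IsSol (fun r => (((μ ^ 2 - 1 / 4) / r ^ 2 + V r : ℝ) - k ^ 2 : ℂ)) ψ (deriv ψ) :=
  ⟨fun h => ⟨fun r hr => (h.1 r hr).hasDerivAt, h.2⟩,
    fun h => ⟨fun r hr => (h.hasDerivAt r hr).differentiableAt, h.prim⟩⟩

lemma IsSol.deriv_eq {Q u u' : ℝ → ℂ} (h : IsSol Q u u') {r : ℝ} (hr : 0 < r) :
    deriv u r = u' r := (h.hasDerivAt r hr).deriv

lemma IsSol.deriv_right {Q u u' : ℝ → ℂ} (h : IsSol Q u u') : IsSol Q u (deriv u) where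
  hasDerivAt r hr := (h.hasDerivAt r hr).differentiableAt.hasDerivAt
  prim := h.prim.congr (fun _ hr => (h.deriv_eq hr).symm) fun _ _ => rfl

/-! ### Holomorphic dependence of integrals on a parameter -/

/-- Holomorphy of a locally dominated integral of holomorphic functions. -/
lemma hasDerivAt_integral_of_locally_dominated {α : Type*} [MeasurableSpace α] {m : Measure α}
    {U : Set ℂ} (hU : IsOpen U) {f : ℂ → α → ℂ}
    (hm : ∀ z ∈ U, AEStronglyMeasurable (f z) m)
    (hd : ∀ᵐ x ∂m, DifferentiableOn ℂ (fun z => f z x) U) {z₀ : ℂ} (hz₀ : z₀ ∈ U)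
    (hb : ∃ g : α → ℝ, Integrable g m ∧ ∃ N ∈ 𝓝 z₀, ∀ᵐ x ∂m, ∀ z ∈ N, ‖f z x‖ ≤ g x) :
    HasDerivAt (fun z => ∫ x, f z x ∂m) (∫ x, deriv (fun z => f z x) z₀ ∂m) z₀ := by
  obtain ⟨g, hg, N, hN, hfg⟩ := hb
  obtain ⟨ε, hε, hball⟩ := Metric.mem_nhds_iff.1 (inter_mem hN (hU.mem_nhds hz₀))
  have hε2 : 0 < ε / 2 := by positivity
  have hsub : Metric.ball z₀ (ε / 2) ⊆ Metric.ball z₀ ε := Metric.ball_subset_ball (by linarith)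
  have hcb : ∀ z ∈ Metric.ball z₀ (ε / 2), Metric.closedBall z (ε / 4) ⊆ Metric.ball z₀ ε := by
    intro z hz w hw
    have h1 := Metric.mem_ball.1 hz
    have h2 := Metric.mem_closedBall.1 hw
    exact Metric.mem_ball.2 ((dist_triangle w z z₀).trans_lt (by linarith))
  refine (hasDerivAt_integral_of_dominated_loc_of_deriv_le (F := f)
    (F' := fun z x => deriv (fun z => f z x) z) (bound := fun x => g x / (ε / 4))
    (Metric.ball_mem_nhds z₀ hε2) ?_ ?_ ?_ ?_ (hg.div_const _) ?_).2
  · filter_upwards [hU.mem_nhds hz₀] with z hz using hm z hz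
  · refine hg.mono' (hm z₀ hz₀) ?_
    filter_upwards [hfg] with x hx using hx z₀ (mem_of_mem_nhds hN)
  -- The derivative is measurable in x as the limit of difference quotients along one sequence
  -- tending to z₀ inside U.
  · set h : ℕ → ℂ := fun n => z₀ + ((ε / 2 / (n + 2) : ℝ) : ℂ) with hh
    have hlt : ∀ n : ℕ, 0 < ε / 2 / (n + 2 : ℝ) ∧ ε / 2 / (n + 2 : ℝ) < ε := fun n => by
      refine ⟨by positivity, ?_⟩
      rw [div_lt_iff₀ (by positivity)]
      nlinarith [(Nat.cast_nonneg n : (0 : ℝ) ≤ n)]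
    have hhU : ∀ n, h n ∈ U := fun n => (hball (by
      simp only [hh, Metric.mem_ball, dist_self_add_left, Complex.norm_real, Real.norm_eq_abs]
      rw [abs_of_pos (hlt n).1]; exact (hlt n).2)).2
    have hne : ∀ n, h n ≠ z₀ := fun n => by
      simp only [hh, ne_eq, add_eq_left, Complex.ofReal_eq_zero]
      exact (hlt n).1.ne'
    have hlim : Tendsto h atTop (𝓝[≠] z₀) := by
      refine tendsto_nhdsWithin_iff.2 ⟨?_, Eventually.of_forall hne⟩
      have : Tendsto (fun n : ℕ => ε / 2 / (n + 2 : ℝ)) atTop (𝓝 0) :=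
        tendsto_const_nhds.div_atTop
          (tendsto_atTop_add_const_right _ _ tendsto_natCast_atTop_atTop)
      have h2 := (Complex.continuous_ofReal.tendsto 0).comp this
      simpa [hh] using h2.const_add z₀
    refine aestronglyMeasurable_of_tendsto_ae (u := atTop)
      (f := fun n x => slope (fun z => f z x) z₀ (h n)) (fun n => ?_) ?_
    · have := ((hm (h n) (hhU n)).sub (hm z₀ hz₀)).const_mul ((h n - z₀)⁻¹)
      refine this.congr (Eventually.of_forall fun x => ?_)
      simp [slope]
    · filter_upwards [hd] with x hx
      exact (hasDerivAt_iff_tendsto_slope.1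
        ((hx.differentiableAt (hU.mem_nhds hz₀)).hasDerivAt)).comp hlim
  -- Cauchy's estimate on spheres of radius ε/4 turns the majorant of f into a majorant of its
  -- derivative.
  · filter_upwards [hfg, hd] with x hx hdx z hz
    refine Complex.norm_deriv_le_of_forall_mem_sphere_norm_le (by positivity) ?_ fun w hw => ?_
    · refine DifferentiableOn.diffContOnCl (hdx.mono ?_)
      rw [closure_ball _ (by positivity)]
      exact (hcb z hz).trans fun w hw => (hball hw).2
    · exact hx w (hball (hcb z hz (Metric.sphere_subset_closedBall hw))).1
  · filter_upwards [hd] with x hdx z hz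
    exact (hdx.differentiableAt (hU.mem_nhds (hball (hsub hz)).2)).hasDerivAt

lemma differentiableOn_integral_of_locally_dominated {α : Type*} [MeasurableSpace α]
    {m : Measure α} {U : Set ℂ} (hU : IsOpen U) {f : ℂ → α → ℂ}
    (hm : ∀ z ∈ U, AEStronglyMeasurable (f z) m)
    (hd : ∀ᵐ x ∂m, DifferentiableOn ℂ (fun z => f z x) U)
    (hb : ∀ z₀ ∈ U, ∃ g : α → ℝ, Integrable g m ∧ ∃ N ∈ 𝓝 z₀, ∀ᵐ x ∂m, ∀ z ∈ N, ‖f z x‖ ≤ g x) :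
    DifferentiableOn ℂ (fun z => ∫ x, f z x ∂m) U := fun z₀ hz₀ =>
  (hasDerivAt_integral_of_locally_dominated hU hm hd hz₀ (hb z₀ hz₀)).differentiableAt
    |>.differentiableWithinAt

/-! ### Iterated majorants and the Gronwall inequality -/

/-- Iterated integrals of `q` over `ρ s < x`, the majorants of Picard iteration for a
Volterra equation. -/
def volterraMajorant (ρ : ℝ → ℝ) (q : ℝ → ℝ≥0∞) : ℕ → ℝ → ℝ≥0∞
  | 0 => fun _ => 1
  | n + 1 => fun x => ∫⁻ s in {s | ρ s < x}, q s * volterraMajorant ρ q n (ρ s)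

section Majorant

variable {ρ : ℝ → ℝ} {q : ℝ → ℝ≥0∞}

lemma volterraMajorant_one (x : ℝ) :
    volterraMajorant ρ q 1 x = ∫⁻ s in {s | ρ s < x}, q s := by
  simp [volterraMajorant]

lemma volterraMajorant_mono (n : ℕ) : Monotone (volterraMajorant ρ q n) := by
  cases n with
  | zero => exact monotone_const
  | succ n => exact fun x y hxy => lintegral_mono_set fun s (hs : ρ s < x) => hs.trans_le hxy

lemma measurable_volterraMajorant (n : ℕ) : Measurable (volterraMajorant ρ q n) :=
  (volterraMajorant_mono n).measurable

/-- The n-th majorant integrates over chains of n points increasing in ρ. Adding one further point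
anywhere below x gives J₁·Jₙ, and each longer chain arises in n + 1 ways. Iteration gives Jₙ ≤
J₁ⁿ/n!. Working with sublevel sets of ρ covers integration from 0, from infinity and from an
interior point at once. -/
lemma succ_mul_volterraMajorant_succ_le (hρ : Measurable ρ) (hq : Measurable q) (n : ℕ) (x : ℝ) :
    ((n : ℝ≥0∞) + 1) * volterraMajorant ρ q (n + 1) x ≤
      volterraMajorant ρ q 1 x * volterraMajorant ρ q n x := by
  induction n generalizing x with
  | zero => simp [volterraMajorant]
  | succ n ih =>
    set A : Set ℝ := {s | ρ s < x} with hA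
    have hAm : MeasurableSet A := measurableSet_lt hρ measurable_const
    have hJ : Measurable fun s => q s * volterraMajorant ρ q n (ρ s) :=
      hq.mul ((measurable_volterraMajorant n).comp hρ)
    have hJ1 : Measurable fun s => q s * volterraMajorant ρ q (n + 1) (ρ s) :=
      hq.mul ((measurable_volterraMajorant (n + 1)).comp hρ)
    have hlow : ∀ s, MeasurableSet {t | ρ t < ρ s} := fun s => measurableSet_lt hρ measurable_const
    have hup : ∀ s, MeasurableSet {t | ρ s < ρ t} := fun s => measurableSet_lt measurable_const hρ
    -- Points level with s are omitted on the left; hence an inequality, with no assumption on the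
    -- level sets of ρ.
    have split : ∀ s ∈ A, volterraMajorant ρ q 1 (ρ s) +
        ∫⁻ t in A, ({t | ρ s < ρ t}.indicator q) t ≤ volterraMajorant ρ q 1 x := by
      intro s hs
      rw [volterraMajorant_one, volterraMajorant_one, setLIntegral_indicator (hup s),
        ← lintegral_union ((hup s).inter hAm)]
      · refine lintegral_mono_set ?_
        rintro t (ht | ht)
        · exact lt_trans (show ρ t < ρ s from ht) hs
        · exact ht.2
      · rw [Set.disjoint_left]
        intro t ht ht'
        exact lt_asymm (show ρ t < ρ s from ht) ht'.1
    -- By Tonelli, placing the extra point above s and integrating it out first is the same as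
    -- lengthening the chain by one.
    have swap : ∫⁻ s in A, (∫⁻ t in A, ({t | ρ s < ρ t}.indicator q) t) *
        (q s * volterraMajorant ρ q n (ρ s)) = volterraMajorant ρ q (n + 2) x := by
      have h1 : ∀ s, (∫⁻ t in A, ({t | ρ s < ρ t}.indicator q) t) *
          (q s * volterraMajorant ρ q n (ρ s)) =
          ∫⁻ t in A, ({p : ℝ × ℝ | ρ p.1 < ρ p.2}.indicator
            (fun p => q p.2 * (q p.1 * volterraMajorant ρ q n (ρ p.1)))) (s, t) := by
        intro s
        rw [← lintegral_mul_const _ (hq.indicator (hup s))]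
        refine lintegral_congr fun t => ?_
        by_cases h : ρ s < ρ t <;> simp [h]
      simp_rw [h1]
      rw [lintegral_lintegral_swap]
      · change _ = ∫⁻ s in A, q s * volterraMajorant ρ q (n + 1) (ρ s)
        refine setLIntegral_congr_fun hAm fun t ht => ?_
        change _ = q t * ∫⁻ s in {s | ρ s < ρ t}, q s * volterraMajorant ρ q n (ρ s)
        rw [← lintegral_const_mul _ hJ, ← lintegral_indicator (hlow t), ← lintegral_indicator hAm]
        refine lintegral_congr fun s => ?_
        by_cases h : ρ s < ρ t
        · have : s ∈ A := lt_trans h ht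
          simp [h, this]
        · simp [h]
      · refine Measurable.aemeasurable (Measurable.indicator ?_ ?_)
        · exact (hq.comp measurable_snd).mul (hJ.comp measurable_fst)
        · exact measurableSet_lt (hρ.comp measurable_fst) (hρ.comp measurable_snd)
    calc ((n + 1 : ℕ) + 1 : ℝ≥0∞) * volterraMajorant ρ q (n + 2) x
        = ((n : ℝ≥0∞) + 1) * volterraMajorant ρ q (n + 2) x + volterraMajorant ρ q (n + 2) x := by
          push_cast; ring
      _ = (∫⁻ s in A, q s * (((n : ℝ≥0∞) + 1) * volterraMajorant ρ q (n + 1) (ρ s)))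
          + volterraMajorant ρ q (n + 2) x := by
          congr 1
          change _ * ∫⁻ s in A, q s * volterraMajorant ρ q (n + 1) (ρ s) = _
          rw [← lintegral_const_mul _ hJ1]
          refine lintegral_congr fun s => by ring
      _ ≤ (∫⁻ s in A, volterraMajorant ρ q 1 (ρ s) * (q s * volterraMajorant ρ q n (ρ s)))
          + volterraMajorant ρ q (n + 2) x := by
          refine add_le_add_left (lintegral_mono fun s => ?_) _
          rw [mul_left_comm (volterraMajorant ρ q 1 (ρ s))]
          exact mul_le_mul_right (ih _) _
      _ = ∫⁻ s in A, (volterraMajorant ρ q 1 (ρ s) +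
          ∫⁻ t in A, ({t | ρ s < ρ t}.indicator q) t) * (q s * volterraMajorant ρ q n (ρ s)) := by
          rw [← swap, ← lintegral_add_left]
          · simp_rw [add_mul]
          · exact ((measurable_volterraMajorant 1).comp hρ).mul hJ
      _ ≤ ∫⁻ s in A, volterraMajorant ρ q 1 x * (q s * volterraMajorant ρ q n (ρ s)) := by
          refine setLIntegral_mono (hJ.const_mul _) fun s hs => ?_
          gcongr
          exact split s hs
      _ = volterraMajorant ρ q 1 x * volterraMajorant ρ q (n + 1) x := by
          rw [lintegral_const_mul _ hJ]; rfl

lemma volterraMajorant_le (hρ : Measurable ρ) (hq : Measurable q) {x : ℝ}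
    (hx : volterraMajorant ρ q 1 x ≠ ∞) (n : ℕ) :
    volterraMajorant ρ q n x ≤
      ENNReal.ofReal ((volterraMajorant ρ q 1 x).toReal ^ n / n.factorial) := by
  have key : (n.factorial : ℝ≥0∞) * volterraMajorant ρ q n x ≤ volterraMajorant ρ q 1 x ^ n := by
    induction n with
    | zero => simp [volterraMajorant]
    | succ n ih =>
      calc ((n + 1).factorial : ℝ≥0∞) * volterraMajorant ρ q (n + 1) x
          = n.factorial * (((n : ℝ≥0∞) + 1) * volterraMajorant ρ q (n + 1) x) := by
            rw [Nat.factorial_succ]; push_cast; ring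
        _ ≤ n.factorial * (volterraMajorant ρ q 1 x * volterraMajorant ρ q n x) := by
            exact mul_le_mul_right (succ_mul_volterraMajorant_succ_le hρ hq n x) _
        _ = volterraMajorant ρ q 1 x * (n.factorial * volterraMajorant ρ q n x) := by ring
        _ ≤ _ := by rw [pow_succ']; gcongr
  have hpos : (0 : ℝ) < n.factorial := by exact_mod_cast n.factorial_pos
  rw [ENNReal.ofReal_div_of_pos hpos, ENNReal.ofReal_natCast,
    ENNReal.ofReal_pow ENNReal.toReal_nonneg, ENNReal.ofReal_toReal hx,
    ENNReal.le_div_iff_mul_le (by simp [n.factorial_ne_zero]) (by simp), mul_comm]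
  exact key

lemma tsum_volterraMajorant_le (hρ : Measurable ρ) (hq : Measurable q) {x : ℝ}
    (hx : volterraMajorant ρ q 1 x ≠ ∞) :
    ∑' n, volterraMajorant ρ q n x ≤
      ENNReal.ofReal (Real.exp (volterraMajorant ρ q 1 x).toReal) := by
  refine (ENNReal.tsum_le_tsum (volterraMajorant_le hρ hq hx)).trans ?_
  rw [← ENNReal.ofReal_tsum_of_nonneg (fun n => by positivity) (Real.summable_pow_div_factorial _),
    Real.exp_eq_exp_ℝ, NormedSpace.exp_eq_tsum_div]

/-- The Gronwall inequality for Volterra integral inequalities. -/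
lemma gronwall_volterra (hρ : Measurable ρ) (hq : Measurable q) {G : ℝ → ℝ≥0∞} {S : Set ℝ}
    {B c : ℝ≥0∞} (hB : B ≠ ∞) (hqS : ∀ s, s ∉ S → q s = 0) (hGB : ∀ s ∈ S, G s ≤ B)
    (hG : ∀ r ∈ S, G r ≤ c + ∫⁻ s in {s | ρ s < ρ r}, q s * G s) {r : ℝ} (hr : r ∈ S)
    (hQ : volterraMajorant ρ q 1 (ρ r) ≠ ∞) :
    G r ≤ c * ENNReal.ofReal (Real.exp (volterraMajorant ρ q 1 (ρ r)).toReal) := by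
  have hm : ∀ n, Measurable fun s => volterraMajorant ρ q n (ρ s) :=
    fun n => (measurable_volterraMajorant n).comp hρ
  -- Substituting the inequality into itself n times leaves a remainder B·Jₙ. The a priori bound B
  -- only serves to make this remainder vanish in the limit.
  have key : ∀ n : ℕ, ∀ r ∈ S, G r ≤ c * ∑ i ∈ Finset.range n, volterraMajorant ρ q i (ρ r) +
      B * volterraMajorant ρ q n (ρ r) := by
    intro n
    induction n with
    | zero => intro r hr; simpa [volterraMajorant] using hGB r hr
    | succ n ih =>
      intro r hr
      have hms : ∀ i, Measurable fun s => c * (q s * volterraMajorant ρ q i (ρ s)) :=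
        fun i => (hq.mul (hm i)).const_mul c
      calc G r ≤ c + ∫⁻ s in {s | ρ s < ρ r}, q s * G s := hG r hr
        _ ≤ c + ∫⁻ s in {s | ρ s < ρ r},
            (∑ i ∈ Finset.range n, c * (q s * volterraMajorant ρ q i (ρ s)) +
              B * (q s * volterraMajorant ρ q n (ρ s))) := by
            refine add_le_add_right (lintegral_mono fun s => ?_) _
            by_cases hs : s ∈ S
            · refine (mul_le_mul_right (ih s hs) (q s)).trans_eq ?_
              rw [← Finset.mul_sum, ← Finset.mul_sum]; ring
            · simp [hqS s hs]
        _ = c + (∑ i ∈ Finset.range n, c * volterraMajorant ρ q (i + 1) (ρ r) +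
              B * volterraMajorant ρ q (n + 1) (ρ r)) := by
            have h1 : ∀ (C : ℝ≥0∞) (i : ℕ),
                ∫⁻ s in {s | ρ s < ρ r}, C * (q s * volterraMajorant ρ q i (ρ s)) =
                  C * volterraMajorant ρ q (i + 1) (ρ r) :=
              fun C i => lintegral_const_mul _ (hq.mul (hm i))
            rw [lintegral_add_left (Finset.measurable_sum _ fun i _ => hms i),
              lintegral_finsetSum _ fun i _ => hms i, h1]
            simp_rw [h1]
        _ = _ := by
            rw [Finset.sum_range_succ', mul_add, Finset.mul_sum]
            simp only [volterraMajorant]; ring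
  have hlim : Tendsto (fun n => volterraMajorant ρ q n (ρ r)) atTop (𝓝 0) :=
    ENNReal.tendsto_atTop_zero_of_tsum_ne_top
      ((tsum_volterraMajorant_le hρ hq hQ).trans_lt ENNReal.ofReal_lt_top).ne
  have h2 : Tendsto (fun n => c * ENNReal.ofReal (Real.exp (volterraMajorant ρ q 1 (ρ r)).toReal) +
      B * volterraMajorant ρ q n (ρ r)) atTop
      (𝓝 (c * ENNReal.ofReal (Real.exp (volterraMajorant ρ q 1 (ρ r)).toReal) + B * 0)) :=
    tendsto_const_nhds.add (ENNReal.Tendsto.const_mul hlim (Or.inr hB))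
  rw [mul_zero, add_zero] at h2
  refine ge_of_tendsto' h2 fun n => (key n r hr).trans ?_
  gcongr
  exact (ENNReal.sum_le_tsum _).trans (tsum_volterraMajorant_le hρ hq hQ)

end Majorant


/-! ### Volterra equations solved by Picard series -/

/-- Picard iterates for the Volterra equation `y r = 1 + ∫ K r s y s ds`. -/
def volterraTerm (K : ℝ → ℝ → ℂ) : ℕ → ℝ → ℂ
  | 0 => fun _ => 1
  | n + 1 => fun r => ∫ s, K r s * volterraTerm K n s

/-- The solution of the Volterra equation `y r = 1 + ∫ K r s y s ds`. -/
def volterraSol (K : ℝ → ℝ → ℂ) (r : ℝ) : ℂ := ∑' n, volterraTerm K n r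

section Volterra

variable {ρ : ℝ → ℝ} {q : ℝ → ℝ≥0∞} {K : ℝ → ℝ → ℂ}

lemma measurable_volterraTerm (hK : Measurable (Function.uncurry K)) (n : ℕ) :
    Measurable (volterraTerm K n) := by
  induction n with
  | zero => exact measurable_const
  | succ n ih =>
    exact (StronglyMeasurable.integral_prod_right (f := fun r s => K r s * volterraTerm K n s)
      (hK.mul (ih.comp measurable_snd)).stronglyMeasurable).measurable

lemma enorm_kernel_mul_le (hKq : ∀ r s, ‖K r s‖ₑ ≤ {s | ρ s < ρ r}.indicator q s) (f : ℝ → ℂ)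
    (r : ℝ) (s : ℝ) : ‖K r s * f s‖ₑ ≤ {s | ρ s < ρ r}.indicator (fun s => q s * ‖f s‖ₑ) s := by
  rw [enorm_mul]
  refine (mul_le_mul_left (hKq r s) _).trans_eq ?_
  by_cases h : ρ s < ρ r <;> simp [h]

lemma lintegral_enorm_kernel_mul_le (hρ : Measurable ρ)
    (hKq : ∀ r s, ‖K r s‖ₑ ≤ {s | ρ s < ρ r}.indicator q s) (f : ℝ → ℂ) (r : ℝ) :
    ∫⁻ s, ‖K r s * f s‖ₑ ≤ ∫⁻ s in {s | ρ s < ρ r}, q s * ‖f s‖ₑ := by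
  rw [← lintegral_indicator (measurableSet_lt hρ measurable_const)]
  exact lintegral_mono fun s => enorm_kernel_mul_le hKq f r s

lemma enorm_volterraTerm_le (hρ : Measurable ρ)
    (hKq : ∀ r s, ‖K r s‖ₑ ≤ {s | ρ s < ρ r}.indicator q s) (n : ℕ) (r : ℝ) :
    ‖volterraTerm K n r‖ₑ ≤ volterraMajorant ρ q n (ρ r) := by
  induction n generalizing r with
  | zero => simp [volterraTerm, volterraMajorant]
  | succ n ih =>
    refine (enorm_integral_le_lintegral_enorm _).trans
      ((lintegral_enorm_kernel_mul_le hρ hKq _ r).trans ?_)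
    exact lintegral_mono fun s => mul_le_mul_right (ih s) _

lemma tsum_enorm_volterraTerm_le (hρ : Measurable ρ) (hq : Measurable q)
    (hKq : ∀ r s, ‖K r s‖ₑ ≤ {s | ρ s < ρ r}.indicator q s) {r : ℝ}
    (hr : volterraMajorant ρ q 1 (ρ r) ≠ ∞) :
    ∑' n, ‖volterraTerm K n r‖ₑ ≤
      ENNReal.ofReal (Real.exp (volterraMajorant ρ q 1 (ρ r)).toReal) :=
  (ENNReal.tsum_le_tsum fun n => enorm_volterraTerm_le hρ hKq n r).trans
    (tsum_volterraMajorant_le hρ hq hr)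

lemma summable_volterraTerm (hρ : Measurable ρ) (hq : Measurable q)
    (hKq : ∀ r s, ‖K r s‖ₑ ≤ {s | ρ s < ρ r}.indicator q s) {r : ℝ}
    (hr : volterraMajorant ρ q 1 (ρ r) ≠ ∞) : Summable fun n => volterraTerm K n r := by
  have h := ((tsum_enorm_volterraTerm_le hρ hq hKq hr).trans_lt ENNReal.ofReal_lt_top).ne
  exact Summable.of_enorm h

lemma enorm_volterraSol_le (hρ : Measurable ρ) (hq : Measurable q)
    (hKq : ∀ r s, ‖K r s‖ₑ ≤ {s | ρ s < ρ r}.indicator q s) {r : ℝ}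
    (hr : volterraMajorant ρ q 1 (ρ r) ≠ ∞) :
    ‖volterraSol K r‖ₑ ≤ ENNReal.ofReal (Real.exp (volterraMajorant ρ q 1 (ρ r)).toReal) :=
  enorm_tsum_le_tsum_enorm.trans
    (tsum_enorm_volterraTerm_le hρ hq hKq hr)

lemma measurable_volterraSol (hK : Measurable (Function.uncurry K)) :
    Measurable (volterraSol K) :=
  Measurable.tsum fun n => measurable_volterraTerm hK n

lemma volterraSol_eq (hρ : Measurable ρ) (hq : Measurable q)
    (hK : Measurable (Function.uncurry K))
    (hKq : ∀ r s, ‖K r s‖ₑ ≤ {s | ρ s < ρ r}.indicator q s) {r : ℝ}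
    (hr : volterraMajorant ρ q 1 (ρ r) ≠ ∞) :
    volterraSol K r = 1 + ∫ s, K r s * volterraSol K s := by
  have hm : ∀ n, AEStronglyMeasurable (fun s => K r s * volterraTerm K n s) volume := fun n =>
    ((hK.comp measurable_prodMk_left).mul (measurable_volterraTerm hK n)).aestronglyMeasurable
  have h1 : ∑' n, ∫⁻ s, ‖K r s * volterraTerm K n s‖ₑ ≠ ∞ := by
    refine ((ENNReal.tsum_le_tsum fun n => ?_).trans_lt
      ((ENNReal.tsum_comp_le_tsum_of_injective (add_left_injective 1) _).trans_lt
        ((tsum_volterraMajorant_le hρ hq hr).trans_lt ENNReal.ofReal_lt_top))).ne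
    refine (lintegral_enorm_kernel_mul_le hρ hKq _ r).trans ?_
    exact lintegral_mono fun s => mul_le_mul_right (enorm_volterraTerm_le hρ hKq n s) _
  have h2 := integral_tsum hm h1
  have h3 : ∫ s, K r s * volterraSol K s = ∑' n, ∫ s, K r s * volterraTerm K n s := by
    rw [← h2]
    congr 1; ext s
    rw [volterraSol, tsum_mul_left]
  rw [h3, volterraSol, (summable_volterraTerm hρ hq hKq hr).tsum_eq_zero_add]
  rfl

lemma enorm_volterraSol_sub_one_le (hρ : Measurable ρ) (hq : Measurable q)
    (hK : Measurable (Function.uncurry K))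
    (hKq : ∀ r s, ‖K r s‖ₑ ≤ {s | ρ s < ρ r}.indicator q s) {r : ℝ}
    (hr : volterraMajorant ρ q 1 (ρ r) ≠ ∞) :
    ‖volterraSol K r - 1‖ₑ ≤ volterraMajorant ρ q 1 (ρ r) *
      ENNReal.ofReal (Real.exp (volterraMajorant ρ q 1 (ρ r)).toReal) := by
  rw [volterraSol_eq hρ hq hK hKq hr, add_sub_cancel_left]
  refine (enorm_integral_le_lintegral_enorm _).trans
    ((lintegral_enorm_kernel_mul_le hρ hKq _ r).trans ?_)
  nth_rw 1 [volterraMajorant_one]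
  rw [← lintegral_mul_const _ hq]
  refine setLIntegral_mono (hq.mul_const _) fun s hs => ?_
  have hle : volterraMajorant ρ q 1 (ρ s) ≤ volterraMajorant ρ q 1 (ρ r) :=
    volterraMajorant_mono 1 (le_of_lt hs)
  refine mul_le_mul_right ((enorm_volterraSol_le hρ hq hKq (ne_top_of_le_ne_top hr hle)).trans ?_) _
  exact ENNReal.ofReal_le_ofReal (Real.exp_le_exp.2 (ENNReal.toReal_mono hr hle))

/-- One majorant q serves all z in U. Each iterate is then a dominated integral of holomorphic
functions, and the series converges uniformly on U by the Weierstrass test. -/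
lemma differentiableOn_volterraSol (hρ : Measurable ρ) (hq : Measurable q) {U : Set ℂ}
    (hU : IsOpen U) {K : ℂ → ℝ → ℝ → ℂ} (hK : ∀ z ∈ U, Measurable (Function.uncurry (K z)))
    (hKq : ∀ z ∈ U, ∀ r s, ‖K z r s‖ₑ ≤ {s | ρ s < ρ r}.indicator q s)
    (hKd : ∀ r s, DifferentiableOn ℂ (fun z => K z r s) U) {r : ℝ}
    (hr : volterraMajorant ρ q 1 (ρ r) ≠ ∞) :
    DifferentiableOn ℂ (fun z => volterraSol (K z) r) U := by
  have hfin : ∀ n {x : ℝ}, volterraMajorant ρ q 1 x ≠ ∞ → volterraMajorant ρ q n x ≠ ∞ :=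
    fun n x hx => ((volterraMajorant_le hρ hq hx n).trans_lt ENNReal.ofReal_lt_top).ne
  have hterm : ∀ n r, volterraMajorant ρ q 1 (ρ r) ≠ ∞ →
      DifferentiableOn ℂ (fun z => volterraTerm (K z) n r) U := by
    intro n
    induction n with
    | zero => intro r _; exact differentiableOn_const 1
    | succ n ih =>
      intro r hr
      set g : ℝ → ℝ≥0∞ :=
        {s | ρ s < ρ r}.indicator fun s => q s * volterraMajorant ρ q n (ρ s) with hg
      have hgm : Measurable g := (hq.mul ((measurable_volterraMajorant n).comp hρ)).indicator
        (measurableSet_lt hρ measurable_const)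
      have hgi : ∫⁻ s, g s ≠ ∞ := by
        rw [hg, lintegral_indicator (measurableSet_lt hρ measurable_const)]
        exact hfin (n + 1) hr
      have hbd : ∀ z ∈ U, ∀ s, ‖K z r s * volterraTerm (K z) n s‖ₑ ≤ g s := by
        intro z hz s
        refine (enorm_kernel_mul_le (hKq z hz) _ r s).trans ?_
        refine indicator_le_indicator (mul_le_mul_right ?_ _)
        exact enorm_volterraTerm_le hρ (hKq z hz) n s
      refine differentiableOn_integral_of_locally_dominated hU (fun z hz => ?_)
        (Eventually.of_forall fun s => ?_) fun z₀ hz₀ => ?_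
      · exact (((hK z hz).comp measurable_prodMk_left).mul
          (measurable_volterraTerm (hK z hz) n)).aestronglyMeasurable
      · by_cases hs : ρ s < ρ r
        · exact (hKd r s).mul (ih s (ne_top_of_le_ne_top hr (volterraMajorant_mono 1 hs.le)))
        · refine (differentiableOn_const 0).congr fun z hz => ?_
          have := hbd z hz s
          simpa [hg, hs] using this
      · refine ⟨fun s => (g s).toReal, integrable_toReal_of_lintegral_ne_top hgm.aemeasurable hgi,
          U, hU.mem_nhds hz₀, ?_⟩
        filter_upwards [ae_lt_top hgm hgi] with s hs z hz
        have := ENNReal.toReal_mono hs.ne (hbd z hz s)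
        simpa using this
  refine Complex.differentiableOn_tsum_of_summable_norm
    (u := fun n => (volterraMajorant ρ q n (ρ r)).toReal) ?_ (fun n => hterm n r hr) hU ?_
  · exact ENNReal.summable_toReal
      ((tsum_volterraMajorant_le hρ hq hr).trans_lt ENNReal.ofReal_lt_top).ne
  · intro n z hz
    have := ENNReal.toReal_mono (hfin n hr) (enorm_volterraTerm_le hρ (hKq z hz) n r)
    simpa using this

end Volterra

/-! ### Uniqueness and growth of solutions -/

lemma enorm_intervalIntegral_le (f : ℝ → ℂ) (a r : ℝ) :
    ‖∫ s in a..r, f s‖ₑ ≤ ∫⁻ s in uIoc a r, ‖f s‖ₑ := by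
  have h : ‖∫ s in a..r, f s‖ₑ = ‖∫ s in uIoc a r, f s‖ₑ := by
    rw [← ofReal_norm, ← ofReal_norm, intervalIntegral.norm_intervalIntegral_eq]
  rw [h]
  exact enorm_integral_le_lintegral_enorm _

/-- Puts an integral from a to r, in either direction, into the sublevel form needed for Gronwall
with ρ(s) = |s - a|. The strict inequality loses only the null set {r}. -/
lemma lintegral_uIoc_le (q G : ℝ → ℝ≥0∞) {a b r : ℝ} (hr : r ∈ uIcc a b) :
    ∫⁻ s in uIoc a r, q s * G s ≤
      ∫⁻ s in {s | |s - a| < |r - a|}, (uIcc a b).indicator q s * G s := by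
  have h1 : ∫⁻ s in uIoc a r, q s * G s = ∫⁻ s in uIoc a r, (uIcc a b).indicator q s * G s := by
    refine setLIntegral_congr_fun measurableSet_uIoc fun s hs => ?_
    have : s ∈ uIcc a b := uIcc_subset_uIcc_left hr (uIoc_subset_uIcc hs)
    simp [this]
  rw [h1]
  refine lintegral_mono_set' ?_
  have hne : ∀ᵐ s : ℝ, s ≠ r := by simp [ae_iff]
  filter_upwards [hne] with s hs hsm
  change |s - a| < |r - a|
  rcases le_total a r with h | h
  · have hsm : s ∈ Ioc a r := by rwa [← uIoc_of_le h]
    rw [abs_of_pos (sub_pos.2 hsm.1), abs_of_nonneg (sub_nonneg.2 h)]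
    linarith [lt_of_le_of_ne hsm.2 hs]
  · have hsm : s ∈ Ioc r a := by rwa [← uIoc_of_ge h]
    rw [abs_of_nonpos (sub_nonpos.2 hsm.2), abs_of_nonpos (sub_nonpos.2 h)]
    linarith [hsm.1]

lemma volterraMajorant_indicator_le (q : ℝ → ℝ≥0∞) {S : Set ℝ} (hS : MeasurableSet S) (ρ : ℝ → ℝ)
    (x : ℝ) : volterraMajorant ρ (S.indicator q) 1 x ≤ ∫⁻ s in S, q s := by
  rw [volterraMajorant_one]
  refine (setLIntegral_le_lintegral _ _).trans_eq ?_
  rw [lintegral_indicator hS]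

lemma measurable_abs_sub_const (a : ℝ) : Measurable fun s : ℝ => |s - a| := by fun_prop

/-- Uniqueness for the initial value problem. -/
lemma IsSol.eqOn_zero {Q u u' : ℝ → ℂ} (h : IsSol Q u u') (hQm : Measurable Q)
    (hQ : ∀ a b : ℝ, 0 < a → 0 < b → IntervalIntegrable Q volume a b) {a : ℝ} (ha : 0 < a)
    (h0 : u a = 0) (h0' : u' a = 0) : EqOn u 0 (Ioi 0) := by
  intro b hb
  have hb : 0 < b := hb
  set S := uIcc a b with hS
  have hSpos : S ⊆ Ioi 0 := uIcc_subset_Ioi_zero ha hb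
  set G : ℝ → ℝ≥0∞ := fun s => ‖u s‖ₑ + ‖u' s‖ₑ with hGdef
  -- For the first-order system, |u'| + |Qu| ≤ (1 + |Q|)(|u| + |u'|).
  set q : ℝ → ℝ≥0∞ := fun s => 1 + ‖Q s‖ₑ with hqdef
  have hq : Measurable q := measurable_const.add hQm.enorm
  obtain ⟨C₁, hC₁⟩ := isCompact_uIcc.exists_bound_of_continuousOn (h.continuousOn.mono hSpos)
  obtain ⟨C₂, hC₂⟩ := isCompact_uIcc.exists_bound_of_continuousOn (h.continuousOn'.mono hSpos)
  have hGB : ∀ s ∈ S, G s ≤ ENNReal.ofReal C₁ + ENNReal.ofReal C₂ := fun s hs => by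
    simp only [hGdef, ← ofReal_norm]
    exact add_le_add (ENNReal.ofReal_le_ofReal (hC₁ s hs)) (ENNReal.ofReal_le_ofReal (hC₂ s hs))
  have hfin : ∫⁻ s in S, q s ≠ ∞ := by
    have h1 : ∫⁻ s in S, ‖Q s‖ₑ ≠ ∞ := by
      have := ((intervalIntegrable_iff' (by simp)).1 (hQ a b ha hb)).2
      exact this.ne
    rw [lintegral_add_left measurable_const]
    refine ENNReal.add_ne_top.2 ⟨?_, h1⟩
    rw [lintegral_const]
    simp [hS, uIcc, Real.volume_Icc]
  have hmaj : volterraMajorant (fun s => |s - a|) (S.indicator q) 1 |b - a| ≠ ∞ :=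
    ne_top_of_le_ne_top hfin (volterraMajorant_indicator_le q measurableSet_uIcc _ _)
  have hGr : ∀ r ∈ S, G r ≤ 0 + ∫⁻ s in {s | |s - a| < |r - a|}, S.indicator q s * G s := by
    intro r hr
    have hr0 : 0 < r := hSpos hr
    rw [zero_add]
    refine le_trans ?_ (lintegral_uIoc_le q G hr)
    have e1 : u r = ∫ s in a..r, u' s := by
      rw [← (HasPrimitive.of_hasDerivAt h.hasDerivAt h.continuousOn').sub_eq ha hr0, h0, sub_zero]
    have e2 : u' r = ∫ s in a..r, Q s * u s := by rw [← h.prim.sub_eq ha hr0, h0', sub_zero]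
    have hum : AEMeasurable (fun s => ‖u' s‖ₑ) (volume.restrict (uIoc a r)) :=
      ((h.continuousOn'.mono (uIoc_subset_uIcc.trans (uIcc_subset_Ioi_zero ha hr0))).aestronglyMeasurable
        measurableSet_uIoc).enorm
    calc G r ≤ (∫⁻ s in uIoc a r, ‖u' s‖ₑ) + ∫⁻ s in uIoc a r, ‖Q s * u s‖ₑ := by
          simp only [hGdef]
          refine add_le_add ?_ ?_
          · rw [e1]; exact enorm_intervalIntegral_le _ _ _
          · rw [e2]; exact enorm_intervalIntegral_le _ _ _
      _ = ∫⁻ s in uIoc a r, (‖u' s‖ₑ + ‖Q s * u s‖ₑ) := (lintegral_add_left' hum _).symm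
      _ ≤ _ := by
          refine lintegral_mono fun s => ?_
          simp only [hqdef, hGdef, enorm_mul]
          calc ‖u' s‖ₑ + ‖Q s‖ₑ * ‖u s‖ₑ
              ≤ ‖u' s‖ₑ + ‖Q s‖ₑ * ‖u s‖ₑ + (‖u s‖ₑ + ‖Q s‖ₑ * ‖u' s‖ₑ) := le_self_add
            _ = _ := by ring
  have key := gronwall_volterra (ρ := fun s => |s - a|) (measurable_abs_sub_const a)
    (hq.indicator (measurableSet_uIcc (a := a) (b := b))) (S := S)
    (ENNReal.add_ne_top.2 ⟨ENNReal.ofReal_ne_top, ENNReal.ofReal_ne_top⟩)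
    (fun s hs => indicator_of_notMem hs _) hGB hGr right_mem_uIcc hmaj
  have hz : G b = 0 := by simpa using key
  have := (add_eq_zero.1 hz).1
  simpa using this

/-- Exponential growth bound for solutions of the equation with coefficient `U + z²`, where `U` is
integrable. -/
lemma IsSol.norm_le_exp {U u u' : ℝ → ℂ} {z : ℂ} (hz : z ≠ 0)
    (h : IsSol (fun r => U r + z ^ 2) u u') (hUm : Measurable U) (hU : IntegrableOn U (Ioi 1))
    {r : ℝ} (hr : 1 ≤ r) :
    ‖u' r‖ ≤ (‖u' 1‖ + ‖z‖ * ‖u 1‖) * Real.exp ((∫ s in Ioi 1, ‖U s‖) / ‖z‖) *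
        Real.exp (|z.re| * (r - 1)) ∧
    ‖z‖ * ‖u r‖ ≤ (‖u' 1‖ + ‖z‖ * ‖u 1‖) * Real.exp ((∫ s in Ioi 1, ‖U s‖) / ‖z‖) *
        Real.exp (|z.re| * (r - 1)) := by
  set x : ℝ := |z.re| with hx
  set e : ℝ → ℂ := fun s => Complex.exp (-(x * (s - 1) : ℝ)) with he
  have henorm : ∀ s, ‖e s‖ = Real.exp (-(x * (s - 1))) := fun s => by
    simp [he, Complex.norm_exp]
  -- If ζ² = z², then (u' + ζu)' = ζ(u' + ζu) + Uu. After weighting by e^{-x(s-1)} the propagator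
  -- exp((ζ - x)(t - s)) is a contraction because Re ζ ≤ x. Both ζ = z and ζ = -z qualify.
  have key : ∀ ζ : ℂ, ζ ^ 2 = z ^ 2 → ζ.re ≤ x → ∀ t, 1 ≤ t →
      ‖e t * (u' t + ζ * u t)‖ₑ ≤ ‖e 1 * (u' 1 + ζ * u 1)‖ₑ +
        ∫⁻ s in uIoc 1 t, ‖U s‖ₑ * ‖e s * u s‖ₑ := by
    intro ζ hζ hζx t ht
    have hA : HasPrimitive (fun s => Complex.exp (-(ζ * s)) * (u' s + ζ * u s))
        (fun s => Complex.exp (-(ζ * s)) * (U s * u s)) := by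
      have h1 := (h.prim.add ((HasPrimitive.of_hasDerivAt h.hasDerivAt h.continuousOn').const_mul
        ζ)).mul (p := fun s : ℝ => Complex.exp (-(ζ * s)))
        (p' := fun s : ℝ => Complex.exp (-(ζ * s)) * (-ζ)) (fun r _ => by
          have h2 : HasDerivAt (fun s : ℝ => -(ζ * (s : ℂ))) (-ζ) r := by
            exact (((Complex.ofRealCLM.hasDerivAt (x := r)).const_mul ζ).neg).congr_deriv (by simp)
          exact h2.cexp) (by fun_prop)
      refine h1.congr (fun _ _ => rfl) fun s _ => ?_
      linear_combination -Complex.exp (-(ζ * s)) * u s * hζ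
    have hsub := hA.sub_eq one_pos (one_pos.trans_le ht)
    have hmul : e t * (u' t + ζ * u t) =
        Complex.exp ((ζ - x) * (t - 1)) * (e 1 * (u' 1 + ζ * u 1)) +
          ∫ s in (1 : ℝ)..t, Complex.exp ((ζ - x) * (t - s)) * (U s * (e s * u s)) := by
      have h3 : ∀ s : ℝ, Complex.exp ((ζ - x) * (t - s)) * (U s * (e s * u s)) =
          (e t * Complex.exp (ζ * t)) * (Complex.exp (-(ζ * s)) * (U s * u s)) := by
        intro s
        have : Complex.exp ((ζ - x) * (t - s)) * e s =
            e t * Complex.exp (ζ * t) * Complex.exp (-(ζ * s)) := by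
          simp only [he, ← Complex.exp_add]; congr 1; push_cast; ring
        linear_combination U s * u s * this
      have h4 : Complex.exp ((ζ - x) * (t - 1)) * e 1 =
          e t * Complex.exp (ζ * t) * Complex.exp (-(ζ * (1 : ℝ))) := by
        simp only [he, ← Complex.exp_add]; congr 1; push_cast; ring
      have h5 : Complex.exp (ζ * t) * Complex.exp (-(ζ * t)) = 1 := by
        rw [← Complex.exp_add]; simp
      simp_rw [h3]
      rw [intervalIntegral.integral_const_mul, ← hsub]
      linear_combination (-(u' 1 + ζ * u 1)) * h4 - e t * (u' t + ζ * u t) * h5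
    have hexp : ∀ s : ℝ, s ≤ t → ‖Complex.exp ((ζ - x) * (t - s))‖ₑ ≤ 1 := by
      intro s hs
      rw [← ofReal_norm, ENNReal.ofReal_le_one, Complex.norm_exp, Real.exp_le_one_iff]
      have : ((ζ - x) * ((t : ℂ) - s)).re = (ζ.re - x) * (t - s) := by
        rw [← Complex.ofReal_sub, Complex.re_mul_ofReal]; simp
      rw [this]
      exact mul_nonpos_of_nonpos_of_nonneg (by linarith) (by linarith)
    rw [hmul]
    refine (enorm_add_le _ _).trans (add_le_add ?_ ?_)
    · rw [enorm_mul]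
      have := hexp 1 ht
      push_cast at this
      exact mul_le_of_le_one_left' this
    · refine (enorm_intervalIntegral_le _ _ _).trans ?_
      refine setLIntegral_mono' measurableSet_uIoc fun s hs => ?_
      rw [uIoc_of_le ht] at hs
      rw [enorm_mul, enorm_mul]
      exact mul_le_of_le_one_left' (hexp s hs.2)
  have hzpos : 0 < ‖z‖ := norm_pos_iff.2 hz
  -- The sum and difference of u' + zu and u' - zu recover 2u' and 2zu. Thus g controls both, and
  -- Gronwall closes with coefficient |U/z|.
  set g : ℝ → ℝ≥0∞ := fun s => ‖e s * (u' s + z * u s)‖ₑ + ‖e s * (u' s + (-z) * u s)‖ₑ with hg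
  have hgu : ∀ s, 2 * ‖z‖ₑ * ‖e s * u s‖ₑ ≤ g s := by
    intro s
    have : (2 : ℂ) * z * (e s * u s) =
        e s * (u' s + z * u s) - e s * (u' s + (-z) * u s) := by ring
    have h2 : ‖(2 : ℂ) * z * (e s * u s)‖ₑ = 2 * ‖z‖ₑ * ‖e s * u s‖ₑ := by
      rw [enorm_mul, enorm_mul]; congr 2; simp [← ofReal_norm]
    rw [← h2, this]
    exact enorm_sub_le
  have hgu' : ∀ s, 2 * ‖e s * u' s‖ₑ ≤ g s := by
    intro s
    have : (2 : ℂ) * (e s * u' s) =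
        e s * (u' s + z * u s) + e s * (u' s + (-z) * u s) := by ring
    have h2 : ‖(2 : ℂ) * (e s * u' s)‖ₑ = 2 * ‖e s * u' s‖ₑ := by
      rw [enorm_mul]; congr 1; simp [← ofReal_norm]
    rw [← h2, this]
    exact enorm_add_le _ _
  set q : ℝ → ℝ≥0∞ := fun s => ‖U s / z‖ₑ with hq
  have hqm : Measurable q := (hUm.div_const z).enorm
  have hzne : (2 : ℝ≥0∞) * ‖z‖ₑ ≠ 0 := by simp [hz]
  have hgr : ∀ t ∈ uIcc 1 r, g t ≤ g 1 +
      ∫⁻ s in {s | |s - 1| < |t - 1|}, (uIcc 1 r).indicator q s * g s := by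
    intro t ht
    have ht1 : 1 ≤ t := by rw [uIcc_of_le hr] at ht; exact ht.1
    have k1 := key z rfl (le_abs_self _) t ht1
    have k2 := key (-z) (by ring) (by rw [Complex.neg_re]; exact neg_le_abs _) t ht1
    refine le_trans ?_ (add_le_add_right (lintegral_uIoc_le q g ht) (g 1))
    refine (add_le_add k1 k2).trans ?_
    have h2 : (∫⁻ s in uIoc 1 t, ‖U s‖ₑ * ‖e s * u s‖ₑ) + (∫⁻ s in uIoc 1 t, ‖U s‖ₑ * ‖e s * u s‖ₑ)
        ≤ ∫⁻ s in uIoc 1 t, q s * g s := by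
      rw [← two_mul, ← lintegral_const_mul' _ _ (by simp)]
      refine lintegral_mono fun s => ?_
      calc 2 * (‖U s‖ₑ * ‖e s * u s‖ₑ) = q s * (2 * ‖z‖ₑ * ‖e s * u s‖ₑ) := by
            have : ‖U s‖ₑ = q s * ‖z‖ₑ := by
              simp only [hq]; rw [← enorm_mul, div_mul_cancel₀ _ hz]
            rw [this]; ring
        _ ≤ q s * g s := mul_le_mul_right (hgu s) _
    calc _ = g 1 + ((∫⁻ s in uIoc 1 t, ‖U s‖ₑ * ‖e s * u s‖ₑ) +
          (∫⁻ s in uIoc 1 t, ‖U s‖ₑ * ‖e s * u s‖ₑ)) := by simp only [hg]; ring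
      _ ≤ _ := add_le_add_right h2 _
  have hsub : uIcc 1 r ⊆ Ioi (0 : ℝ) := uIcc_subset_Ioi_zero one_pos (one_pos.trans_le hr)
  have hec : Continuous e := by simp only [he]; fun_prop
  have hcont : ∀ ζ : ℂ, ContinuousOn (fun s => e s * (u' s + ζ * u s)) (uIcc 1 r) := fun ζ =>
    hec.continuousOn.mul ((h.continuousOn'.mono hsub).add
      (continuousOn_const.mul (h.continuousOn.mono hsub)))
  obtain ⟨C₁, hC₁⟩ := isCompact_uIcc.exists_bound_of_continuousOn (hcont z)
  obtain ⟨C₂, hC₂⟩ := isCompact_uIcc.exists_bound_of_continuousOn (hcont (-z))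
  have hGB : ∀ s ∈ uIcc 1 r, g s ≤ ENNReal.ofReal C₁ + ENNReal.ofReal C₂ := fun s hs => by
    simp only [hg, ← ofReal_norm]
    exact add_le_add (ENNReal.ofReal_le_ofReal (hC₁ s hs)) (ENNReal.ofReal_le_ofReal (hC₂ s hs))
  have hint : ∫⁻ s in Ioi 1, q s = ENNReal.ofReal ((∫ s in Ioi 1, ‖U s‖) / ‖z‖) := by
    rw [← integral_div, ofReal_integral_eq_lintegral_ofReal (hU.norm.div_const _)
      (ae_of_all _ fun s => by positivity)]
    simp only [hq, ← ofReal_norm, norm_div]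
  have hmaj : volterraMajorant (fun s => |s - 1|) ((uIcc 1 r).indicator q) 1 |r - 1| ≤
      ENNReal.ofReal ((∫ s in Ioi 1, ‖U s‖) / ‖z‖) := by
    refine (volterraMajorant_indicator_le q measurableSet_uIcc _ _).trans ?_
    rw [← hint, uIcc_of_le hr, ← restrict_Ioc_eq_restrict_Icc]
    exact lintegral_mono_set Ioc_subset_Ioi_self
  have fin := gronwall_volterra (ρ := fun s => |s - 1|) (measurable_abs_sub_const 1)
    (hqm.indicator (measurableSet_uIcc (a := (1 : ℝ)) (b := r))) (S := uIcc 1 r)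
    (ENNReal.add_ne_top.2 ⟨ENNReal.ofReal_ne_top, ENNReal.ofReal_ne_top⟩)
    (fun s hs => by simp [hs]) hGB hgr right_mem_uIcc (ne_top_of_le_ne_top ENNReal.ofReal_ne_top hmaj)
  have hI : 0 ≤ (∫ s in Ioi 1, ‖U s‖) / ‖z‖ := by positivity
  have hg1 : g 1 ≤ ENNReal.ofReal (2 * (‖u' 1‖ + ‖z‖ * ‖u 1‖)) := by
    have he1 : e 1 = 1 := by simp [he]
    simp only [hg, he1, one_mul, ← ofReal_norm]
    rw [← ENNReal.ofReal_add (norm_nonneg _) (norm_nonneg _)]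
    refine ENNReal.ofReal_le_ofReal ?_
    have h1 := norm_add_le (u' 1) (z * u 1)
    have h2 := norm_add_le (u' 1) (-z * u 1)
    rw [norm_mul] at h1 h2
    rw [norm_neg] at h2
    linarith
  set M := (‖u' 1‖ + ‖z‖ * ‖u 1‖) * Real.exp ((∫ s in Ioi 1, ‖U s‖) / ‖z‖) with hM
  have hM0 : 0 ≤ M := by positivity
  have hgr' : g r ≤ ENNReal.ofReal (2 * M) := by
    refine fin.trans ?_
    calc _ ≤ ENNReal.ofReal (2 * (‖u' 1‖ + ‖z‖ * ‖u 1‖)) *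
          ENNReal.ofReal (Real.exp ((∫ s in Ioi 1, ‖U s‖) / ‖z‖)) := by
          refine mul_le_mul' hg1 (ENNReal.ofReal_le_ofReal (Real.exp_le_exp.2 ?_))
          exact ENNReal.toReal_le_of_le_ofReal hI hmaj
      _ = _ := by rw [← ENNReal.ofReal_mul (by positivity), hM, mul_assoc]
  have hfinal : ∀ w : ℂ, 2 * ‖e r * w‖ₑ ≤ g r → ‖w‖ ≤ M * Real.exp (x * (r - 1)) := by
    intro w hw
    have h1 : ENNReal.ofReal (2 * ‖e r * w‖) ≤ ENNReal.ofReal (2 * M) := by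
      rw [ENNReal.ofReal_mul (by norm_num), ofReal_norm]
      simpa using hw.trans hgr'
    have h2 := (ENNReal.ofReal_le_ofReal_iff (by positivity)).1 h1
    rw [norm_mul, henorm] at h2
    have h3 : Real.exp (-(x * (r - 1))) * ‖w‖ ≤ M := by linarith
    calc ‖w‖ = Real.exp (-(x * (r - 1))) * ‖w‖ * Real.exp (x * (r - 1)) := by
          rw [mul_right_comm, ← Real.exp_add]; simp
      _ ≤ _ := by gcongr
  refine ⟨hfinal _ (hgu' r), ?_⟩
  rw [← norm_mul]
  refine hfinal _ ?_
  refine le_trans (le_of_eq ?_) (hgu r)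
  rw [mul_left_comm, enorm_mul z, mul_assoc]

/-- Two solutions with the same leading behaviour at an end of `(0, ∞)` coincide, if the
reference solution is subdominant there. -/
lemma IsSol.eqOn_of_tendsto {Q u u' v v' : ℝ → ℂ} (hu : IsSol Q u u') (hv : IsSol Q v v')
    (hQm : Measurable Q) (hQ : ∀ a b : ℝ, 0 < a → 0 < b → IntervalIntegrable Q volume a b)
    {l : Filter ℝ} [l.NeBot] {E : Set ℝ} (hEo : IsOpen E) (hEc : Convex ℝ E) (hE0 : E ⊆ Ioi 0)
    (hEl : E ∈ l) (hvE : ∀ r ∈ E, v r ≠ 0) (hlim : Tendsto (fun r => u r / v r) l (𝓝 1))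
    {b : ℝ → ℝ} (hb : Tendsto b l l) {c : ℝ} (hc : 0 < c)
    (hsd : ∀ᶠ r in l, r < b r ∧ Icc r (b r) ⊆ E ∧ ∃ θ : ℂ, ‖θ‖ ≤ 1 ∧
      ∀ x ∈ Icc r (b r), c / (b r - r) ≤ (θ / v x ^ 2).re) :
    EqOn u v (Ioi 0) := by
  obtain ⟨e, heE⟩ : E.Nonempty := Filter.nonempty_of_mem hEl
  have he0 : 0 < e := hE0 heE
  set W : ℂ := u e * v' e - v e * u' e with hW
  have hWc : ∀ r, 0 < r → u r * v' r - v r * u' r = W := fun r hr =>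
    hu.wronskian_const hv hr he0
  have hder : ∀ r ∈ E, HasDerivAt (fun r => u r / v r) (-(W / v r ^ 2)) r := by
    intro r hr
    have h1 := (hu.hasDerivAt r (hE0 hr)).div (hv.hasDerivAt r (hE0 hr)) (hvE r hr)
    refine h1.congr_deriv ?_
    rw [← hWc r (hE0 hr)]; ring
  -- The derivative of u/v is -W/v². Convergence of u/v makes its increments over [r, b r] tend to
  -- 0, whereas W ≠ 0 would keep them at least c|W|. The rotation θ allows 1/v² to have any phase,
  -- provided that phase is nearly constant on the window.
  have hW0 : W = 0 := by
    by_contra hne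
    have hWp : 0 < ‖W‖ := norm_pos_iff.2 hne
    have hdiff : Tendsto (fun r => ‖u (b r) / v (b r) - u r / v r‖) l (𝓝 0) := by
      simpa using ((hlim.comp hb).sub hlim).norm
    have hsmall := hdiff.eventually (gt_mem_nhds (mul_pos hWp hc))
    obtain ⟨r, hr1, hlt, hIcc, θ, hθ, hre⟩ := (hsmall.and hsd).exists
    have hbr : 0 < b r - r := sub_pos.2 hlt
    -- Multiplying by -θ times the conjugate of W makes the derivative of the real part |W|²
    -- Re(θ/v²), to which the mean value inequality applies.
    set f : ℝ → ℝ := fun x => (-(θ * (starRingEnd ℂ) W) * (u x / v x)).re with hf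
    have hfd : ∀ x ∈ Icc r (b r), HasDerivAt f (‖W‖ ^ 2 * (θ / v x ^ 2).re) x := by
      intro x hx
      have h1 := (hder x (hIcc hx)).const_mul (-(θ * (starRingEnd ℂ) W))
      have h2 := (Complex.reCLM.hasFDerivAt).comp_hasDerivAt x h1
      refine h2.congr_deriv ?_
      have h3 : -(θ * (starRingEnd ℂ) W) * -(W / v x ^ 2) =
          ((‖W‖ ^ 2 : ℝ) : ℂ) * (θ / v x ^ 2) := by
        have := Complex.mul_conj' W
        push_cast
        rw [← this]; ring
      rw [Complex.reCLM_apply, h3, Complex.re_ofReal_mul]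
    have hmv : ‖W‖ ^ 2 * c ≤ f (b r) - f r := by
      have := (convex_Icc r (b r)).mul_sub_le_image_sub_of_le_deriv (f := f)
        (C := ‖W‖ ^ 2 * (c / (b r - r)))
        (fun x hx => (hfd x hx).continuousAt.continuousWithinAt)
        (fun x hx => (hfd x (interior_subset hx)).differentiableAt.differentiableWithinAt)
        (fun x hx => by
          rw [(hfd x (interior_subset hx)).deriv]
          exact mul_le_mul_of_nonneg_left (hre x (interior_subset hx)) (by positivity))
        r (left_mem_Icc.2 hlt.le) (b r) (right_mem_Icc.2 hlt.le) hlt.le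
      have h4 : ‖W‖ ^ 2 * (c / (b r - r)) * (b r - r) = ‖W‖ ^ 2 * c := by
        field_simp
      rwa [h4] at this
    have hup : f (b r) - f r ≤ ‖W‖ * ‖u (b r) / v (b r) - u r / v r‖ := by
      simp only [hf]
      rw [← Complex.sub_re, ← mul_sub]
      refine (Complex.re_le_norm _).trans ?_
      rw [norm_mul, norm_neg, norm_mul, RCLike.norm_conj]
      gcongr
      exact mul_le_of_le_one_left (norm_nonneg _) hθ
    have : ‖W‖ * ‖u (b r) / v (b r) - u r / v r‖ < ‖W‖ * (‖W‖ * c) := by gcongr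
    nlinarith
  have hEq : EqOn u v E := by
    intro r hr
    have hconst : ∀ x ∈ E, u x / v x = u r / v r := fun x hx =>
      hEc.is_const_of_fderivWithin_eq_zero (𝕜 := ℝ) (f := fun r => u r / v r)
        (fun y hy => (hder y hy).differentiableAt.differentiableWithinAt)
        (fun y hy => by
          rw [(hder y hy).hasFDerivAt.hasFDerivWithinAt.fderivWithin (hEo.uniqueDiffWithinAt hy)]
          ext; simp [hW0]) hx hr
    have h1 : Tendsto (fun r => u r / v r) l (𝓝 (u r / v r)) :=
      tendsto_const_nhds.congr' (by filter_upwards [hEl] with x hx using (hconst x hx).symm)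
    have h2 := tendsto_nhds_unique h1 hlim
    rwa [div_eq_one_iff_eq (hvE r hr)] at h2
  have hd' : u' e = v' e := by
    refine (hu.hasDerivAt e he0).unique ((hv.hasDerivAt e he0).congr_of_eventuallyEq ?_)
    filter_upwards [hEo.mem_nhds heE] with x hx using hEq hx
  intro r hr
  have := (hu.sub hv).eqOn_zero hQm hQ he0 (by simp [hEq heE]) (by simp [hd']) hr
  simpa [sub_eq_zero] using this

/-! ### The regular solution at the origin -/

/-- The coefficient `(μ² - 1/4) / r² + V r + z` of the radial equation. -/
def radialCoeff (V : ℝ → ℝ) (μ : ℝ) (z : ℂ) (r : ℝ) : ℂ :=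
  (((μ ^ 2 - 1 / 4) / r ^ 2 + V r : ℝ) : ℂ) + z

/-- Kernel of the Volterra equation for `r ^ (-μ - 1/2)` times the regular solution. -/
def regularKernel (V : ℝ → ℝ) (μ : ℝ) (z : ℂ) (r s : ℝ) : ℂ :=
  {p : ℝ × ℝ | 0 < p.2 ∧ p.2 < p.1}.indicator
    (fun p => ((p.2 * (1 - (p.2 / p.1) ^ (2 * μ)) / (2 * μ) : ℝ) : ℂ) * (V p.2 + z)) (r, s)

/-- Majorant of `regularKernel` for `‖z‖ ≤ Λ`. -/
def regularMajorant (V : ℝ → ℝ) (μ Λ : ℝ) : ℝ → ℝ≥0∞ :=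
  (Ioi 0).indicator fun s => ENNReal.ofReal (s * (|V s| + Λ) / (2 * μ))

/-- `r ^ (-μ - 1/2)` times the regular solution. -/
def regularFactor (V : ℝ → ℝ) (μ : ℝ) (z : ℂ) (r : ℝ) : ℂ := volterraSol (regularKernel V μ z) r

/-- Weighted integrals of the regular solution against the potential. -/
def regularMoment (V : ℝ → ℝ) (μ : ℝ) (ω : ℝ → ℝ) (z : ℂ) (r : ℝ) : ℂ :=
  ∫ s in (0 : ℝ)..r, (ω s : ℂ) * ((V s + z) * regularFactor V μ z s)

/-- The regular solution for the coefficient `radialCoeff V μ z`, with `u ~ r ^ (1/2 + μ)` at `0`. -/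
def regularSol (V : ℝ → ℝ) (μ : ℝ) (z : ℂ) (r : ℝ) : ℂ :=
  (1 + regularMoment V μ (fun s => s / (2 * μ)) z r) * (r ^ (1 / 2 + μ) : ℝ) +
    regularMoment V μ (fun s => -s ^ (1 + 2 * μ) / (2 * μ)) z r * (r ^ (1 / 2 - μ) : ℝ)

/-- The derivative of `regularSol`. -/
def regularSolDeriv (V : ℝ → ℝ) (μ : ℝ) (z : ℂ) (r : ℝ) : ℂ :=
  (1 + regularMoment V μ (fun s => s / (2 * μ)) z r) *
      (((1 / 2 + μ) * r ^ (1 / 2 + μ - 1) : ℝ) : ℂ) +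
    regularMoment V μ (fun s => -s ^ (1 + 2 * μ) / (2 * μ)) z r *
      (((1 / 2 - μ) * r ^ (1 / 2 - μ - 1) : ℝ) : ℂ)

section Regular

variable {V : ℝ → ℝ} {μ : ℝ}

lemma measurable_regularMajorant (hVm : Measurable V) (Λ : ℝ) :
    Measurable (regularMajorant V μ Λ) := by
  refine Measurable.indicator ?_ measurableSet_Ioi
  fun_prop

lemma measurable_regularKernel (hVm : Measurable V) (z : ℂ) :
    Measurable (Function.uncurry (regularKernel V μ z)) := by
  refine Measurable.indicator (f := fun p : ℝ × ℝ =>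
    ((p.2 * (1 - (p.2 / p.1) ^ (2 * μ)) / (2 * μ) : ℝ) : ℂ) * (V p.2 + z)) ?_ ?_
  · have : Measurable fun p : ℝ × ℝ => V p.2 := hVm.comp measurable_snd
    fun_prop
  · exact (measurableSet_lt measurable_const measurable_snd).inter
      (measurableSet_lt measurable_snd measurable_fst)

lemma enorm_regularKernel_le (hμ : 0 < μ) {Λ : ℝ} {z : ℂ} (hz : ‖z‖ ≤ Λ) (r s : ℝ) :
    ‖regularKernel V μ z r s‖ₑ ≤ {s : ℝ | id s < id r}.indicator (regularMajorant V μ Λ) s := by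
  by_cases h : 0 < s ∧ s < r
  · have hr : 0 < r := h.1.trans h.2
    have hpow0 : 0 ≤ (s / r) ^ (2 * μ) := by have := h.1; positivity
    have hpow1 : (s / r) ^ (2 * μ) ≤ 1 :=
      Real.rpow_le_one (by have := h.1; positivity) ((div_le_one hr).2 h.2.le) (by positivity)
    simp only [regularKernel, regularMajorant, id, mem_ofPred_eq, h, indicator_of_mem, mem_Ioi,
      and_self]
    rw [← ofReal_norm]
    refine ENNReal.ofReal_le_ofReal ?_
    rw [norm_mul, Complex.norm_real, Real.norm_eq_abs, abs_div, abs_mul, abs_of_pos h.1,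
      abs_of_nonneg (sub_nonneg.2 hpow1), abs_of_pos (by positivity : 0 < 2 * μ), div_mul_eq_mul_div]
    have h1 : ‖(V s : ℂ) + z‖ ≤ |V s| + Λ := by
      refine (norm_add_le _ _).trans ?_
      rw [Complex.norm_real, Real.norm_eq_abs]; gcongr
    have h2 : s * (1 - (s / r) ^ (2 * μ)) ≤ s := by nlinarith [h.1]
    have := h.1.le
    gcongr
  · simp only [regularKernel]
    rw [indicator_of_notMem (by simpa using h)]
    simp

lemma differentiable_regularKernel (r s : ℝ) :
    Differentiable ℂ fun z => regularKernel V μ z r s := by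
  by_cases h : 0 < s ∧ s < r
  · have : (fun z => regularKernel V μ z r s) = fun z =>
        ((s * (1 - (s / r) ^ (2 * μ)) / (2 * μ) : ℝ) : ℂ) * (V s + z) := by
      ext z; simp only [regularKernel]; rw [indicator_of_mem (by simpa using h)]
    rw [this]; fun_prop
  · have : (fun z => regularKernel V μ z r s) = fun z => 0 := by
      ext z; simp only [regularKernel]; rw [indicator_of_notMem (by simpa using h)]
    rw [this]; fun_prop

lemma integrableOn_mul_abs_add (hV : IntegrableOn (fun s => s * |V s|) (Ioi 0)) (Λ R : ℝ) :
    IntegrableOn (fun s => s * (|V s| + Λ)) (Ioc 0 R) := by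
  have h1 : IntegrableOn (fun s => s * |V s|) (Ioc 0 R) := hV.mono_set Ioc_subset_Ioi_self
  have h2 : IntegrableOn (fun s : ℝ => s * Λ) (Ioc 0 R) :=
    (continuous_id.mul continuous_const).integrableOn_Ioc
  exact (h1.add h2).congr_fun (fun s _ => (mul_add s _ _).symm) measurableSet_Ioc

lemma regularMajorant_one_ne_top (hV : IntegrableOn (fun s => s * |V s|) (Ioi 0)) (Λ r : ℝ) :
    volterraMajorant id (regularMajorant V μ Λ) 1 (id r) ≠ ∞ := by
  rw [volterraMajorant_one, regularMajorant, setLIntegral_indicator measurableSet_Ioi]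
  have h : Ioi 0 ∩ {s : ℝ | id s < id r} ⊆ Ioc 0 r := fun s hs => ⟨hs.1, le_of_lt hs.2⟩
  have hi : IntegrableOn (fun s => s * (|V s| + Λ) / (2 * μ)) (Ioi 0 ∩ {s : ℝ | id s < id r}) :=
    IntegrableOn.mono_set ((integrableOn_mul_abs_add hV Λ r).div_const (2 * μ)) h
  refine (lt_of_le_of_lt (lintegral_mono fun s => ?_) hi.2).ne
  rw [← ofReal_norm]
  exact ENNReal.ofReal_le_ofReal (le_abs_self _)

/-- The majorant is the mass of (0, r) for the measure with density `regularMajorant`. The intervals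
decrease to the empty set and the mass is finite at r = 1, so it tends to 0. -/
lemma tendsto_regularMajorant_one (hV : IntegrableOn (fun s => s * |V s|) (Ioi 0)) (Λ : ℝ) :
    Tendsto (fun r => volterraMajorant id (regularMajorant V μ Λ) 1 r) (𝓝[>] 0) (𝓝 0) := by
  have hmono := volterraMajorant_mono (ρ := id) (q := regularMajorant V μ Λ) 1
  have h1 : ∀ r, volterraMajorant id (regularMajorant V μ Λ) 1 r =
      (volume.withDensity (regularMajorant V μ Λ)) (Iio r) := by
    intro r
    rw [volterraMajorant_one, withDensity_apply _ measurableSet_Iio]; rfl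
  have h2 : ∀ r, (volume.withDensity (regularMajorant V μ Λ)) (Iio r) =
      (volume.withDensity (regularMajorant V μ Λ)) (Ioo 0 r) := by
    intro r
    rw [withDensity_apply _ measurableSet_Iio, withDensity_apply _ measurableSet_Ioo,
      regularMajorant, setLIntegral_indicator measurableSet_Ioi,
      setLIntegral_indicator measurableSet_Ioi]
    congr 2
    ext s; simp
  have h3 := tendsto_measure_biInter_gt (μ := volume.withDensity (regularMajorant V μ Λ))
    (s := fun r => Ioo (0 : ℝ) r) (a := 0) (fun r _ => measurableSet_Ioo.nullMeasurableSet)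
    (fun i j _ hij => Ioo_subset_Ioo_right hij)
    ⟨1, one_pos, by rw [← h2, ← h1]; exact regularMajorant_one_ne_top hV Λ 1⟩
  have h4 : (⋂ r, ⋂ (_ : (0 : ℝ) < r), Ioo 0 r) = ∅ := by
    ext s
    simp only [mem_iInter, mem_Ioo, mem_empty_iff_false, iff_false, not_forall]
    by_cases hs : 0 < s
    · exact ⟨s, hs, fun h => lt_irrefl _ h.2⟩
    · exact ⟨1, one_pos, fun h => hs h.1⟩
  rw [h4, measure_empty] at h3
  refine h3.congr fun r => ?_
  simp [h1, h2]

lemma norm_regularFactor_le (hμ : 0 < μ) (hVm : Measurable V)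
    (hV : IntegrableOn (fun s => s * |V s|) (Ioi 0)) {Λ : ℝ} {z : ℂ} (hz : ‖z‖ ≤ Λ) {s r : ℝ}
    (hsr : s ≤ r) : ‖regularFactor V μ z s‖ ≤
      Real.exp (volterraMajorant id (regularMajorant V μ Λ) 1 r).toReal := by
  have h1 := enorm_volterraSol_le measurable_id (measurable_regularMajorant (μ := μ) hVm Λ)
    (enorm_regularKernel_le hμ hz) (regularMajorant_one_ne_top hV Λ s)
  have h2 := (ENNReal.ofReal_le_ofReal_iff (Real.exp_pos _).le).1 ((ofReal_norm _).trans_le h1)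
  refine h2.trans (Real.exp_le_exp.2 (ENNReal.toReal_mono (regularMajorant_one_ne_top hV Λ r) ?_))
  exact volterraMajorant_mono 1 hsr

lemma measurable_regularFactor (hVm : Measurable V) (z : ℂ) :
    Measurable (regularFactor V μ z) := measurable_volterraSol (measurable_regularKernel hVm z)

lemma differentiable_regularFactor (hμ : 0 < μ) (hVm : Measurable V)
    (hV : IntegrableOn (fun s => s * |V s|) (Ioi 0)) (r : ℝ) :
    Differentiable ℂ fun z => regularFactor V μ z r := by
  intro z
  have hz : z ∈ Metric.ball (0 : ℂ) (‖z‖ + 1) := by simp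
  refine (differentiableOn_volterraSol (ρ := id) measurable_id
    (measurable_regularMajorant (μ := μ) hVm (‖z‖ + 1)) Metric.isOpen_ball
    (fun w _ => measurable_regularKernel hVm w)
    (fun w hw => enorm_regularKernel_le hμ (mem_ball_zero_iff.1 hw).le)
    (fun r s => (differentiable_regularKernel r s).differentiableOn)
    (regularMajorant_one_ne_top hV _ r)).differentiableAt (Metric.isOpen_ball.mem_nhds hz)

lemma norm_regularMoment_integrand_le (hμ : 0 < μ) (hVm : Measurable V)
    (hV : IntegrableOn (fun s => s * |V s|) (Ioi 0)) {ω : ℝ → ℝ} {C r : ℝ}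
    (hω : ∀ s ∈ Ioc 0 r, |ω s| ≤ C * s) {Λ : ℝ} {z : ℂ} (hz : ‖z‖ ≤ Λ) {s : ℝ} (hs : s ∈ Ioc 0 r) :
    ‖(ω s : ℂ) * ((V s + z) * regularFactor V μ z s)‖ ≤
      C * Real.exp (volterraMajorant id (regularMajorant V μ Λ) 1 r).toReal *
        (s * (|V s| + Λ)) := by
  have h1 : ‖(V s : ℂ) + z‖ ≤ |V s| + Λ := by
    refine (norm_add_le _ _).trans ?_
    rw [Complex.norm_real, Real.norm_eq_abs]; gcongr
  have h2 := norm_regularFactor_le hμ hVm hV hz hs.2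
  have hC : 0 ≤ C * s := (abs_nonneg _).trans (hω s hs)
  rw [norm_mul, norm_mul, Complex.norm_real, Real.norm_eq_abs]
  calc _ ≤ (C * s) * ((|V s| + Λ) *
        Real.exp (volterraMajorant id (regularMajorant V μ Λ) 1 r).toReal) := by
        gcongr
        · exact hω s hs
        · exact (norm_nonneg _).trans h1
    _ = _ := by ring

lemma intervalIntegrable_regularMoment (hμ : 0 < μ) (hVm : Measurable V)
    (hV : IntegrableOn (fun s => s * |V s|) (Ioi 0)) {ω : ℝ → ℝ} (hωm : Measurable ω) {C r : ℝ}
    (hr : 0 ≤ r) (hω : ∀ s ∈ Ioc 0 r, |ω s| ≤ C * s) (z : ℂ) :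
    IntervalIntegrable (fun s => (ω s : ℂ) * ((V s + z) * regularFactor V μ z s)) volume 0 r := by
  rw [intervalIntegrable_iff_integrableOn_Ioc_of_le hr]
  refine Integrable.mono' ((integrableOn_mul_abs_add hV ‖z‖ r).const_mul _) ?_
    ((ae_restrict_mem measurableSet_Ioc).mono fun s hs =>
      norm_regularMoment_integrand_le hμ hVm hV hω le_rfl hs)
  have := measurable_regularFactor (μ := μ) hVm z
  exact Measurable.aestronglyMeasurable (by fun_prop)

lemma differentiable_regularMoment (hμ : 0 < μ) (hVm : Measurable V)
    (hV : IntegrableOn (fun s => s * |V s|) (Ioi 0)) {ω : ℝ → ℝ} (hωm : Measurable ω) {C r : ℝ}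
    (hr : 0 ≤ r) (hω : ∀ s ∈ Ioc 0 r, |ω s| ≤ C * s) :
    Differentiable ℂ fun z => regularMoment V μ ω z r := by
  rw [← differentiableOn_univ]
  simp only [regularMoment, intervalIntegral.integral_of_le hr]
  refine differentiableOn_integral_of_locally_dominated isOpen_univ (fun z _ => ?_)
    (ae_of_all _ fun s => ?_) fun z₀ _ => ?_
  · have := measurable_regularFactor (μ := μ) hVm z
    exact Measurable.aestronglyMeasurable (by fun_prop)
  · have := differentiable_regularFactor hμ hVm hV s
    exact Differentiable.differentiableOn (by fun_prop)
  · refine ⟨_, (integrableOn_mul_abs_add hV (‖z₀‖ + 1) r).const_mul (C * Real.exp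
      (volterraMajorant id (regularMajorant V μ (‖z₀‖ + 1)) 1 r).toReal),
      Metric.ball z₀ 1, Metric.ball_mem_nhds _ one_pos, ?_⟩
    filter_upwards [ae_restrict_mem measurableSet_Ioc] with s hs z hz
    refine norm_regularMoment_integrand_le hμ hVm hV hω ?_ hs
    have h1 := norm_sub_norm_le z z₀
    have h2 := mem_ball_iff_norm.1 hz
    linarith

lemma exists_norm_regularMoment_le (hμ : 0 < μ) (hVm : Measurable V)
    (hV : IntegrableOn (fun s => s * |V s|) (Ioi 0)) {ω : ℝ → ℝ} {C r : ℝ}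
    (hr : 0 ≤ r) (hω : ∀ s ∈ Ioc 0 r, |ω s| ≤ C * s) (Λ : ℝ) :
    ∃ D, ∀ z : ℂ, ‖z‖ ≤ Λ → ‖regularMoment V μ ω z r‖ ≤ D := by
  refine ⟨∫ s in Ioc 0 r, C * Real.exp (volterraMajorant id (regularMajorant V μ Λ) 1 r).toReal *
        (s * (|V s| + Λ)), fun z hz => ?_⟩
  rw [regularMoment, intervalIntegral.integral_of_le hr]
  exact norm_integral_le_of_norm_le ((integrableOn_mul_abs_add hV Λ r).const_mul _)
    ((ae_restrict_mem measurableSet_Ioc).mono fun s hs =>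
      norm_regularMoment_integrand_le hμ hVm hV hω hz hs)

lemma hasPrimitive_regularMoment (hμ : 0 < μ) (hVm : Measurable V)
    (hV : IntegrableOn (fun s => s * |V s|) (Ioi 0)) {ω : ℝ → ℝ} (hωm : Measurable ω)
    (hω : ∀ r, 0 ≤ r → ∃ C, ∀ s ∈ Ioc 0 r, |ω s| ≤ C * s) (z : ℂ) :
    HasPrimitive (regularMoment V μ ω z)
      (fun s => (ω s : ℂ) * ((V s + z) * regularFactor V μ z s)) := by
  intro a b ha hab
  obtain ⟨C, hC⟩ := hω b (ha.le.trans hab)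
  have hb := intervalIntegrable_regularMoment hμ hVm hV hωm (ha.le.trans hab) hC z
  have ha' : IntervalIntegrable (fun s => (ω s : ℂ) * ((V s + z) * regularFactor V μ z s))
      volume 0 a := hb.mono_set (by
        rw [uIcc_of_le ha.le, uIcc_of_le (ha.le.trans hab)]; exact Icc_subset_Icc_right hab)
  exact ⟨ha'.symm.trans hb, intervalIntegral.integral_interval_sub_left hb ha'⟩

/-- Both weights are O(s) near 0, which is what integrability of s|V(s)| requires for the moments to
converge. -/
lemma regularWeight₁ (hμ : 0 < μ) (r : ℝ) :
    ∀ s ∈ Ioc 0 r, |s / (2 * μ)| ≤ 1 / (2 * μ) * s := fun s hs => by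
  rw [abs_of_pos (div_pos hs.1 (by positivity))]
  exact le_of_eq (by ring)

lemma regularWeight₂ (hμ : 0 < μ) (r : ℝ) :
    ∀ s ∈ Ioc 0 r, |-s ^ (1 + 2 * μ) / (2 * μ)| ≤ r ^ (2 * μ) / (2 * μ) * s := fun s hs => by
  rw [abs_div, abs_neg, abs_of_pos (Real.rpow_pos_of_pos hs.1 _),
    abs_of_pos (by positivity : 0 < 2 * μ), Real.rpow_add hs.1, Real.rpow_one, div_mul_eq_mul_div,
    mul_comm s]
  have := hs.1.le
  have := Real.rpow_le_rpow hs.1.le hs.2 (by positivity : 0 ≤ 2 * μ)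
  gcongr

/-- Expanding 1 - (s/r)^(2μ) separates the variables in the Volterra kernel, and the two terms give
the coefficients of r^(1/2+μ) and r^(1/2-μ). -/
lemma regularSol_eq (hμ : 0 < μ) (hVm : Measurable V)
    (hV : IntegrableOn (fun s => s * |V s|) (Ioi 0)) (z : ℂ) {r : ℝ} (hr : 0 < r) :
    regularSol V μ z r = (r ^ (1 / 2 + μ) : ℝ) * regularFactor V μ z r := by
  have h1 := volterraSol_eq measurable_id (measurable_regularMajorant (μ := μ) hVm ‖z‖)
    (measurable_regularKernel hVm z) (enorm_regularKernel_le hμ le_rfl)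
    (regularMajorant_one_ne_top hV ‖z‖ r)
  change regularFactor V μ z r = _ at h1
  have h2 : ∫ s, regularKernel V μ z r s * volterraSol (regularKernel V μ z) s =
      ∫ s in (0 : ℝ)..r, (((s / (2 * μ) : ℝ) : ℂ) * ((V s + z) * regularFactor V μ z s) +
        ((r ^ (2 * μ))⁻¹ : ℝ) * (((-s ^ (1 + 2 * μ) / (2 * μ) : ℝ) : ℂ) *
          ((V s + z) * regularFactor V μ z s))) := by
    rw [intervalIntegral.integral_of_le hr.le, integral_Ioc_eq_integral_Ioo,
      ← integral_indicator measurableSet_Ioo]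
    congr 1; ext s
    by_cases hs : s ∈ Ioo 0 r
    · have hs' : (r, s) ∈ {p : ℝ × ℝ | 0 < p.2 ∧ p.2 < p.1} := hs
      simp only [regularKernel, indicator_of_mem hs, indicator_of_mem hs']
      change _ * regularFactor V μ z s = _
      have e1 : (s * (1 - (s / r) ^ (2 * μ)) / (2 * μ) : ℝ) =
          s / (2 * μ) + (r ^ (2 * μ))⁻¹ * (-s ^ (1 + 2 * μ) / (2 * μ)) := by
        rw [Real.div_rpow hs.1.le hr.le, Real.rpow_add hs.1, Real.rpow_one]; ring
      rw [e1]; push_cast; ring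
    · have hs' : (r, s) ∉ {p : ℝ × ℝ | 0 < p.2 ∧ p.2 < p.1} := hs
      simp only [regularKernel, indicator_of_notMem hs, indicator_of_notMem hs', zero_mul]
  rw [h2, intervalIntegral.integral_add
    (intervalIntegrable_regularMoment hμ hVm hV (by fun_prop) hr.le (regularWeight₁ hμ r) z)
    ((intervalIntegrable_regularMoment hμ hVm hV (by fun_prop) hr.le
      (regularWeight₂ hμ r) z).const_mul _), intervalIntegral.integral_const_mul] at h1
  have h3 : ((r ^ (1 / 2 - μ) : ℝ) : ℂ) = ((r ^ (2 * μ))⁻¹ : ℝ) * (r ^ (1 / 2 + μ) : ℝ) := by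
    rw [← Complex.ofReal_mul, ← Real.rpow_neg hr.le, ← Real.rpow_add hr]
    congr 2; ring
  rw [h1, regularSol, h3]
  simp only [regularMoment]
  ring

lemma measurable_radialCoeff (hVm : Measurable V) (z : ℂ) : Measurable (radialCoeff V μ z) := by
  unfold radialCoeff; fun_prop

lemma intervalIntegrable_of_mul_abs (hVm : Measurable V)
    (hV : IntegrableOn (fun s => s * |V s|) (Ioi 0)) {a b : ℝ} (ha : 0 < a) (hb : 0 < b) :
    IntervalIntegrable V volume a b := by
  have hm : 0 < min a b := lt_min ha hb
  rw [intervalIntegrable_iff]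
  refine Integrable.mono' ((hV.mono_set (t := Ioi 0) (s := uIoc a b)
    (uIoc_subset_uIcc.trans (uIcc_subset_Ioi_zero ha hb))).const_mul (min a b)⁻¹)
    hVm.aestronglyMeasurable ?_
  filter_upwards [ae_restrict_mem measurableSet_uIoc] with s hs
  rw [Real.norm_eq_abs, ← mul_assoc]
  refine le_mul_of_one_le_left (abs_nonneg _) ?_
  rw [inv_mul_eq_div, one_le_div hm]
  exact hs.1.le

lemma intervalIntegrable_radialCoeff (hVm : Measurable V)
    (hV : IntegrableOn (fun s => s * |V s|) (Ioi 0)) (z : ℂ) {a b : ℝ} (ha : 0 < a) (hb : 0 < b) :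
    IntervalIntegrable (radialCoeff V μ z) volume a b := by
  have h1 : ContinuousOn (fun r : ℝ => (((μ ^ 2 - 1 / 4) / r ^ 2 : ℝ) : ℂ) + z) (uIcc a b) := by
    refine ContinuousOn.add (Complex.continuous_ofReal.comp_continuousOn
      (continuousOn_const.div (by fun_prop) fun r hr => ?_)) continuousOn_const
    have : 0 < r := uIcc_subset_Ioi_zero ha hb hr
    positivity
  have h2 : IntervalIntegrable (fun r => (V r : ℂ)) volume a b :=
    ⟨(intervalIntegrable_of_mul_abs hVm hV ha hb).1.ofReal,
      (intervalIntegrable_of_mul_abs hVm hV ha hb).2.ofReal⟩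
  refine (h1.intervalIntegrable.add h2).congr fun r _ => ?_
  simp only [radialCoeff]; push_cast; ring

lemma hasDerivAt_ofReal_rpow {r : ℝ} (hr : 0 < r) (s : ℝ) :
    HasDerivAt (fun r : ℝ => ((r ^ s : ℝ) : ℂ)) ((s * r ^ (s - 1) : ℝ) : ℂ) r :=
  (Real.hasDerivAt_rpow_const (Or.inl hr.ne')).ofReal_comp

lemma isSol_regularSol (hμ : 0 < μ) (hVm : Measurable V)
    (hV : IntegrableOn (fun s => s * |V s|) (Ioi 0)) (z : ℂ) :
    IsSol (radialCoeff V μ z) (regularSol V μ z) (regularSolDeriv V μ z) := by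
  have hfac : ∀ r : ℝ, 0 < r → ∀ s : ℝ, s * (s - 1) = μ ^ 2 - 1 / 4 →
      HasDerivAt (fun r : ℝ => ((s * r ^ (s - 1) : ℝ) : ℂ))
        ((((μ ^ 2 - 1 / 4) / r ^ 2 : ℝ) : ℂ) * (r ^ s : ℝ)) r := by
    intro r hr s hs
    have h1 := ((Real.hasDerivAt_rpow_const (p := s - 1) (Or.inl hr.ne')).const_mul s).ofReal_comp
    refine h1.congr_deriv ?_
    rw [← Complex.ofReal_mul, ← hs]
    congr 1
    rw [show s - 1 - 1 = s - (2 : ℕ) by push_cast; ring, Real.rpow_sub_natCast hr.ne']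
    ring
  -- The powers r^(1/2+μ) and r^(1/2-μ) have Wronskian -2μ, so f is (V + z)u divided by it, with u
  -- written as r^(1/2+μ) times `regularFactor`.
  set f : ℝ → ℂ := fun s =>
    -((V s + z) * regularFactor V μ z s * (s ^ (1 / 2 + μ) : ℝ)) / (2 * μ) with hf
  have hμc : (μ : ℂ) ≠ 0 := by exact_mod_cast hμ.ne'
  refine IsSol.of_variation (f := f) (Q₀ := fun r => (((μ ^ 2 - 1 / 4) / r ^ 2 : ℝ) : ℂ))
    (fun r hr => hasDerivAt_ofReal_rpow hr _) (fun r hr => hasDerivAt_ofReal_rpow hr _)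
    (fun r hr => hfac r hr _ (by ring)) (fun r hr => hfac r hr _ (by ring)) ?_ ?_ ?_ ?_ ?_
  · refine Complex.continuous_ofReal.comp_continuousOn
      (continuousOn_const.div (by fun_prop) fun r hr => ?_)
    have : 0 < r := hr
    positivity
  · intro a b ha hb
    have h1 := (hasPrimitive_regularMoment hμ hVm hV (ω := fun s => s / (2 * μ)) (by fun_prop)
      (fun r _ => ⟨_, regularWeight₁ hμ r⟩) z).intervalIntegrable ha hb
    have hc : ContinuousOn (fun s : ℝ => -((s ^ (1 / 2 + μ - 1) : ℝ) : ℂ)) (uIcc a b) := by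
      refine (Complex.continuous_ofReal.comp_continuousOn fun r hr => ?_).neg
      exact (Real.continuousAt_rpow_const _ _
        (Or.inl (uIcc_subset_Ioi_zero ha hb hr).ne')).continuousWithinAt
    refine (h1.continuousOn_mul hc).congr fun s hs => ?_
    have hs : 0 < s := uIcc_subset_Ioi_zero ha hb (uIoc_subset_uIcc hs)
    have e : s ^ (1 / 2 + μ) = s ^ (1 / 2 + μ - 1) * s := by
      rw [Real.rpow_sub_one hs.ne']; field_simp
    simp only [hf, e]; push_cast; ring
  · refine ((hasPrimitive_regularMoment hμ hVm hV (ω := fun s => s / (2 * μ)) (by fun_prop)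
      (fun r _ => ⟨_, regularWeight₁ hμ r⟩) z).add
      (HasPrimitive.of_hasDerivAt (A := fun _ => 1) (f := fun _ => 0)
        (fun r _ => hasDerivAt_const r 1) continuousOn_const)).congr (fun r _ => by ring) ?_
    intro s hs
    have hs : 0 < s := hs
    have e : s ^ (1 / 2 - μ) * s ^ (1 / 2 + μ) = s := by
      rw [← Real.rpow_add hs]; norm_num
    have e' : ((s ^ (1 / 2 - μ) : ℝ) : ℂ) * (s ^ (1 / 2 + μ) : ℝ) = s := by exact_mod_cast e
    simp only [hf]; push_cast
    linear_combination (-(V s + z) * regularFactor V μ z s / (2 * μ)) * e'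
  · refine (hasPrimitive_regularMoment hμ hVm hV (ω := fun s => -s ^ (1 + 2 * μ) / (2 * μ))
      (by fun_prop) (fun r _ => ⟨_, regularWeight₂ hμ r⟩) z).congr (fun r _ => rfl) ?_
    intro s hs
    have hs : 0 < s := hs
    have e : s ^ (1 / 2 + μ) * s ^ (1 / 2 + μ) = s ^ (1 + 2 * μ) := by
      rw [← Real.rpow_add hs]; congr 1; ring
    simp only [hf]
    rw [← e]; push_cast
    ring
  · intro r hr
    change _ = (_ - _) * regularSol V μ z r
    rw [regularSol_eq hμ hVm hV z hr]
    have e1 : r ^ (1 / 2 + μ) * r ^ (1 / 2 - μ - 1) = 1 := by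
      rw [← Real.rpow_add hr]; ring_nf; simp
    have e2 : r ^ (1 / 2 - μ) * r ^ (1 / 2 + μ - 1) = 1 := by
      rw [← Real.rpow_add hr]; ring_nf; simp
    have e1' : ((r ^ (1 / 2 + μ) : ℝ) : ℂ) * (r ^ (1 / 2 - μ - 1) : ℝ) = 1 := by exact_mod_cast e1
    have e2' : ((r ^ (1 / 2 - μ) : ℝ) : ℂ) * (r ^ (1 / 2 + μ - 1) : ℝ) = 1 := by exact_mod_cast e2
    have hw : ((r ^ (1 / 2 + μ) : ℝ) : ℂ) * (((1 / 2 - μ) * r ^ (1 / 2 - μ - 1) : ℝ) : ℂ) -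
        ((r ^ (1 / 2 - μ) : ℝ) : ℂ) * (((1 / 2 + μ) * r ^ (1 / 2 + μ - 1) : ℝ) : ℂ) =
        -(2 * μ) := by
      rw [Complex.ofReal_mul, Complex.ofReal_mul]; push_cast
      linear_combination (1 / 2 - μ) * e1' - (1 / 2 + μ) * e2'
    rw [hw]
    simp only [hf, radialCoeff, Complex.ofReal_add]
    generalize (((r ^ (1 / 2 + μ) : ℝ)) : ℂ) = A
    field_simp
    ring

lemma tendsto_regularFactor (hμ : 0 < μ) (hVm : Measurable V)
    (hV : IntegrableOn (fun s => s * |V s|) (Ioi 0)) (z : ℂ) :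
    Tendsto (regularFactor V μ z) (𝓝[>] 0) (𝓝 1) := by
  rw [tendsto_iff_norm_sub_tendsto_zero]
  have h0 := tendsto_regularMajorant_one (μ := μ) hV ‖z‖
  have h1 : Tendsto (fun r => (volterraMajorant id (regularMajorant V μ ‖z‖) 1 r).toReal)
      (𝓝[>] 0) (𝓝 0) := (ENNReal.tendsto_toReal ENNReal.zero_ne_top).comp h0
  have h2 := h1.mul ((Real.continuous_exp.tendsto 0).comp h1)
  rw [zero_mul] at h2
  refine squeeze_zero (fun _ => norm_nonneg _) (fun r => ?_) h2
  have h3 := enorm_volterraSol_sub_one_le measurable_id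
    (measurable_regularMajorant (μ := μ) hVm ‖z‖) (measurable_regularKernel hVm z)
    (enorm_regularKernel_le hμ le_rfl) (regularMajorant_one_ne_top hV ‖z‖ r)
  have h4 := ENNReal.toReal_mono (ENNReal.mul_ne_top (regularMajorant_one_ne_top hV ‖z‖ r)
    ENNReal.ofReal_ne_top) h3
  rw [toReal_enorm, ENNReal.toReal_mul, ENNReal.toReal_ofReal (Real.exp_pos _).le] at h4
  exact h4

lemma differentiable_regularSol (hμ : 0 < μ) (hVm : Measurable V)
    (hV : IntegrableOn (fun s => s * |V s|) (Ioi 0)) {r : ℝ} (hr : 0 ≤ r) :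
    (Differentiable ℂ fun z => regularSol V μ z r) ∧
      Differentiable ℂ fun z => regularSolDeriv V μ z r := by
  have h1 := differentiable_regularMoment hμ hVm hV (ω := fun s => s / (2 * μ)) (by fun_prop) hr
    (regularWeight₁ hμ r)
  have h2 := differentiable_regularMoment hμ hVm hV (ω := fun s => -s ^ (1 + 2 * μ) / (2 * μ))
    (by fun_prop) hr (regularWeight₂ hμ r)
  unfold regularSol regularSolDeriv
  constructor <;> fun_prop

lemma exists_norm_regularSol_le (hμ : 0 < μ) (hVm : Measurable V)
    (hV : IntegrableOn (fun s => s * |V s|) (Ioi 0)) (Λ : ℝ) :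
    ∃ D, ∀ z : ℂ, ‖z‖ ≤ Λ → ‖regularSol V μ z 1‖ ≤ D ∧ ‖regularSolDeriv V μ z 1‖ ≤ D := by
  obtain ⟨D₁, h₁⟩ := exists_norm_regularMoment_le hμ hVm hV zero_le_one (regularWeight₁ hμ 1) Λ
  obtain ⟨D₂, h₂⟩ := exists_norm_regularMoment_le hμ hVm hV zero_le_one (regularWeight₂ hμ 1) Λ
  refine ⟨max ((1 + D₁) + D₂) ((1 + D₁) * |1 / 2 + μ| + D₂ * |1 / 2 - μ|), fun z hz => ⟨?_, ?_⟩⟩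
  · refine le_trans ?_ (le_max_left _ _)
    simp only [regularSol, Real.one_rpow, Complex.ofReal_one, mul_one]
    refine (norm_add_le _ _).trans (add_le_add ((norm_add_le _ _).trans ?_) (h₂ z hz))
    rw [norm_one]; gcongr; exact h₁ z hz
  · refine le_trans ?_ (le_max_right _ _)
    simp only [regularSolDeriv, Real.one_rpow, mul_one]
    refine (norm_add_le _ _).trans (add_le_add ?_ ?_)
    · rw [norm_mul, Complex.norm_real, Real.norm_eq_abs]
      gcongr
      refine (norm_add_le _ _).trans ?_
      rw [norm_one]; gcongr; exact h₁ z hz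
    · rw [norm_mul, Complex.norm_real, Real.norm_eq_abs]
      gcongr; exact h₂ z hz

lemma integrableOn_Ioi_one_potential (hVm : Measurable V)
    (hV : IntegrableOn (fun s => s * |V s|) (Ioi 0)) : IntegrableOn V (Ioi 1) := by
  refine Integrable.mono' (hV.mono_set (Ioi_subset_Ioi zero_le_one)) hVm.aestronglyMeasurable ?_
  filter_upwards [ae_restrict_mem measurableSet_Ioi] with s hs
  exact le_mul_of_one_le_left (abs_nonneg _) (le_of_lt hs)

lemma integrableOn_Ioi_one_radial (hVm : Measurable V)
    (hV : IntegrableOn (fun s => s * |V s|) (Ioi 0)) :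
    IntegrableOn (fun r => (((μ ^ 2 - 1 / 4) / r ^ 2 + V r : ℝ) : ℂ)) (Ioi 1) := by
  refine Integrable.ofReal (Integrable.add ?_ (integrableOn_Ioi_one_potential hVm hV))
  have h := (integrableOn_Ioi_rpow_of_lt (a := -2) (by norm_num) one_pos).const_mul (μ ^ 2 - 1 / 4)
  refine h.congr ?_
  filter_upwards [ae_restrict_mem measurableSet_Ioi] with r hr
  have hr : (0 : ℝ) < r := one_pos.trans hr
  rw [show (-2 : ℝ) = -((2 : ℕ) : ℝ) by norm_num, Real.rpow_neg hr.le, Real.rpow_natCast]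
  rfl

/-- Growth of the regular solution at infinity, uniformly for `z` in an annulus. -/
lemma exists_norm_regularSol_le_exp (hμ : 0 < μ) (hVm : Measurable V)
    (hV : IntegrableOn (fun s => s * |V s|) (Ioi 0)) {δ : ℝ} (hδ : 0 < δ) (Λ : ℝ) :
    ∃ D, 0 ≤ D ∧ ∀ z : ℂ, δ ≤ ‖z‖ → ‖z‖ ≤ Λ → ∀ r, 1 ≤ r →
      ‖regularSol V μ (z ^ 2) r‖ ≤ D * Real.exp (|z.re| * r) ∧
      ‖regularSolDeriv V μ (z ^ 2) r‖ ≤ D * Real.exp (|z.re| * r) := by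
  obtain ⟨D, hD⟩ := exists_norm_regularSol_le hμ hVm hV (Λ ^ 2)
  set I := ∫ s in Ioi 1, ‖(((μ ^ 2 - 1 / 4) / s ^ 2 + V s : ℝ) : ℂ)‖ with hI
  have hI0 : 0 ≤ I := integral_nonneg fun _ => norm_nonneg _
  set M := (|D| + |Λ| * |D|) * Real.exp (I / δ) with hM
  have hM0 : 0 ≤ M := by positivity
  -- M bounds the derivative; M/δ bounds the solution, whose estimate carries a factor ‖z‖ ≥ δ.
  refine ⟨max M (M / δ), le_max_of_le_left hM0, fun z hδz hzΛ r hr => ?_⟩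
  have hzp : 0 < ‖z‖ := hδ.trans_le hδz
  have hz2 : ‖z ^ 2‖ ≤ Λ ^ 2 := by rw [norm_pow]; gcongr
  obtain ⟨hb1, hb2⟩ := hD (z ^ 2) hz2
  obtain ⟨g1, g2⟩ := (isSol_regularSol hμ hVm hV (z ^ 2)).norm_le_exp (norm_pos_iff.1 hzp)
    (by fun_prop) (integrableOn_Ioi_one_radial hVm hV) hr
  have hle : (‖regularSolDeriv V μ (z ^ 2) 1‖ + ‖z‖ * ‖regularSol V μ (z ^ 2) 1‖) *
      Real.exp (I / ‖z‖) * Real.exp (|z.re| * (r - 1)) ≤ M * Real.exp (|z.re| * r) := by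
    have := hb2.trans (le_abs_self D)
    have := hb1.trans (le_abs_self D)
    have := hzΛ.trans (le_abs_self Λ)
    rw [hM]
    gcongr
    linarith
  refine ⟨?_, (g1.trans hle).trans (by gcongr; exact le_max_left _ _)⟩
  calc ‖regularSol V μ (z ^ 2) r‖ = ‖z‖ * ‖regularSol V μ (z ^ 2) r‖ / ‖z‖ := by field_simp
    _ ≤ M * Real.exp (|z.re| * r) / δ := by
        exact div_le_div₀ (by positivity) (g2.trans hle) hδ hδz
    _ = M / δ * Real.exp (|z.re| * r) := by ring
    _ ≤ _ := by gcongr; exact le_max_right _ _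

end Regular

/-! ### The Jost solution at infinity, and uniqueness at both ends -/

/-- The potential `(μ² - 1/4) / r² + V`. -/
def radialPotential (V : ℝ → ℝ) (μ : ℝ) (r : ℝ) : ℝ := (μ ^ 2 - 1 / 4) / r ^ 2 + V r

/-- Kernel of the Volterra equation for `exp (z r)` times the Jost solution. -/
def jostKernel (V : ℝ → ℝ) (μ : ℝ) (z : ℂ) (r s : ℝ) : ℂ :=
  {p : ℝ × ℝ | 0 < p.1 ∧ p.1 < p.2}.indicator
    (fun p => (1 - Complex.exp (-(2 * z * (p.2 - p.1)))) / (2 * z) * radialPotential V μ p.2) (r, s)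

/-- Majorant of `jostKernel`. -/
def jostMajorant (V : ℝ → ℝ) (μ : ℝ) (z : ℂ) : ℝ → ℝ≥0∞ :=
  (Ioi 0).indicator fun s => ENNReal.ofReal (|radialPotential V μ s| / ‖z‖)

/-- `exp (z r)` times the Jost solution. -/
def jostFactor (V : ℝ → ℝ) (μ : ℝ) (z : ℂ) (r : ℝ) : ℂ := volterraSol (jostKernel V μ z) r

/-- Weighted tail integrals of the Jost solution against the potential. -/
def jostMoment (V : ℝ → ℝ) (μ : ℝ) (z : ℂ) (ω : ℝ → ℂ) (r : ℝ) : ℂ :=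
  ∫ s in Ioi r, ω s * (radialPotential V μ s * jostFactor V μ z s)

section Jost

variable {V : ℝ → ℝ} {μ : ℝ} {z : ℂ}

lemma measurable_radialPotential (hVm : Measurable V) : Measurable (radialPotential V μ) := by
  unfold radialPotential; fun_prop

lemma measurable_jostMajorant (hVm : Measurable V) : Measurable (jostMajorant V μ z) := by
  have := measurable_radialPotential (μ := μ) hVm
  refine Measurable.indicator ?_ measurableSet_Ioi
  fun_prop

lemma measurable_jostKernel (hVm : Measurable V) :
    Measurable (Function.uncurry (jostKernel V μ z)) := by
  refine Measurable.indicator (f := fun p : ℝ × ℝ =>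
    (1 - Complex.exp (-(2 * z * (p.2 - p.1)))) / (2 * z) * radialPotential V μ p.2) ?_ ?_
  · have : Measurable fun p : ℝ × ℝ => radialPotential V μ p.2 :=
      (measurable_radialPotential hVm).comp measurable_snd
    fun_prop
  · exact (measurableSet_lt measurable_const measurable_fst).inter
      (measurableSet_lt measurable_fst measurable_snd)

lemma norm_exp_neg_mul_le_one (hz : 0 ≤ z.re) {t : ℝ} (ht : 0 ≤ t) :
    ‖Complex.exp (-(2 * z * t))‖ ≤ 1 := by
  rw [Complex.norm_exp, Real.exp_le_one_iff, Complex.neg_re, Complex.re_mul_ofReal]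
  have : (2 * z).re = 2 * z.re := by simp
  rw [this]
  have := mul_nonneg hz ht
  nlinarith

/-- For Re z ≥ 0 the numerator 1 - e^{-2z(s-r)} is at most 2 in modulus, cancelling the 2 in 1/(2z).
The centrifugal term belongs to the perturbation, being integrable away from 0. Integration comes
from infinity, hence ρ(s) = -s. -/
lemma enorm_jostKernel_le (hz : 0 ≤ z.re) (r s : ℝ) :
    ‖jostKernel V μ z r s‖ₑ ≤ {s : ℝ | -s < -r}.indicator (jostMajorant V μ z) s := by
  by_cases h : 0 < r ∧ r < s
  · have hs : 0 < s := h.1.trans h.2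
    simp only [jostKernel, jostMajorant, mem_ofPred_eq, h, indicator_of_mem, mem_Ioi, hs,
      and_self, neg_lt_neg_iff]
    rw [← ofReal_norm]
    refine ENNReal.ofReal_le_ofReal ?_
    rw [norm_mul, Complex.norm_real, Real.norm_eq_abs, norm_div, norm_mul, Complex.norm_ofNat,
      mul_comm, ← mul_div_assoc]
    have h1 : ‖1 - Complex.exp (-(2 * z * ((s : ℂ) - r)))‖ ≤ 2 := by
      refine (norm_sub_le _ _).trans ?_
      rw [← Complex.ofReal_sub, norm_one]
      linarith [norm_exp_neg_mul_le_one hz (sub_nonneg.2 h.2.le)]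
    calc _ ≤ |radialPotential V μ s| * 2 / (2 * ‖z‖) := by gcongr
      _ = _ := by rw [mul_comm 2 ‖z‖, mul_div_mul_right _ _ (by norm_num)]
  · simp only [jostKernel]
    rw [indicator_of_notMem (by simpa using h)]
    simp

lemma integrableOn_radialPotential (hVm : Measurable V)
    (hV : IntegrableOn (fun s => s * |V s|) (Ioi 0)) {r : ℝ} (hr : 0 < r) :
    IntegrableOn (radialPotential V μ) (Ioi r) := by
  refine Integrable.add ?_ ?_
  · have h := (integrableOn_Ioi_rpow_of_lt (a := -2) (by norm_num) hr).const_mul (μ ^ 2 - 1 / 4)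
    refine h.congr ?_
    filter_upwards [ae_restrict_mem measurableSet_Ioi] with s hs
    have hs : (0 : ℝ) < s := hr.trans hs
    rw [show (-2 : ℝ) = -((2 : ℕ) : ℝ) by norm_num, Real.rpow_neg hs.le, Real.rpow_natCast]
    rfl
  · refine Integrable.mono' ((hV.mono_set (Ioi_subset_Ioi hr.le)).const_mul r⁻¹)
      hVm.aestronglyMeasurable ?_
    filter_upwards [ae_restrict_mem measurableSet_Ioi] with s hs
    rw [Real.norm_eq_abs, ← mul_assoc]
    refine le_mul_of_one_le_left (abs_nonneg _) ?_
    rw [inv_mul_eq_div, one_le_div hr]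
    exact le_of_lt hs

lemma jostMajorant_one_eq {r : ℝ} (hr : 0 ≤ r) :
    volterraMajorant (fun s => -s) (jostMajorant V μ z) 1 (-r) =
      ∫⁻ s in Ioi r, ENNReal.ofReal (|radialPotential V μ s| / ‖z‖) := by
  rw [volterraMajorant_one, jostMajorant, setLIntegral_indicator measurableSet_Ioi]
  congr 2
  ext s
  simp only [mem_inter_iff, mem_Ioi, mem_ofPred_eq, neg_lt_neg_iff]
  exact ⟨fun h => h.2, fun h => ⟨hr.trans_lt h, h⟩⟩

lemma jostMajorant_one_ne_top (hVm : Measurable V)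
    (hV : IntegrableOn (fun s => s * |V s|) (Ioi 0)) {r : ℝ} (hr : 0 < r) :
    volterraMajorant (fun s => -s) (jostMajorant V μ z) 1 (-r) ≠ ∞ := by
  rw [jostMajorant_one_eq hr.le]
  have hi := ((integrableOn_radialPotential (μ := μ) hVm hV hr).abs.div_const ‖z‖)
  refine (lt_of_le_of_lt (lintegral_mono fun s => ?_) hi.2).ne
  rw [← ofReal_norm]
  exact ENNReal.ofReal_le_ofReal (le_abs_self _)

lemma tendsto_setIntegral_Ioi_zero {f : ℝ → ℝ} {a : ℝ} (hf : IntegrableOn f (Ioi a)) :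
    Tendsto (fun r => ∫ s in Ioi r, f s) atTop (𝓝 0) := by
  have h1 := intervalIntegral_tendsto_integral_Ioi a hf tendsto_id
  have h2 := h1.const_sub (∫ s in Ioi a, f s)
  rw [sub_self] at h2
  refine h2.congr' ?_
  filter_upwards [eventually_ge_atTop a] with r hr
  rw [intervalIntegral.integral_of_le (by exact hr), sub_eq_iff_eq_add', ← setIntegral_union
    (by rw [Set.disjoint_left]; intro x hx hx'; exact not_lt.2 hx.2 hx') measurableSet_Ioi
    (hf.mono_set Ioc_subset_Ioi_self) (hf.mono_set (Ioi_subset_Ioi hr))]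
  simp only [id]
  rw [Ioc_union_Ioi_eq_Ioi hr]

lemma norm_jostFactor_le (hVm : Measurable V)
    (hV : IntegrableOn (fun s => s * |V s|) (Ioi 0)) (hz : 0 ≤ z.re) {r s : ℝ} (hr : 0 < r)
    (hrs : r ≤ s) : ‖jostFactor V μ z s‖ ≤
      Real.exp (volterraMajorant (fun s => -s) (jostMajorant V μ z) 1 (-r)).toReal := by
  have h1 := enorm_volterraSol_le measurable_neg (measurable_jostMajorant (μ := μ) (z := z) hVm)
    (enorm_jostKernel_le hz) (jostMajorant_one_ne_top hVm hV (hr.trans_le hrs))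
  have h2 := (ENNReal.ofReal_le_ofReal_iff (Real.exp_pos _).le).1 ((ofReal_norm _).trans_le h1)
  refine h2.trans (Real.exp_le_exp.2 (ENNReal.toReal_mono (jostMajorant_one_ne_top hVm hV hr) ?_))
  exact volterraMajorant_mono 1 (neg_le_neg hrs)

lemma norm_jostMoment_integrand_le (hVm : Measurable V)
    (hV : IntegrableOn (fun s => s * |V s|) (Ioi 0)) (hz : 0 ≤ z.re) {r s : ℝ} (hr : 0 < r)
    (hrs : r ≤ s) {w : ℂ} {C : ℝ} (hw : ‖w‖ ≤ C) :
    ‖w * (radialPotential V μ s * jostFactor V μ z s)‖ ≤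
      C * Real.exp (volterraMajorant (fun s => -s) (jostMajorant V μ z) 1 (-r)).toReal *
        |radialPotential V μ s| := by
  have := norm_jostFactor_le (μ := μ) hVm hV hz hr hrs
  rw [norm_mul, norm_mul, Complex.norm_real, Real.norm_eq_abs, mul_comm |_|, ← mul_assoc]
  have := (norm_nonneg w).trans hw
  gcongr

lemma integrableOn_jostMoment (hVm : Measurable V)
    (hV : IntegrableOn (fun s => s * |V s|) (Ioi 0)) (hz : 0 ≤ z.re) {r : ℝ} (hr : 0 < r)
    {ω : ℝ → ℂ} (hωm : Measurable ω) {C : ℝ} (hω : ∀ s, r < s → ‖ω s‖ ≤ C) :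
    IntegrableOn (fun s => ω s * (radialPotential V μ s * jostFactor V μ z s)) (Ioi r) := by
  refine Integrable.mono' ((integrableOn_radialPotential (μ := μ) hVm hV hr).abs.const_mul _) ?_
    ((ae_restrict_mem measurableSet_Ioi).mono fun s (hs : r < s) =>
      norm_jostMoment_integrand_le hVm hV hz hr hs.le (hω s hs))
  have h1 := measurable_radialPotential (μ := μ) hVm
  have h2 : Measurable (jostFactor V μ z) := measurable_volterraSol (measurable_jostKernel hVm)
  exact Measurable.aestronglyMeasurable (by fun_prop)

lemma hasPrimitive_jostMoment (hVm : Measurable V)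
    (hV : IntegrableOn (fun s => s * |V s|) (Ioi 0)) (hz : 0 ≤ z.re)
    {ω : ℝ → ℂ} (hωm : Measurable ω) {C : ℝ} (hω : ∀ s, 0 < s → ‖ω s‖ ≤ C) :
    HasPrimitive (jostMoment V μ z ω)
      (fun s => -(ω s * (radialPotential V μ s * jostFactor V μ z s))) := by
  intro a b ha hab
  have hi := integrableOn_jostMoment (μ := μ) hVm hV hz ha hωm fun s hs => hω s (ha.trans hs)
  have hab' := hi.mono_set (Ioc_subset_Ioi_self : Ioc a b ⊆ Ioi a)
  refine ⟨((intervalIntegrable_iff_integrableOn_Ioc_of_le hab).2 hab').neg, ?_⟩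
  rw [intervalIntegral.integral_neg, intervalIntegral.integral_of_le hab, jostMoment, jostMoment,
    ← Ioc_union_Ioi_eq_Ioi hab, setIntegral_union
    (by rw [Set.disjoint_left]; intro x hx hx'; exact not_lt.2 hx.2 hx') measurableSet_Ioi
    hab' (hi.mono_set (Ioi_subset_Ioi hab))]
  ring

lemma jostFactor_eq (hVm : Measurable V)
    (hV : IntegrableOn (fun s => s * |V s|) (Ioi 0)) (hz : 0 ≤ z.re) {r : ℝ} (hr : 0 < r) :
    jostFactor V μ z r = 1 + jostMoment V μ z (fun _ => 1 / (2 * z)) r -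
      Complex.exp (2 * z * r) *
        jostMoment V μ z (fun s => Complex.exp (-(2 * z * s)) / (2 * z)) r := by
  have h1 := volterraSol_eq measurable_neg (measurable_jostMajorant (μ := μ) (z := z) hVm)
    (measurable_jostKernel hVm) (enorm_jostKernel_le hz) (jostMajorant_one_ne_top hVm hV hr)
  change jostFactor V μ z r = _ at h1
  rw [h1, add_sub_assoc, jostMoment, jostMoment, ← integral_const_mul, ← integral_sub
    (integrableOn_jostMoment hVm hV hz hr (by fun_prop) fun s _ => le_rfl)
    ((integrableOn_jostMoment hVm hV hz hr (C := 1 / ‖2 * z‖) (by fun_prop) fun s hs => by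
      rw [norm_div]
      gcongr
      exact norm_exp_neg_mul_le_one hz (hr.trans hs).le).const_mul _),
    ← integral_indicator measurableSet_Ioi]
  congr 2; ext s
  by_cases hs : r < s
  · have hs' : (r, s) ∈ {p : ℝ × ℝ | 0 < p.1 ∧ p.1 < p.2} := ⟨hr, hs⟩
    simp only [jostKernel, indicator_of_mem hs', indicator_of_mem (mem_Ioi.2 hs)]
    change _ * jostFactor V μ z s = _
    have e1 : Complex.exp (-(2 * z * ((s : ℂ) - r))) =
        Complex.exp (2 * z * r) * Complex.exp (-(2 * z * s)) := by
      rw [← Complex.exp_add]; congr 1; ring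
    rw [e1]; ring
  · have hs' : (r, s) ∉ {p : ℝ × ℝ | 0 < p.1 ∧ p.1 < p.2} := fun h => hs h.2
    simp only [jostKernel, indicator_of_notMem hs', indicator_of_notMem (show s ∉ Ioi r from hs),
      zero_mul]

/-- The weight may depend on r: only a uniform bound on s > r matters. This covers the weight
e^{-2z(s-r)}, which appears once e^{2zr} is moved inside the integral. -/
lemma tendsto_jostMoment (hVm : Measurable V)
    (hV : IntegrableOn (fun s => s * |V s|) (Ioi 0)) (hz : 0 ≤ z.re)
    {ω : ℝ → ℝ → ℂ} {C : ℝ} (hω : ∀ r s, r < s → ‖ω r s‖ ≤ C) :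
    Tendsto (fun r => jostMoment V μ z (ω r) r) atTop (𝓝 0) := by
  have h0 := (tendsto_setIntegral_Ioi_zero
    (integrableOn_radialPotential (μ := μ) hVm hV one_pos).abs).const_mul
    (C * Real.exp (volterraMajorant (fun s => -s) (jostMajorant V μ z) 1 (-1)).toReal)
  rw [mul_zero] at h0
  refine squeeze_zero_norm' ?_ h0
  filter_upwards [eventually_ge_atTop 1] with r hr
  rw [← integral_const_mul]
  exact norm_integral_le_of_norm_le
    (((integrableOn_radialPotential hVm hV (one_pos.trans_le hr)).abs).const_mul _)
    ((ae_restrict_mem measurableSet_Ioi).mono fun s (hs : r < s) =>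
      norm_jostMoment_integrand_le hVm hV hz one_pos (hr.trans hs.le) (hω r s hs))

/-- Existence of the Jost solution, with the asymptotics of its derivative. -/
theorem exists_jostSol (hVm : Measurable V)
    (hV : IntegrableOn (fun s => s * |V s|) (Ioi 0)) (hz : 0 ≤ z.re) (hz0 : z ≠ 0) :
    ∃ u u' : ℝ → ℂ, IsSol (radialCoeff V μ (z ^ 2)) u u' ∧
      Tendsto (fun r : ℝ => Complex.exp (z * r) * u r) atTop (𝓝 1) ∧
      Tendsto (fun r : ℝ => Complex.exp (z * r) * u' r) atTop (𝓝 (-z)) := by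
  set α : ℝ → ℂ := fun r => 1 + jostMoment V μ z (fun _ => 1 / (2 * z)) r with hα
  set β : ℝ → ℂ := fun r =>
    -jostMoment V μ z (fun s => Complex.exp (-(2 * z * s)) / (2 * z)) r with hβ
  have hexp : ∀ (c : ℂ) (r : ℝ), HasDerivAt (fun s : ℝ => Complex.exp (c * s))
      (c * Complex.exp (c * r)) r := by
    intro c r
    have h1 : HasDerivAt (fun s : ℝ => c * (s : ℂ)) c r :=
      ((Complex.ofRealCLM.hasDerivAt (x := r)).const_mul c).congr_deriv (by simp)
    exact h1.cexp.congr_deriv (by ring)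
  have hexp2 : ∀ (c : ℂ) (r : ℝ), HasDerivAt (fun s : ℝ => c * Complex.exp (c * s))
      (c ^ 2 * Complex.exp (c * r)) r := fun c r =>
    ((hexp c r).const_mul c).congr_deriv (by ring)
  have hωb : ∀ s : ℝ, 0 < s → ‖Complex.exp (-(2 * z * s)) / (2 * z)‖ ≤ 1 / ‖2 * z‖ := by
    intro s hs
    rw [norm_div]; gcongr; exact norm_exp_neg_mul_le_one hz hs.le
  have hU : ∀ r : ℝ, 0 < r →
      Complex.exp (-z * r) * jostFactor V μ z r =
        α r * Complex.exp (-z * r) + β r * Complex.exp (z * r) := by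
    intro r hr
    have e : Complex.exp (-z * r) * Complex.exp (2 * z * r) = Complex.exp (z * r) := by
      rw [← Complex.exp_add]; congr 1; ring
    rw [jostFactor_eq hVm hV hz hr, ← e]
    simp only [hα, hβ]; ring
  have hpα := hasPrimitive_jostMoment (μ := μ) hVm hV hz (ω := fun _ => 1 / (2 * z)) (by fun_prop)
      (fun s _ => le_rfl)
  have hpβ := hasPrimitive_jostMoment (μ := μ) hVm hV hz
      (ω := fun s => Complex.exp (-(2 * z * s)) / (2 * z)) (by fun_prop) hωb
  -- The exponentials e^{-zr} and e^{zr} have Wronskian 2z, so f is the potential times the solution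
  -- divided by 2z.
  set f : ℝ → ℂ := fun s =>
    Complex.exp (-z * s) * (1 / (2 * z) * (radialPotential V μ s * jostFactor V μ z s)) with hf
  have hsol : IsSol (radialCoeff V μ (z ^ 2))
      (fun r => α r * Complex.exp (-z * r) + β r * Complex.exp (z * r))
      (fun r => α r * (-z * Complex.exp (-z * r)) + β r * (z * Complex.exp (z * r))) := by
    refine IsSol.of_variation (f := f) (Q₀ := fun _ => z ^ 2)
      (fun r _ => hexp _ r) (fun r _ => hexp _ r)
      (fun r _ => (hexp2 _ r).congr_deriv (by ring)) (fun r _ => hexp2 _ r)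
      continuousOn_const ?_ ?_ ?_ ?_
    · intro a b ha hb
      have h1 := (hpα.intervalIntegrable ha hb).neg
      refine (h1.continuousOn_mul (g := fun s : ℝ => Complex.exp (-z * s))
        (by fun_prop)).congr fun s _ => ?_
      simp [hf]
    · refine (hpα.add (HasPrimitive.of_hasDerivAt (A := fun _ => 1) (f := fun _ => 0)
        (fun r _ => hasDerivAt_const r 1) continuousOn_const)).congr
        (fun r _ => add_comm _ _) fun s _ => ?_
      have e : Complex.exp (z * s) * Complex.exp (-z * s) = 1 := by
        rw [← Complex.exp_add]; simp
      simp only [hf]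
      linear_combination (1 / (2 * z) * (radialPotential V μ s * jostFactor V μ z s)) * e
    · refine (hpβ.const_mul (-1)).congr (fun r _ => by simp only [hβ]; ring) fun s _ => ?_
      have e : Complex.exp (-z * s) * Complex.exp (-z * s) = Complex.exp (-(2 * z * s)) := by
        rw [← Complex.exp_add]; congr 1; ring
      simp only [hf]
      rw [← e]; ring
    · intro r hr
      rw [← hU r hr]
      have e : Complex.exp (-z * r) * Complex.exp (z * r) = 1 := by
        rw [← Complex.exp_add]; simp
      simp only [hf, radialCoeff]
      change _ = ((radialPotential V μ r : ℂ) + z ^ 2 - z ^ 2) * _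
      have h2 : Complex.exp (-z * r) * (z * Complex.exp (z * r)) -
          Complex.exp (z * r) * (-z * Complex.exp (-z * r)) = 2 * z := by
        linear_combination 2 * z * e
      rw [h2]; field_simp; ring
  have hαlim : Tendsto α atTop (𝓝 1) := by
    have := (tendsto_jostMoment (μ := μ) hVm hV hz (ω := fun _ _ => 1 / (2 * z))
      (fun _ _ _ => le_rfl)).const_add 1
    rwa [add_zero] at this
  have hβlim : Tendsto (fun r : ℝ => Complex.exp (2 * z * r) * β r) atTop (𝓝 0) := by
    have := (tendsto_jostMoment (μ := μ) hVm hV hz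
      (ω := fun r s => Complex.exp (-(2 * z * (s - r : ℝ))) / (2 * z)) (C := 1 / ‖2 * z‖)
      (fun r s hrs => by
        rw [norm_div]; gcongr; exact norm_exp_neg_mul_le_one hz (sub_nonneg.2 hrs.le))).neg
    rw [neg_zero] at this
    refine this.congr fun r => ?_
    simp only [hβ, jostMoment]
    rw [mul_neg, ← integral_const_mul]
    congr 2; ext s
    have e : Complex.exp (-(2 * z * (s - r : ℝ))) =
        Complex.exp (2 * z * r) * Complex.exp (-(2 * z * s)) := by
      rw [← Complex.exp_add]; congr 1; push_cast; ring
    rw [e]; ring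
  have e1 : ∀ r : ℝ, Complex.exp (z * r) * Complex.exp (-z * r) = 1 := fun r => by
    rw [← Complex.exp_add]; simp
  have e2 : ∀ r : ℝ, Complex.exp (z * r) * Complex.exp (z * r) = Complex.exp (2 * z * r) :=
    fun r => by rw [← Complex.exp_add]; congr 1; ring
  refine ⟨_, _, hsol, ?_, ?_⟩
  · have := hαlim.add hβlim
    rw [add_zero] at this
    refine this.congr fun r => ?_
    linear_combination -(α r) * e1 r - β r * e2 r
  · have := (hαlim.const_mul (-z)).add (hβlim.const_mul z)
    rw [mul_one, mul_zero, add_zero] at this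
    refine this.congr fun r => ?_
    linear_combination z * (α r) * e1 r - z * β r * e2 r

lemma norm_mul_sub_one_le {a b : ℂ} (ha : ‖a - 1‖ ≤ 1 / 4) (hb : ‖b - 1‖ ≤ 1 / 4) :
    1 / 4 ≤ (a * b).re := by
  have h1 : a * b - 1 = (a - 1) * (b - 1) + (a - 1) + (b - 1) := by ring
  have h2 : ‖a * b - 1‖ ≤ 1 / 4 * (1 / 4) + 1 / 4 + 1 / 4 := by
    rw [h1]
    refine (norm_add₃_le).trans ?_
    rw [norm_mul]
    gcongr
  have h3 := (abs_le.1 (Complex.abs_re_le_norm (a * b - 1))).1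
  simp only [Complex.sub_re, Complex.one_re] at h3
  linarith

/-- Uniqueness of the Jost solution. -/
theorem jostSol_unique (hVm : Measurable V)
    (hV : IntegrableOn (fun s => s * |V s|) (Ioi 0)) (hz : 0 ≤ z.re) {u u' v v' : ℝ → ℂ}
    (hu : IsSol (radialCoeff V μ (z ^ 2)) u u') (hv : IsSol (radialCoeff V μ (z ^ 2)) v v')
    (hul : Tendsto (fun r : ℝ => Complex.exp (z * r) * u r) atTop (𝓝 1))
    (hvl : Tendsto (fun r : ℝ => Complex.exp (z * r) * v r) atTop (𝓝 1)) :
    EqOn u v (Ioi 0) := by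
  have hinv : Tendsto (fun r : ℝ => ((Complex.exp (z * r) * v r) ^ 2)⁻¹) atTop (𝓝 1) := by
    have := (hvl.pow 2).inv₀ (by simp)
    simpa using this
  have hev : ∀ᶠ r : ℝ in atTop, ‖((Complex.exp (z * r) * v r) ^ 2)⁻¹ - 1‖ ≤ 1 / 4 := by
    have := (tendsto_iff_norm_sub_tendsto_zero.1 hinv).eventually
      (gt_mem_nhds (by norm_num : (0 : ℝ) < 1 / 4))
    exact this.mono fun _ h => h.le
  have hne : ∀ᶠ r : ℝ in atTop, v r ≠ 0 := by
    filter_upwards [hvl.eventually_ne one_ne_zero] with r hr using right_ne_zero_of_mul hr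
  obtain ⟨R, hR⟩ := eventually_atTop.1 (hev.and hne)
  -- A window of fixed length d, short enough that e^{2zt} stays near 1; real k, where the solution
  -- oscillates without decay, needs this.
  obtain ⟨d, hd, hdb⟩ : ∃ d : ℝ, 0 < d ∧ ∀ t ∈ Icc 0 d,
      ‖Complex.exp (2 * z * t) - 1‖ ≤ 1 / 4 := by
    have hc : Tendsto (fun t : ℝ => ‖Complex.exp (2 * z * t) - 1‖) (𝓝 0) (𝓝 0) := by
      have : Continuous fun t : ℝ => ‖Complex.exp (2 * z * t) - 1‖ := by fun_prop
      simpa using this.tendsto 0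
    obtain ⟨d, hd, h⟩ := Metric.eventually_nhds_iff.1
      (hc.eventually (gt_mem_nhds (by norm_num : (0 : ℝ) < 1 / 4)))
    refine ⟨d / 2, by positivity, fun t ht => (h ?_).le⟩
    rw [Real.dist_eq, sub_zero, abs_of_nonneg ht.1]; linarith [ht.2]
  refine hu.eqOn_of_tendsto hv (measurable_radialCoeff hVm _)
    (fun a b ha hb => intervalIntegrable_radialCoeff hVm hV _ ha hb) (l := atTop)
    (E := Ioi (max R 0)) isOpen_Ioi (convex_Ioi _) (Ioi_subset_Ioi (le_max_right _ _))
    (Ioi_mem_atTop _) (fun r hr => (hR r ((le_max_left R 0).trans (le_of_lt hr))).2) ?_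
    (b := fun r => r + d) (tendsto_atTop_add_const_right _ _ tendsto_id) (c := d / 4)
    (by positivity) ?_
  · have := hul.div hvl one_ne_zero
    rw [div_one] at this
    refine this.congr fun r => ?_
    exact mul_div_mul_left _ _ (Complex.exp_ne_zero _)
  · filter_upwards [eventually_gt_atTop (max R 0)] with r hr
    -- Here 1/v(x)² is close to e^{2zx}, so θ = e^{-2zr} brings it near 1 on the window; |θ| ≤ 1
    -- because Re z ≥ 0.
    refine ⟨by linarith, fun x hx => lt_of_lt_of_le hr hx.1, Complex.exp (-(2 * z * r)), ?_, ?_⟩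
    · exact norm_exp_neg_mul_le_one hz ((le_max_right R 0).trans hr.le)
    · intro x hx
      have h1 := (hR x ((le_max_left R 0).trans (hr.le.trans hx.1))).1
      have h2 := hdb (x - r) ⟨by linarith [hx.1], by linarith [hx.2]⟩
      have h3 := norm_mul_sub_one_le h2 h1
      have h4 : d / 4 / (r + d - r) = 1 / 4 := by
        rw [add_sub_cancel_left]; field_simp
      rw [h4]
      convert h3 using 2
      have e : Complex.exp (2 * z * (x - r : ℝ)) =
          Complex.exp (-(2 * z * r)) * Complex.exp (z * x) ^ 2 := by
        rw [← Complex.exp_nat_mul, ← Complex.exp_add]; congr 1; push_cast; ring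
      have hvx := (hR x ((le_max_left R 0).trans (hr.le.trans hx.1))).2
      have hex := Complex.exp_ne_zero (z * x)
      rw [e]; field_simp

/-- Uniqueness of the regular solution. -/
theorem regularSol_unique (hμ : 0 < μ) (hVm : Measurable V)
    (hV : IntegrableOn (fun s => s * |V s|) (Ioi 0)) {u u' v v' : ℝ → ℂ}
    (hu : IsSol (radialCoeff V μ z) u u') (hv : IsSol (radialCoeff V μ z) v v')
    (hul : Tendsto (fun r : ℝ => u r / (r ^ (1 / 2 + μ) : ℝ)) (𝓝[>] 0) (𝓝 1))
    (hvl : Tendsto (fun r : ℝ => v r / (r ^ (1 / 2 + μ) : ℝ)) (𝓝[>] 0) (𝓝 1)) :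
    EqOn u v (Ioi 0) := by
  have hinv : Tendsto (fun r : ℝ => ((v r / (r ^ (1 / 2 + μ) : ℝ)) ^ 2)⁻¹) (𝓝[>] 0) (𝓝 1) := by
    have := (hvl.pow 2).inv₀ (by simp)
    simpa using this
  have hev : ∀ᶠ r : ℝ in 𝓝[>] 0, 1 / 2 ≤ (((v r / (r ^ (1 / 2 + μ) : ℝ)) ^ 2)⁻¹).re := by
    have := ((Complex.continuous_re.tendsto 1).comp hinv).eventually
      (lt_mem_nhds (by norm_num : (1 / 2 : ℝ) < (1 : ℂ).re))
    exact this.mono fun _ h => h.le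
  have hne : ∀ᶠ r : ℝ in 𝓝[>] 0, v r ≠ 0 := by
    filter_upwards [hvl.eventually_ne one_ne_zero] with r hr h
    exact hr (by rw [h, zero_div])
  obtain ⟨δ, hδ, hδb⟩ := mem_nhdsGT_iff_exists_Ioo_subset.1 (hev.and hne)
  have hδ : 0 < δ := hδ
  have hm : 0 < min δ 1 := lt_min hδ one_pos
  refine hu.eqOn_of_tendsto hv (measurable_radialCoeff hVm _)
    (fun a b ha hb => intervalIntegrable_radialCoeff hVm hV _ ha hb) (l := 𝓝[>] 0)
    (E := Ioo 0 (min δ 1)) isOpen_Ioo (convex_Ioo _ _) Ioo_subset_Ioi_self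
    (Ioo_mem_nhdsGT hm)
    (fun r hr => (hδb ⟨hr.1, hr.2.trans_le (min_le_left _ _)⟩).2) ?_
    (b := fun r => 2 * r) ?_ (c := 1 / 4) (by norm_num) ?_
  · have := hul.div hvl one_ne_zero
    rw [div_one] at this
    refine this.congr' ?_
    filter_upwards [self_mem_nhdsWithin] with r hr
    have : ((r ^ (1 / 2 + μ) : ℝ) : ℂ) ≠ 0 := by
      exact_mod_cast (Real.rpow_pos_of_pos hr _).ne'
    exact div_div_div_cancel_right₀ this _ _
  · refine tendsto_nhdsWithin_iff.2 ⟨?_, ?_⟩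
    · have : Tendsto (fun r : ℝ => 2 * r) (𝓝 0) (𝓝 0) := by
        simpa using (continuous_const.mul continuous_id).tendsto (0 : ℝ) (f := fun r : ℝ => 2 * r)
      exact this.mono_left nhdsWithin_le_nhds
    · filter_upwards [self_mem_nhdsWithin] with r hr
      exact mul_pos two_pos (show 0 < r from hr)
  · filter_upwards [Ioo_mem_nhdsGT (half_pos hm)] with r hr
    refine ⟨by linarith [hr.1], fun x hx => ⟨hr.1.trans_le hx.1, by linarith [hx.2, hr.2]⟩, 1,
      by simp, fun x hx => ?_⟩
    have hx0 : 0 < x := hr.1.trans_le hx.1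
    have hxm : x < min δ 1 := by linarith [hx.2, hr.2]
    have h1 := (hδb ⟨hx0, hxm.trans_le (min_le_left _ _)⟩).1
    have hp : 0 < x ^ (1 / 2 + μ) := Real.rpow_pos_of_pos hx0 _
    have e : (1 / v x ^ 2) = (((x ^ (1 / 2 + μ)) ^ 2)⁻¹ : ℝ) *
        ((v x / (x ^ (1 / 2 + μ) : ℝ)) ^ 2)⁻¹ := by
      have : ((x ^ (1 / 2 + μ) : ℝ) : ℂ) ≠ 0 := by exact_mod_cast hp.ne'
      push_cast
      generalize ((x ^ (1 / 2 + μ) : ℝ) : ℂ) = p at *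
      rw [div_pow, inv_div, one_div, ← mul_div_assoc, inv_mul_cancel₀ (pow_ne_zero 2 this),
        one_div]
    rw [e, Complex.re_ofReal_mul]
    -- On [r, 2r] with 2r below 1, the real part of 1/v² is at least half of x^{-(1+2μ)} ≥ 1/x ≥
    -- 1/(2r). The window has length r, so c = 1/4 works.
    have h2 : (x ^ (1 / 2 + μ)) ^ 2 ≤ x := by
      rw [← Real.rpow_natCast, ← Real.rpow_mul hx0.le]
      refine (Real.rpow_le_rpow_of_exponent_ge hx0 (hxm.le.trans (min_le_right _ _))
        (by push_cast; nlinarith : (1 : ℝ) ≤ _)).trans_eq (Real.rpow_one x)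
    have h3 : (2 * r)⁻¹ ≤ ((x ^ (1 / 2 + μ)) ^ 2)⁻¹ := by
      gcongr
      exact h2.trans hx.2
    have h4 : 1 / 4 / (2 * r - r) = (2 * r)⁻¹ * (1 / 2) := by
      have := hr.1.ne'
      rw [show 2 * r - r = r by ring]; field_simp; norm_num
    rw [h4]
    have := hr.1
    gcongr

end Jost

/-! ### Hankel-type moments and the amplitude of the free solution -/

/-- The moments `∫₀^∞ e^{-t} t^c (1 + t w)^d dt`. -/
def hankelMoment (c d : ℝ) (w : ℂ) : ℂ :=
  ∫ t in Ioi (0 : ℝ), ((Real.exp (-t) * t ^ c : ℝ) : ℂ) * (1 + t * w) ^ (d : ℂ)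

/-- Half of the decay of e^{-t} absorbs the polynomial growth, and the other half keeps the
integrals convergent. -/
lemma exists_one_add_mul_rpow_le (m B : ℝ) (hB : 0 ≤ B) :
    ∃ C, 0 < C ∧ ∀ t : ℝ, 0 ≤ t → (1 + t * B) ^ m ≤ C * Real.exp (t / 2) := by
  set n := ⌈m⌉₊
  refine ⟨(1 + B) ^ n * (2 ^ n * (n.factorial * Real.exp (1 / 2))), by positivity, fun t ht => ?_⟩
  have h1 : (1 : ℝ) ≤ 1 + t * B := by nlinarith [mul_nonneg ht hB]
  have h2 := Real.pow_div_factorial_le_exp ((1 + t) / 2) (by positivity) n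
  rw [div_le_iff₀ (by positivity)] at h2
  calc (1 + t * B) ^ m ≤ (1 + t * B) ^ (n : ℝ) := Real.rpow_le_rpow_of_exponent_le h1 (Nat.le_ceil m)
    _ = (1 + t * B) ^ n := Real.rpow_natCast _ _
    _ ≤ ((1 + B) * (2 * ((1 + t) / 2))) ^ n := by
        gcongr
        nlinarith [mul_nonneg ht hB]
    _ = (1 + B) ^ n * (2 ^ n * ((1 + t) / 2) ^ n) := by rw [mul_pow, mul_pow]
    _ ≤ (1 + B) ^ n * (2 ^ n * (Real.exp ((1 + t) / 2) * n.factorial)) := by gcongr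
    _ = _ := by rw [add_div, Real.exp_add]; ring

lemma norm_one_add_mul_le {w : ℂ} {B t : ℝ} (hw : ‖w‖ ≤ B) (ht : 0 ≤ t) :
    ‖1 + (t : ℂ) * w‖ ≤ 1 + t * B := by
  refine (norm_add_le _ _).trans ?_
  rw [norm_one, norm_mul, Complex.norm_real, Real.norm_eq_abs, abs_of_nonneg ht]
  gcongr

lemma exists_norm_one_add_mul_cpow_le {d : ℝ} (hd : 0 ≤ d) (B : ℝ) :
    ∃ C, 0 < C ∧ ∀ w : ℂ, ‖w‖ ≤ B → ∀ t : ℝ, 0 ≤ t →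
      ‖(1 + (t : ℂ) * w) ^ (d : ℂ)‖ ≤ C * Real.exp (t / 2) := by
  obtain ⟨C, hC, h⟩ := exists_one_add_mul_rpow_le d |B| (abs_nonneg _)
  refine ⟨C, hC, fun w hw t ht => ?_⟩
  rw [Complex.norm_cpow_real]
  refine le_trans ?_ (h t ht)
  exact Real.rpow_le_rpow (norm_nonneg _) (norm_one_add_mul_le (hw.trans (le_abs_self B)) ht) hd

lemma one_add_mul_mem_slitPlane {w : ℂ} (hw : w ∈ Complex.slitPlane) {t : ℝ} (ht : 0 ≤ t) :
    1 + (t : ℂ) * w ∈ Complex.slitPlane := by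
  rcases ht.eq_or_lt with rfl | ht
  · simp
  rw [Complex.mem_slitPlane_iff] at hw ⊢
  rcases hw with h | h
  · left; simp; positivity
  · right; simp [ht.ne', h]

lemma exists_le_norm_one_add_mul {w₀ : ℂ} (hw₀ : w₀ ∈ Complex.slitPlane) :
    ∃ δ, 0 < δ ∧ ∃ N ∈ 𝓝 w₀, ∀ w ∈ N, ∀ t : ℝ, 0 ≤ t → δ ≤ ‖1 + (t : ℂ) * w‖ := by
  rcases Complex.mem_slitPlane_iff.1 hw₀ with h | h
  · refine ⟨1, one_pos, {w | 0 < w.re},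
      (isOpen_lt continuous_const Complex.continuous_re).mem_nhds h, fun w hw t ht => ?_⟩
    refine le_trans ?_ (Complex.re_le_norm _)
    have : 0 < w.re := hw
    simp; positivity
  · have hi : 0 < |w₀.im| := abs_pos.2 h
    refine ⟨|w₀.im| / 2 / (‖w₀‖ + 1), by positivity,
      {w | |w₀.im| / 2 < |w.im|} ∩ {w | ‖w‖ < ‖w₀‖ + 1}, inter_mem
      ((isOpen_lt continuous_const Complex.continuous_im.abs).mem_nhds
        (by simp only [mem_ofPred_eq]; linarith))
      ((isOpen_lt continuous_norm continuous_const).mem_nhds (by simp)), ?_⟩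
    rintro w ⟨hw1, hw2⟩ t ht
    have hw1 : |w₀.im| / 2 < |w.im| := hw1
    have hw2 : ‖w‖ < ‖w₀‖ + 1 := hw2
    rw [div_le_iff₀ (by positivity)]
    -- Multiplying by the conjugate of w makes tw real, so the imaginary part no longer involves t.
    -- Hence |1 + tw||w| ≥ |Im w| uniformly in t.
    have h1 : ((1 + (t : ℂ) * w) * (starRingEnd ℂ) w).im = -w.im := by
      simp; ring
    have h2 := Complex.abs_im_le_norm ((1 + (t : ℂ) * w) * (starRingEnd ℂ) w)
    rw [h1, abs_neg, norm_mul, RCLike.norm_conj] at h2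
    calc |w₀.im| / 2 ≤ |w.im| := hw1.le
      _ ≤ _ := h2
      _ ≤ _ := by gcongr

lemma exists_norm_one_add_mul_cpow_le_nhds (d : ℝ) {w₀ : ℂ} (hw₀ : w₀ ∈ Complex.slitPlane) :
    ∃ C, 0 < C ∧ ∃ N ∈ 𝓝 w₀, ∀ w ∈ N, ∀ t : ℝ, 0 ≤ t →
      ‖(1 + (t : ℂ) * w) ^ (d : ℂ)‖ ≤ C * Real.exp (t / 2) := by
  rcases le_or_gt 0 d with hd | hd
  · obtain ⟨C, hC, h⟩ := exists_norm_one_add_mul_cpow_le hd (‖w₀‖ + 1)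
    exact ⟨C, hC, {w | ‖w‖ < ‖w₀‖ + 1},
      (isOpen_lt continuous_norm continuous_const).mem_nhds (by simp), fun w hw => h w (le_of_lt hw)⟩
  · obtain ⟨δ, hδ, N, hN, h⟩ := exists_le_norm_one_add_mul hw₀
    refine ⟨δ ^ d, by positivity, N, hN, fun w hw t ht => ?_⟩
    rw [Complex.norm_cpow_real]
    calc ‖1 + (t : ℂ) * w‖ ^ d ≤ δ ^ d := Real.rpow_le_rpow_of_nonpos hδ (h w hw t ht) hd.le
      _ ≤ _ := le_mul_of_one_le_right (by positivity) (Real.one_le_exp (by positivity))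

lemma integrableOn_exp_half_mul_rpow {c : ℝ} (hc : -1 < c) (C : ℝ) :
    IntegrableOn (fun t : ℝ => C * (Real.exp (-(t / 2)) * t ^ c)) (Ioi 0) := by
  have h := (integrableOn_rpow_mul_exp_neg_mul_rpow (p := 1) (b := 1 / 2) hc one_pos
    (by norm_num)).const_mul C
  refine h.congr ?_
  filter_upwards [ae_restrict_mem measurableSet_Ioi] with t ht
  simp only [Real.rpow_one]
  rw [mul_comm (t ^ c)]; congr 3; ring

lemma norm_hankel_integrand_le {c C t : ℝ} {x : ℂ} (ht : 0 < t) (hx : ‖x‖ ≤ C * Real.exp (t / 2)) :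
    ‖((Real.exp (-t) * t ^ c : ℝ) : ℂ) * x‖ ≤ C * (Real.exp (-(t / 2)) * t ^ c) := by
  have hp := Real.rpow_pos_of_pos ht c
  rw [norm_mul, Complex.norm_real, Real.norm_eq_abs, abs_of_pos (by positivity)]
  calc _ ≤ Real.exp (-t) * t ^ c * (C * Real.exp (t / 2)) := by gcongr
    _ = C * (Real.exp (-t) * Real.exp (t / 2) * t ^ c) := by ring
    _ = _ := by rw [← Real.exp_add]; congr 3; ring

lemma measurable_hankel_integrand (c d : ℝ) (w : ℂ) :
    Measurable fun t : ℝ => ((Real.exp (-t) * t ^ c : ℝ) : ℂ) * (1 + t * w) ^ (d : ℂ) := by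
  have : Measurable fun t : ℝ => 1 + (t : ℂ) * w := by fun_prop
  have h2 : Measurable fun t : ℝ => Real.exp (-t) * t ^ c := by fun_prop
  exact (Complex.measurable_ofReal.comp h2).mul (this.pow_const _)

lemma integrableOn_hankel_integrand {c : ℝ} (hc : -1 < c) (d : ℝ) {w : ℂ}
    (hw : w ∈ Complex.slitPlane) :
    IntegrableOn (fun t : ℝ => ((Real.exp (-t) * t ^ c : ℝ) : ℂ) * (1 + t * w) ^ (d : ℂ))
      (Ioi 0) := by
  obtain ⟨C, -, N, hN, h⟩ := exists_norm_one_add_mul_cpow_le_nhds d hw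
  refine Integrable.mono' (integrableOn_exp_half_mul_rpow hc C)
    (measurable_hankel_integrand c d w).aestronglyMeasurable ?_
  filter_upwards [ae_restrict_mem measurableSet_Ioi] with t ht
  exact norm_hankel_integrand_le ht (h w (mem_of_mem_nhds hN) t (le_of_lt ht))

lemma hasDerivAt_hankelMoment {c : ℝ} (hc : -1 < c) (d : ℝ) {w : ℂ}
    (hw : w ∈ Complex.slitPlane) :
    HasDerivAt (hankelMoment c d) (d * hankelMoment (c + 1) (d - 1) w) w := by
  have hder : ∀ t : ℝ, 0 < t → ∀ w ∈ Complex.slitPlane, HasDerivAt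
      (fun w : ℂ => ((Real.exp (-t) * t ^ c : ℝ) : ℂ) * (1 + t * w) ^ (d : ℂ))
      (((Real.exp (-t) * t ^ c : ℝ) : ℂ) * (d * (1 + t * w) ^ ((d : ℂ) - 1) * t)) w := by
    intro t ht w hw
    have h1 : HasDerivAt (fun w : ℂ => 1 + (t : ℂ) * w) t w := by
      simpa using ((hasDerivAt_id w).const_mul (t : ℂ)).const_add 1
    exact (h1.cpow_const (one_add_mul_mem_slitPlane hw ht.le)).const_mul _
  have hae : ∀ᵐ t : ℝ ∂(volume.restrict (Ioi (0 : ℝ))), (0 : ℝ) < t := ae_restrict_mem measurableSet_Ioi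
  have key := hasDerivAt_integral_of_locally_dominated (m := volume.restrict (Ioi (0 : ℝ)))
    Complex.isOpen_slitPlane
    (f := fun w t => ((Real.exp (-t) * t ^ c : ℝ) : ℂ) * (1 + t * w) ^ (d : ℂ))
    (fun w _ => (measurable_hankel_integrand c d w).aestronglyMeasurable)
    (hae.mono fun t ht w hw => (hder t ht w hw).differentiableAt.differentiableWithinAt) hw ?_
  · refine key.congr_deriv ?_
    rw [hankelMoment, ← integral_const_mul]
    refine setIntegral_congr_fun measurableSet_Ioi fun t ht => ?_
    rw [(hder t ht w hw).deriv, Real.rpow_add_one (ne_of_gt ht)]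
    push_cast; ring
  · obtain ⟨C, -, N, hN, h⟩ := exists_norm_one_add_mul_cpow_le_nhds d hw
    exact ⟨_, integrableOn_exp_half_mul_rpow hc C, N, hN, hae.mono fun t ht w hw =>
      norm_hankel_integrand_le ht (h w hw t ht.le)⟩

/-- One factor 1 + tw is split off the power. -/
lemma hankelMoment_succ {c : ℝ} (hc : -1 < c) (d : ℝ) {w : ℂ} (hw : w ∈ Complex.slitPlane) :
    hankelMoment c d w = hankelMoment c (d - 1) w + w * hankelMoment (c + 1) (d - 1) w := by
  rw [hankelMoment, hankelMoment, hankelMoment, ← integral_const_mul, ← integral_add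
    (integrableOn_hankel_integrand hc _ hw)
    ((integrableOn_hankel_integrand (by linarith) _ hw).const_mul _)]
  refine setIntegral_congr_fun measurableSet_Ioi fun t ht => ?_
  have hne := Complex.slitPlane_ne_zero (one_add_mul_mem_slitPlane hw (le_of_lt ht))
  have h1 : (1 + (t : ℂ) * w) ^ (d : ℂ) =
      (1 + t * w) ^ ((d - 1 : ℝ) : ℂ) * (1 + t * w) := by
    rw [Complex.ofReal_sub, Complex.ofReal_one, Complex.cpow_sub _ _ hne, Complex.cpow_one,
      div_mul_cancel₀ _ hne]
  change _ = _ + _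
  rw [h1, Real.rpow_add_one (ne_of_gt ht)]
  push_cast; ring

/-- Integration by parts: the derivative of e^{-t} t^(c+1) (1 + tw)^d integrates to zero over the
half line. -/
lemma hankelMoment_parts {c : ℝ} (hc : -1 < c) (d : ℝ) {w : ℂ} (hw : w ∈ Complex.slitPlane) :
    hankelMoment (c + 1) d w =
      (c + 1) * hankelMoment c d w + d * w * hankelMoment (c + 1) (d - 1) w := by
  have i1 := integrableOn_hankel_integrand (by linarith : -1 < c + 1) d hw
  have i2 := integrableOn_hankel_integrand hc d hw
  have i3 := integrableOn_hankel_integrand (by linarith : -1 < c + 1) (d - 1) hw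
  set f : ℝ → ℂ := fun t => ((Real.exp (-t) * t ^ (c + 1) : ℝ) : ℂ) * (1 + t * w) ^ (d : ℂ) with hf
  have hpow : ∀ t : ℝ, 0 ≤ t → HasDerivAt (fun t : ℝ => (1 + (t : ℂ) * w) ^ (d : ℂ))
      (d * (1 + t * w) ^ ((d : ℂ) - 1) * (1 * w)) t := fun t ht =>
    ((((hasDerivAt_id (t : ℂ)).mul_const w).const_add 1).cpow_const
      (one_add_mul_mem_slitPlane hw ht)).comp_ofReal
  have hder : ∀ t ∈ Ioi (0 : ℝ), HasDerivAt f
      ((c + 1) * (((Real.exp (-t) * t ^ c : ℝ) : ℂ) * (1 + t * w) ^ (d : ℂ)) +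
        d * w * (((Real.exp (-t) * t ^ (c + 1) : ℝ) : ℂ) * (1 + t * w) ^ ((d - 1 : ℝ) : ℂ)) -
        ((Real.exp (-t) * t ^ (c + 1) : ℝ) : ℂ) * (1 + t * w) ^ (d : ℂ)) t := by
    intro t ht
    have e1 : HasDerivAt (fun t : ℝ => Real.exp (-t) * t ^ (c + 1))
        (Real.exp (-t) * (-1) * t ^ (c + 1) + Real.exp (-t) * ((c + 1) * t ^ (c + 1 - 1))) t :=
      ((hasDerivAt_neg t).exp).mul (Real.hasDerivAt_rpow_const (Or.inl (ne_of_gt ht)))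
    refine (e1.ofReal_comp.mul (hpow t (le_of_lt ht))).congr_deriv ?_
    rw [add_sub_cancel_right]
    push_cast
    ring
  have hcont : ContinuousWithinAt f (Ici 0) 0 := by
    refine ContinuousAt.continuousWithinAt ?_
    have e1 : ContinuousAt (fun t : ℝ => Real.exp (-t) * t ^ (c + 1)) 0 :=
      (by fun_prop : ContinuousAt (fun t : ℝ => Real.exp (-t)) 0).mul
        (Real.continuousAt_rpow_const _ _ (Or.inr (by linarith)))
    exact (Complex.continuous_ofReal.continuousAt.comp e1).mul (hpow 0 le_rfl).continuousAt
  have hlim : Tendsto f atTop (𝓝 0) := by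
    obtain ⟨C, -, N, hN, h⟩ := exists_norm_one_add_mul_cpow_le_nhds d hw
    have h0 := (tendsto_rpow_mul_exp_neg_mul_atTop_nhds_zero (c + 1) (1 / 2)
      (by norm_num)).const_mul C
    rw [mul_zero] at h0
    refine squeeze_zero_norm' ?_ h0
    filter_upwards [eventually_gt_atTop 0] with t ht
    refine (norm_hankel_integrand_le ht (h w (mem_of_mem_nhds hN) t ht.le)).trans_eq ?_
    rw [mul_comm (Real.exp _)]; congr 3; ring
  have i4 : IntegrableOn (fun t : ℝ =>
      (c + 1) * (((Real.exp (-t) * t ^ c : ℝ) : ℂ) * (1 + t * w) ^ (d : ℂ)) +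
      d * w * (((Real.exp (-t) * t ^ (c + 1) : ℝ) : ℂ) * (1 + t * w) ^ ((d - 1 : ℝ) : ℂ)))
      (Ioi 0) := (i2.const_mul (c + 1 : ℂ)).add (i3.const_mul (d * w))
  have key := integral_Ioi_of_hasDerivAt_of_tendsto hcont hder (i4.sub i1) hlim
  have hf0 : f 0 = 0 := by simp [hf, Real.zero_rpow (by linarith : c + 1 ≠ 0)]
  rw [integral_sub i4 i1,
    integral_add (i2.const_mul (c + 1 : ℂ)) (i3.const_mul (d * w)), integral_const_mul,
    integral_const_mul, hf0, sub_zero] at key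
  simp only [hankelMoment]
  linear_combination -key

/-- The Hankel-type amplitude `∫₀^∞ e^{-t} t^a (1 + t w)^a dt`, in a form that converges up to and
on the cut. -/
def hankelAmp (a : ℝ) (w : ℂ) : ℂ :=
  2 * hankelMoment a (a + 1) w - hankelMoment (a + 1) (a + 1) w / (a + 1)

section Amp

variable {a : ℝ} {w : ℂ}

/-- For -1 < a < 0 the power (1 + tw)^a is unbounded as w approaches the cut. One parts relation and
one splitting relation raise its exponent to a + 1 ≥ 0, which gives a majorant uniform up to the
cut. -/
lemma hankelAmp_eq (ha : -1 < a) (hw : w ∈ Complex.slitPlane) :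
    hankelAmp a w = hankelMoment a a w := by
  have h1 := hankelMoment_parts ha (a + 1) hw
  have h2 := hankelMoment_succ ha (a + 1) hw
  rw [add_sub_cancel_right] at h1 h2
  have hne : (a : ℂ) + 1 ≠ 0 := by exact_mod_cast (by linarith : a + 1 ≠ 0)
  rw [hankelAmp, h1]
  field_simp
  push_cast
  linear_combination ((a : ℂ) + 1) * h2

/-- This is w²y'' + (1 + 2w)y' = a(a + 1)y for y = `hankelMoment a a`, as each derivative in w
raises c and lowers d by one. Under w = 1/(2zr) it becomes the free radial equation. -/
lemma hankelMoment_ode (ha : -1 < a) (hw : w ∈ Complex.slitPlane) :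
    w ^ 2 * (a * ((a - 1) * hankelMoment (a + 2) (a - 2) w)) +
      (1 + 2 * w) * (a * hankelMoment (a + 1) (a - 1) w) =
      a * (a + 1) * hankelMoment a a w := by
  have h1 := hankelMoment_parts ha (a - 1) hw
  have h2 := hankelMoment_succ ha a hw
  have h3 := hankelMoment_succ (by linarith : -1 < a + 1) (a - 1) hw
  rw [show a - 1 - 1 = a - 2 by ring] at h1 h3
  rw [show a + 1 + 1 = a + 2 by ring] at h3
  push_cast at h1
  linear_combination (a : ℂ) * h1 - a * (a + 1) * h2 - w * a * (a - 1) * h3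

lemma differentiableOn_hankelAmp (ha : -1 < a) :
    DifferentiableOn ℂ (hankelAmp a) Complex.slitPlane := fun _ hw =>
  (((hasDerivAt_hankelMoment ha (a + 1) hw).const_mul 2).sub
    ((hasDerivAt_hankelMoment (by linarith : -1 < a + 1) (a + 1) hw).div_const _)).differentiableAt
    |>.differentiableWithinAt

/-- For d ≥ 0 the modulus of the power is bounded whatever its branch, so the estimate ignores the
cut. -/
lemma exists_norm_hankelMoment_le {c d : ℝ} (hc : -1 < c) (hd : 0 ≤ d) (B : ℝ) :
    ∃ D, ∀ w : ℂ, ‖w‖ ≤ B → ‖hankelMoment c d w‖ ≤ D := by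
  obtain ⟨C, -, h⟩ := exists_norm_one_add_mul_cpow_le hd B
  exact ⟨_, fun w hw => norm_integral_le_of_norm_le (integrableOn_exp_half_mul_rpow hc C)
    ((ae_restrict_mem measurableSet_Ioi).mono fun t ht =>
      norm_hankel_integrand_le ht (h w hw t (le_of_lt ht)))⟩

lemma exists_norm_hankelAmp_le (ha : -1 < a) (B : ℝ) :
    ∃ D, 0 ≤ D ∧ ∀ w : ℂ, ‖w‖ ≤ B → ‖hankelAmp a w‖ ≤ D := by
  have ha1 : 0 ≤ a + 1 := by linarith
  obtain ⟨D₁, h₁⟩ := exists_norm_hankelMoment_le ha ha1 B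
  obtain ⟨D₂, h₂⟩ := exists_norm_hankelMoment_le (by linarith : -1 < a + 1) ha1 B
  refine ⟨|2 * D₁ + D₂ / (a + 1)|, abs_nonneg _, fun w hw => le_trans ?_ (le_abs_self _)⟩
  refine (norm_sub_le _ _).trans ?_
  rw [norm_mul, norm_div, Complex.norm_ofNat]
  have : ‖(a : ℂ) + 1‖ = a + 1 := by
    rw [← Complex.ofReal_one, ← Complex.ofReal_add, Complex.norm_real, Real.norm_of_nonneg ha1]
  rw [this]
  have := h₁ w hw
  have := h₂ w hw
  gcongr

lemma tendsto_hankelMoment {ι : Type*} {l : Filter ι} [l.IsCountablyGenerated] {W : ι → ℂ}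
    {c d B : ℝ} (hc : -1 < c) (hd : 0 ≤ d) (hB : ∀ᶠ i in l, ‖W i‖ ≤ B) {g : ℝ → ℂ}
    (hg : ∀ᵐ t : ℝ ∂(volume.restrict (Ioi (0 : ℝ))),
      Tendsto (fun i => (1 + (t : ℂ) * W i) ^ (d : ℂ)) l (𝓝 (g t))) :
    Tendsto (fun i => hankelMoment c d (W i)) l
      (𝓝 (∫ t in Ioi (0 : ℝ), ((Real.exp (-t) * t ^ c : ℝ) : ℂ) * g t)) := by
  obtain ⟨C, -, h⟩ := exists_norm_one_add_mul_cpow_le hd B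
  refine tendsto_integral_filter_of_dominated_convergence _
    (Eventually.of_forall fun i => (measurable_hankel_integrand c d (W i)).aestronglyMeasurable)
    ?_ (integrableOn_exp_half_mul_rpow hc C) (hg.mono fun t ht => ht.const_mul _)
  filter_upwards [hB] with i hi
  filter_upwards [ae_restrict_mem measurableSet_Ioi] with t ht
  exact norm_hankel_integrand_le ht (h _ hi t (le_of_lt ht))

lemma hankelMoment_zero {c : ℝ} (hc : -1 < c) (d : ℝ) :
    hankelMoment c d 0 = Real.Gamma (c + 1) := by
  rw [Real.Gamma_eq_integral (by linarith), hankelMoment]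
  simp only [mul_zero, add_zero, Complex.one_cpow, mul_one, add_sub_cancel_right]
  exact integral_ofReal

lemma hankelAmp_zero (ha : -1 < a) : hankelAmp a 0 = Real.Gamma (a + 1) := by
  have hne : (a : ℂ) + 1 ≠ 0 := by exact_mod_cast (by linarith : a + 1 ≠ 0)
  rw [hankelAmp, hankelMoment_zero ha, hankelMoment_zero (by linarith),
    Real.Gamma_add_one (by linarith : a + 1 ≠ 0)]
  push_cast
  field_simp; ring

/-- The point 0 lies on the boundary of the slit plane, so differentiability there is unavailable;
dominated convergence gives the limit from every direction. -/
lemma tendsto_hankelAmp_zero (ha : -1 < a) {ι : Type*} {l : Filter ι} [l.IsCountablyGenerated]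
    {W : ι → ℂ} (hW : Tendsto W l (𝓝 0)) :
    Tendsto (fun i => hankelAmp a (W i)) l (𝓝 (Real.Gamma (a + 1))) := by
  have hB : ∀ᶠ i in l, ‖W i‖ ≤ 1 := by
    have h0 : Tendsto (fun i => ‖W i‖) l (𝓝 0) := by simpa using hW.norm
    exact (h0.eventually (gt_mem_nhds one_pos)).mono fun _ h => h.le
  have hg : ∀ d : ℝ, ∀ᵐ t : ℝ ∂(volume.restrict (Ioi (0 : ℝ))),
      Tendsto (fun i => (1 + (t : ℂ) * W i) ^ (d : ℂ)) l (𝓝 ((1 + (t : ℂ) * 0) ^ (d : ℂ))) := by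
    intro d
    refine Eventually.of_forall fun t => ?_
    refine (ContinuousAt.tendsto (f := fun x : ℂ => x ^ (d : ℂ)) ?_).comp
      ((hW.const_mul (t : ℂ)).const_add 1)
    exact continuousAt_cpow_const (by simp)
  rw [← hankelAmp_zero ha]
  exact ((tendsto_hankelMoment ha (by linarith) hB (hg _)).const_mul 2).sub
    ((tendsto_hankelMoment (by linarith : -1 < a + 1) (by linarith) hB (hg _)).div_const _)

end Amp

/-! ### Boundary values on the cut and their jump -/

/-- The boundary values on the real axis of the power `x ^ d`, with `arg x = σ π` for `x < 0`. -/
def boundaryPow (σ d x : ℝ) : ℂ :=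
  if 0 < x then ((x ^ d : ℝ) : ℂ) else ((|x| ^ d : ℝ) : ℂ) * Complex.exp (σ * Real.pi * d * Complex.I)

/-- The boundary values of `hankelMoment` at `-b`. -/
def hankelMomentBoundary (σ c d b : ℝ) : ℂ :=
  ∫ t in Ioi (0 : ℝ), ((Real.exp (-t) * t ^ c : ℝ) : ℂ) * boundaryPow σ d (1 - t * b)

/-- The boundary values of `hankelAmp` at `-b`. -/
def hankelAmpBoundary (σ a b : ℝ) : ℂ :=
  2 * hankelMomentBoundary σ a (a + 1) b - hankelMomentBoundary σ (a + 1) (a + 1) b / (a + 1)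

lemma tendsto_cpow_boundaryPow_of_pos {d x : ℝ} (hx : 0 < x) (σ : ℝ) :
    Tendsto (fun y : ℂ => y ^ (d : ℂ)) (𝓝 x) (𝓝 (boundaryPow σ d x)) := by
  rw [boundaryPow, if_pos hx, Complex.ofReal_cpow hx.le]
  exact continuousAt_cpow_const (Complex.ofReal_mem_slitPlane.2 hx)

lemma tendsto_cpow_of_tendsto_log {d x θ : ℝ} (hx : x < 0) {s : Set ℂ}
    (h : Tendsto Complex.log (𝓝[s] (x : ℂ)) (𝓝 (Real.log |x| + θ * Complex.I))) :
    Tendsto (fun y : ℂ => y ^ (d : ℂ)) (𝓝[s] (x : ℂ))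
      (𝓝 (((|x| ^ d : ℝ) : ℂ) * Complex.exp (θ * d * Complex.I))) := by
  have h1 := (Complex.continuous_exp.tendsto _).comp (h.mul_const (d : ℂ))
  have h2 : Complex.exp ((Real.log |x| + θ * Complex.I) * d) =
      ((|x| ^ d : ℝ) : ℂ) * Complex.exp (θ * d * Complex.I) := by
    rw [Real.rpow_def_of_pos (abs_pos.2 hx.ne), Complex.ofReal_exp, ← Complex.exp_add]
    congr 1; push_cast; ring
  rw [h2] at h1
  refine h1.congr' ?_
  have hne : ∀ᶠ y in 𝓝[s] (x : ℂ), y ≠ 0 :=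
    (eventually_ne_nhds (by exact_mod_cast hx.ne)).filter_mono nhdsWithin_le_nhds
  filter_upwards [hne] with y hy
  rw [Complex.cpow_def_of_ne_zero hy]; rfl

lemma tendsto_cpow_boundaryPow_upper {d x : ℝ} (hx : x ≠ 0) :
    Tendsto (fun y : ℂ => y ^ (d : ℂ)) (𝓝[{y | 0 < y.im}] (x : ℂ)) (𝓝 (boundaryPow 1 d x)) := by
  rcases hx.lt_or_gt with h | h
  · rw [boundaryPow, if_neg (not_lt.2 h.le)]
    have h1 := (Complex.tendsto_log_nhdsWithin_im_nonneg_of_re_neg_of_im_zero (z := x) (by simpa)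
      (by simp)).mono_left (nhdsWithin_mono _ fun y (hy : 0 < y.im) => hy.le)
    have h2 := tendsto_cpow_of_tendsto_log (d := d) (θ := Real.pi) h (by simpa using h1)
    rwa [Complex.ofReal_one, one_mul]
  · exact (tendsto_cpow_boundaryPow_of_pos h 1).mono_left nhdsWithin_le_nhds

lemma tendsto_cpow_boundaryPow_lower {d x : ℝ} (hx : x ≠ 0) :
    Tendsto (fun y : ℂ => y ^ (d : ℂ)) (𝓝[{y | y.im < 0}] (x : ℂ)) (𝓝 (boundaryPow (-1) d x)) := by
  rcases hx.lt_or_gt with h | h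
  · rw [boundaryPow, if_neg (not_lt.2 h.le)]
    have h1 := Complex.tendsto_log_nhdsWithin_im_neg_of_re_neg_of_im_zero (z := x) (by simpa)
      (by simp)
    have h2 := tendsto_cpow_of_tendsto_log (d := d) (θ := -Real.pi) h
      (by simpa [sub_eq_add_neg] using h1)
    rwa [show ((-1 : ℝ) : ℂ) * Real.pi = ((-Real.pi : ℝ) : ℂ) by push_cast; ring]
  · exact (tendsto_cpow_boundaryPow_of_pos h (-1)).mono_left nhdsWithin_le_nhds

lemma tendsto_one_add_mul_nhdsWithin {b t : ℝ} {s : Set ℂ}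
    (hs : ∀ w ∈ s, 1 + (t : ℂ) * w ∈ s) :
    Tendsto (fun w : ℂ => 1 + (t : ℂ) * w) (𝓝[s] (-(b : ℂ))) (𝓝[s] ((1 - t * b : ℝ) : ℂ)) := by
  refine tendsto_nhdsWithin_iff.2 ⟨?_, ?_⟩
  · have : Continuous fun w : ℂ => 1 + (t : ℂ) * w := by fun_prop
    refine (this.tendsto' _ _ ?_).mono_left nhdsWithin_le_nhds
    push_cast; ring
  · filter_upwards [self_mem_nhdsWithin] with w hw using hs w hw

lemma ae_one_sub_mul_ne {b : ℝ} (hb : 0 < b) :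
    ∀ᵐ t : ℝ ∂(volume.restrict (Ioi (0 : ℝ))), 1 - t * b ≠ 0 := by
  have hne : ∀ᵐ t : ℝ, t ≠ 1 / b := by simp [ae_iff]
  refine ae_restrict_of_ae (hne.mono fun t ht h => ht ?_)
  rw [eq_div_iff hb.ne']; linarith

lemma tendsto_hankelAmp_boundary {a b σ : ℝ} (ha : -1 < a) (hb : 0 < b) {s : Set ℂ}
    (hs : ∀ t : ℝ, 0 < t → ∀ w ∈ s, 1 + (t : ℂ) * w ∈ s)
    (hpow : ∀ d x : ℝ, x ≠ 0 →
      Tendsto (fun y : ℂ => y ^ (d : ℂ)) (𝓝[s] (x : ℂ)) (𝓝 (boundaryPow σ d x))) :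
    Tendsto (hankelAmp a) (𝓝[s] (-(b : ℂ))) (𝓝 (hankelAmpBoundary σ a b)) := by
  have hB : ∀ᶠ w in 𝓝[s] (-(b : ℂ)), ‖w‖ ≤ b + 1 := by
    refine Eventually.filter_mono nhdsWithin_le_nhds ?_
    have := (continuous_norm.tendsto (-(b : ℂ))).eventually
      (gt_mem_nhds (show ‖-(b : ℂ)‖ < b + 1 by
        rw [norm_neg, Complex.norm_real, Real.norm_of_nonneg hb.le]; linarith))
    exact this.mono fun _ h => le_of_lt h
  have hg : ∀ᵐ t : ℝ ∂(volume.restrict (Ioi (0 : ℝ))),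
      Tendsto (fun w => (1 + (t : ℂ) * w) ^ ((a + 1 : ℝ) : ℂ)) (𝓝[s] (-(b : ℂ)))
        (𝓝 (boundaryPow σ (a + 1) (1 - t * b))) := by
    filter_upwards [ae_one_sub_mul_ne hb, ae_restrict_mem measurableSet_Ioi] with t ht ht0
    exact (hpow _ _ ht).comp (tendsto_one_add_mul_nhdsWithin (hs t ht0))
  exact ((tendsto_hankelMoment ha (by linarith) hB hg).const_mul 2).sub
    ((tendsto_hankelMoment (by linarith : -1 < a + 1) (by linarith) hB hg).div_const _)

lemma norm_boundaryPow (σ d x : ℝ) : ‖boundaryPow σ d x‖ = |x| ^ d := by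
  rw [boundaryPow]
  split_ifs with h
  · rw [Complex.norm_real, Real.norm_of_nonneg (Real.rpow_nonneg h.le _), abs_of_pos h]
  · rw [norm_mul, Complex.norm_real, Real.norm_of_nonneg (by positivity)]
    have : (σ * Real.pi * d * Complex.I : ℂ) = ((σ * Real.pi * d : ℝ) : ℂ) * Complex.I := by
      push_cast; ring
    rw [this, Complex.norm_exp_ofReal_mul_I, mul_one]

lemma measurable_boundaryPow (σ d : ℝ) : Measurable (boundaryPow σ d) := by
  unfold boundaryPow
  refine Measurable.ite measurableSet_Ioi ?_ ?_ <;> fun_prop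

lemma integrableOn_hankelMomentBoundary (σ : ℝ) {c d b : ℝ} (hc : -1 < c) (hd : 0 ≤ d)
    (hb : 0 < b) : IntegrableOn
      (fun t => ((Real.exp (-t) * t ^ c : ℝ) : ℂ) * boundaryPow σ d (1 - t * b)) (Ioi 0) := by
  obtain ⟨C, -, h⟩ := exists_one_add_mul_rpow_le d b hb.le
  refine Integrable.mono' (integrableOn_exp_half_mul_rpow hc C) ?_ ?_
  · have := (measurable_boundaryPow σ d).comp (by fun_prop : Measurable fun t : ℝ => 1 - t * b)
    have h2 : Measurable fun t : ℝ => Real.exp (-t) * t ^ c := by fun_prop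
    exact ((Complex.measurable_ofReal.comp h2).mul this).aestronglyMeasurable
  · filter_upwards [ae_restrict_mem measurableSet_Ioi] with t ht
    have ht : 0 < t := ht
    refine norm_hankel_integrand_le ht ?_
    rw [norm_boundaryPow]
    refine le_trans (Real.rpow_le_rpow (abs_nonneg _) ?_ hd) (h t ht.le)
    have := mul_pos ht hb
    rw [abs_le]; constructor <;> linarith

/-- The two branches agree for t < 1/b. For t = s + 1/b one has 1 - tb = -sb and t = (1 + sb)/b, so
the base of the power and the base of the weight change roles: the exponents c and d are
interchanged, and e^{-t} contributes e^{-1/b}. -/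
lemma hankelMomentBoundary_sub {c d b : ℝ} (hc : -1 < c) (hd : 0 < d) (hb : 0 < b) :
    hankelMomentBoundary (-1) c d b - hankelMomentBoundary 1 c d b =
      (Complex.exp (-(Real.pi * d * Complex.I)) - Complex.exp (Real.pi * d * Complex.I)) *
        (Real.exp (-(1 / b)) * (b ^ (d - c) : ℝ) * hankelMoment d c b) := by
  set κ := Complex.exp (-(Real.pi * d * Complex.I)) - Complex.exp (Real.pi * d * Complex.I) with hκ
  rw [hankelMomentBoundary, hankelMomentBoundary, ← integral_sub
    (integrableOn_hankelMomentBoundary _ hc hd.le hb)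
    (integrableOn_hankelMomentBoundary _ hc hd.le hb), hankelMoment, ← integral_const_mul,
    ← integral_const_mul, ← integral_indicator measurableSet_Ioi,
    ← integral_indicator measurableSet_Ioi, ← integral_add_right_eq_self _ (1 / b)]
  congr 1; ext s
  have hbb : 0 < 1 / b := by positivity
  by_cases hs : 0 < s
  · have hs' : s + 1 / b ∈ Ioi (0 : ℝ) := by simp only [mem_Ioi]; positivity
    rw [indicator_of_mem hs', indicator_of_mem (mem_Ioi.2 hs)]
    have hx : 1 - (s + 1 / b) * b = -(s * b) := by field_simp; ring
    have hsb : 0 < s * b := by positivity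
    simp only [hx, boundaryPow, if_neg (not_lt.2 (neg_nonpos.2 hsb.le)), abs_neg, abs_of_pos hsb]
    have e1 : (s + 1 / b) ^ c = (1 + s * b) ^ c * b ^ (-c) := by
      rw [show s + 1 / b = (1 + s * b) * b⁻¹ by field_simp; ring,
        Real.mul_rpow (by positivity) (by positivity), Real.inv_rpow hb.le, Real.rpow_neg hb.le]
    have e2 : (1 + (s : ℂ) * b) ^ (c : ℂ) = (((1 + s * b) ^ c : ℝ) : ℂ) := by
      rw [Complex.ofReal_cpow (by positivity)]; push_cast; rfl
    have e3 : Real.exp (-(s + 1 / b)) = Real.exp (-(1 / b)) * Real.exp (-s) := by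
      rw [← Real.exp_add]; congr 1; ring
    have e4 : b ^ (d - c) = b ^ d * b ^ (-c) := by rw [← Real.rpow_add hb]; rfl
    rw [e1, e2, e3, e4, Real.mul_rpow hs.le hb.le, hκ]
    push_cast
    rw [show (-1 : ℂ) * Real.pi * d * Complex.I = -(Real.pi * d * Complex.I) by ring, one_mul]
    ring
  · rw [indicator_of_notMem (show s ∉ Ioi (0 : ℝ) from hs)]
    by_cases hs' : s + 1 / b ∈ Ioi (0 : ℝ)
    · rw [indicator_of_mem hs']
      have hx : 1 - (s + 1 / b) * b = -(s * b) := by field_simp; ring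
      rcases (not_lt.1 hs).eq_or_lt with h0 | h0
      · have hx0 : 1 - (s + 1 / b) * b = 0 := by rw [hx, h0]; ring
        simp only [hx0, boundaryPow, lt_irrefl, if_false, abs_zero, Real.zero_rpow hd.ne',
          Complex.ofReal_zero, zero_mul, mul_zero, sub_self]
      · have : 0 < -(s * b) := by nlinarith
        simp only [hx, boundaryPow, if_pos this, sub_self]
    · rw [indicator_of_notMem hs']

/-- The jump of `hankelAmp` across its cut. -/
lemma hankelAmpBoundary_sub {a b : ℝ} (ha : -1 < a) (hb : 0 < b) :
    hankelAmpBoundary (-1) a b - hankelAmpBoundary 1 a b =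
      (Complex.exp (Real.pi * (a + 1) * Complex.I) -
        Complex.exp (-(Real.pi * (a + 1) * Complex.I))) * Real.exp (-(1 / b)) * hankelAmp a b := by
  have hbs : (b : ℂ) ∈ Complex.slitPlane := Complex.ofReal_mem_slitPlane.2 hb
  have hne : (a : ℂ) + 1 ≠ 0 := by exact_mod_cast (by linarith : a + 1 ≠ 0)
  -- Apart from common factors the jumps are b·`hankelMoment (a+1) a b` and `hankelMoment (a+1)
  -- (a+1) b`. The relations `h1` and `h2` collapse their combination to -`hankelMoment a a b`,
  -- which explains the reversed order of the exponentials.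
  have j1 := hankelMomentBoundary_sub ha (by linarith : 0 < a + 1) hb
  have j2 := hankelMomentBoundary_sub (by linarith : -1 < a + 1) (by linarith : 0 < a + 1) hb
  have h1 := hankelMoment_parts ha (a + 1) hbs
  have h2 := hankelMoment_succ ha (a + 1) hbs
  have h3 := hankelAmp_eq ha hbs
  rw [add_sub_cancel_right] at h1 h2
  rw [sub_self, Real.rpow_zero] at j2
  rw [show a + 1 - a = 1 by ring, Real.rpow_one] at j1
  push_cast at j1 j2 h1
  rw [hankelAmpBoundary, hankelAmpBoundary, h3]
  have e : ∀ x y x' y' : ℂ, (2 * x - y / (a + 1)) - (2 * x' - y' / (a + 1)) =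
      2 * (x - x') - (y - y') / (a + 1) := fun x y x' y' => by ring
  rw [e, j1, j2, h1]
  field_simp
  rw [h2]
  push_cast
  ring

/-! ### The free Jost solution -/

/-- The outgoing solution of the free equation, up to normalization. -/
def freeJost (a : ℝ) (z : ℂ) (r : ℝ) : ℂ :=
  Complex.exp (-(z * r)) * hankelAmp a (2 * z * r)⁻¹

/-- The radial derivative of `freeJost`. -/
def freeJostDeriv (a : ℝ) (z : ℂ) (r : ℝ) : ℂ :=
  Complex.exp (-(z * r)) * (-z * hankelMoment a a (2 * z * r)⁻¹ -
    2 * z * (2 * z * r)⁻¹ ^ 2 * (a * hankelMoment (a + 1) (a - 1) (2 * z * r)⁻¹))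

lemma inv_two_mul_mem_slitPlane {z : ℂ} (hz : z ∈ Complex.slitPlane) {r : ℝ} (hr : 0 < r) :
    (2 * z * r)⁻¹ ∈ Complex.slitPlane := by
  have h : 2 * z * (r : ℂ) ∈ Complex.slitPlane := by
    rw [Complex.mem_slitPlane_iff] at hz ⊢
    rcases hz with h | h
    · left; simp; positivity
    · right; simp [hr.ne', h]
  have hn : 0 < Complex.normSq (2 * z * r) := Complex.normSq_pos.2 (Complex.slitPlane_ne_zero h)
  rw [Complex.mem_slitPlane_iff] at h ⊢
  rw [Complex.inv_re, Complex.inv_im]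
  rcases h with h | h
  · exact Or.inl (div_pos h hn)
  · exact Or.inr (div_ne_zero (neg_ne_zero.2 h) hn.ne')

lemma hasDerivAt_inv_two_mul {z : ℂ} (hz : z ≠ 0) {r : ℝ} (hr : 0 < r) :
    HasDerivAt (fun r : ℝ => (2 * z * r)⁻¹) (-(2 * z * (2 * z * r)⁻¹ ^ 2)) r := by
  have hr' : (r : ℂ) ≠ 0 := by exact_mod_cast hr.ne'
  have h := (((hasDerivAt_id (r : ℂ)).const_mul (2 * z)).inv
    (by simp [hz, hr'])).comp_ofReal
  refine h.congr_deriv ?_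
  simp only [id]
  field_simp

lemma hasDerivAt_exp_neg_mul (z : ℂ) (r : ℝ) :
    HasDerivAt (fun r : ℝ => Complex.exp (-(z * r))) (-z * Complex.exp (-(z * r))) r := by
  have h := (((hasDerivAt_id (r : ℂ)).const_mul z).neg.cexp).comp_ofReal
  refine h.congr_deriv ?_
  simp; ring

section

variable {a μ : ℝ} {z : ℂ}

lemma hasDerivAt_freeJost (ha : -1 < a) (hz : z ∈ Complex.slitPlane) {r : ℝ} (hr : 0 < r) :
    HasDerivAt (freeJost a z) (freeJostDeriv a z r) r := by
  have hw := inv_two_mul_mem_slitPlane hz hr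
  have h1 := (hasDerivAt_hankelMoment ha a hw).scomp r
    (hasDerivAt_inv_two_mul (Complex.slitPlane_ne_zero hz) hr)
  refine (((hasDerivAt_exp_neg_mul z r).mul h1).congr_deriv ?_).congr_of_eventuallyEq ?_
  · simp only [freeJostDeriv, Function.comp, smul_eq_mul]; ring
  · filter_upwards [lt_mem_nhds hr] with s hs
    simp only [freeJost, Pi.mul_apply, Function.comp,
      hankelAmp_eq ha (inv_two_mul_mem_slitPlane hz hs)]

lemma hasDerivAt_freeJostDeriv (ha : -1 < a) (haμ : μ ^ 2 - 1 / 4 = a * (a + 1))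
    (hz : z ∈ Complex.slitPlane) {r : ℝ} (hr : 0 < r) :
    HasDerivAt (freeJostDeriv a z) (radialCoeff (fun _ => 0) μ (z ^ 2) r * freeJost a z r) r := by
  have hw := inv_two_mul_mem_slitPlane hz hr
  have hz0 := Complex.slitPlane_ne_zero hz
  have hr0 : (r : ℂ) ≠ 0 := by exact_mod_cast hr.ne'
  have hd := hasDerivAt_inv_two_mul hz0 hr
  have h1 := (hasDerivAt_hankelMoment ha a hw).scomp r hd
  have h2 := (hasDerivAt_hankelMoment (by linarith : -1 < a + 1) (a - 1) hw).scomp r hd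
  have h3 := (hasDerivAt_exp_neg_mul z r).mul ((h1.const_mul (-z)).sub
    (((hd.pow 2).const_mul (2 * z)).mul (h2.const_mul (a : ℂ))))
  refine h3.congr_deriv ?_
  have hode := hankelMoment_ode ha hw
  have e : (((μ ^ 2 - 1 / 4) / r ^ 2 + 0 : ℝ) : ℂ) =
      4 * z ^ 2 * ((2 * z * r)⁻¹) ^ 2 * (a * (a + 1)) := by
    rw [haμ]; push_cast; field_simp; ring
  rw [radialCoeff, e, freeJost, hankelAmp_eq ha hw]
  rw [show a + 1 + 1 = a + 2 by ring, show a - 1 - 1 = a - 2 by ring]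
  simp only [Function.comp, smul_eq_mul, Pi.mul_apply, Pi.sub_apply]
  push_cast
  set w := (2 * z * (r : ℂ))⁻¹
  simp only [Pi.pow_apply]
  linear_combination 4 * z ^ 2 * w ^ 2 * Complex.exp (-(z * r)) * hode

lemma isSol_freeJost (ha : -1 < a) (haμ : μ ^ 2 - 1 / 4 = a * (a + 1))
    (hz : z ∈ Complex.slitPlane) :
    IsSol (radialCoeff (fun _ => 0) μ (z ^ 2)) (freeJost a z) (freeJostDeriv a z) := by
  refine ⟨fun r hr => hasDerivAt_freeJost ha hz hr, .of_hasDerivAt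
    (fun r hr => hasDerivAt_freeJostDeriv ha haμ hz hr) ?_⟩
  refine ContinuousOn.mul ?_ fun r hr =>
    (hasDerivAt_freeJost ha hz hr).continuousAt.continuousWithinAt
  unfold radialCoeff
  refine ContinuousOn.add (Complex.continuous_ofReal.comp_continuousOn ?_) continuousOn_const
  exact (continuousOn_const.div (by fun_prop) fun r hr => pow_ne_zero _ (ne_of_gt hr)).add
    continuousOn_const

/-- No sector is excluded: the amplitude is bounded on discs, across its cut, so one constant serves
on both sides up to the cut. -/
lemma exists_norm_freeJost_le (ha : -1 < a) {δ : ℝ} (hδ : 0 < δ) :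
    ∃ D, 0 ≤ D ∧ ∀ z : ℂ, δ ≤ ‖z‖ → ∀ r : ℝ, 1 ≤ r →
      ‖freeJost a z r‖ ≤ D * Real.exp (-(z.re * r)) := by
  obtain ⟨D, hD, h⟩ := exists_norm_hankelAmp_le ha (2 * δ)⁻¹
  refine ⟨D, hD, fun z hz r hr => ?_⟩
  rw [freeJost, norm_mul, Complex.norm_exp, mul_comm]
  have e : (-(z * (r : ℂ))).re = -(z.re * r) := by simp
  rw [e]
  gcongr
  refine h _ ?_
  rw [norm_inv, norm_mul, norm_mul, Complex.norm_real, Complex.norm_ofNat,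
    Real.norm_of_nonneg (by linarith)]
  exact inv_anti₀ (by positivity) (by nlinarith [norm_nonneg z])

lemma differentiableOn_freeJost (ha : -1 < a) {r : ℝ} (hr : 0 < r) :
    DifferentiableOn ℂ (fun z => freeJost a z r) Complex.slitPlane := by
  refine DifferentiableOn.mul (by fun_prop) ((differentiableOn_hankelAmp ha).comp ?_
    fun z hz => inv_two_mul_mem_slitPlane hz hr)
  refine DifferentiableOn.inv (by fun_prop) fun z hz => ?_
  have hr' : (r : ℂ) ≠ 0 := by exact_mod_cast hr.ne'
  simp [Complex.slitPlane_ne_zero hz, hr']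

lemma tendsto_freeJost (ha : -1 < a) (hz : z ≠ 0) :
    Tendsto (fun r : ℝ => Complex.exp (z * r) * freeJost a z r) atTop
      (𝓝 (Real.Gamma (a + 1))) := by
  have hW : Tendsto (fun r : ℝ => (2 * z * (r : ℂ))⁻¹) atTop (𝓝 0) := by
    refine tendsto_inv₀_cobounded.comp (tendsto_norm_atTop_iff_cobounded.1 ?_)
    simp only [norm_mul, Complex.norm_real]
    exact (tendsto_norm_atTop_atTop).const_mul_atTop (by simpa using hz)
  refine (tendsto_hankelAmp_zero ha hW).congr fun r => ?_
  rw [freeJost, ← mul_assoc, ← Complex.exp_add, add_neg_cancel, Complex.exp_zero, one_mul]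

/-- The derivative asymptotics are known for the solution from `exists_jostSol` with V = 0.
Uniqueness identifies it with the normalized free solution, so no second asymptotic computation is
needed. -/
lemma tendsto_freeJostDeriv (ha : -1 < a) (haμ : μ ^ 2 - 1 / 4 = a * (a + 1))
    (hz : 0 ≤ z.re) (hz0 : z ≠ 0) :
    Tendsto (fun r : ℝ => Complex.exp (z * r) * freeJostDeriv a z r) atTop
      (𝓝 (-z * Real.Gamma (a + 1))) := by
  have hm : Measurable fun _ : ℝ => (0 : ℝ) := measurable_const
  have hi : IntegrableOn (fun s : ℝ => s * |(fun _ : ℝ => (0 : ℝ)) s|) (Ioi 0) := by simp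
  have hzs : z ∈ Complex.slitPlane := by
    rw [Complex.mem_slitPlane_iff]
    by_contra! h
    exact hz0 (Complex.ext (le_antisymm h.1 hz) h.2)
  have hG : (Real.Gamma (a + 1) : ℂ) ≠ 0 := by
    exact_mod_cast (Real.Gamma_pos_of_pos (by linarith)).ne'
  obtain ⟨u, u', hu, hul, hul'⟩ := exists_jostSol (μ := μ) hm hi hz hz0
  have hE := (isSol_freeJost ha haμ hzs).const_mul (Real.Gamma (a + 1) : ℂ)⁻¹
  have hEl : Tendsto (fun r : ℝ => Complex.exp (z * r) *
      ((Real.Gamma (a + 1) : ℂ)⁻¹ * freeJost a z r)) atTop (𝓝 1) := by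
    have := (tendsto_freeJost ha hz0).const_mul (Real.Gamma (a + 1) : ℂ)⁻¹
    rw [inv_mul_cancel₀ hG] at this
    exact this.congr fun r => by ring
  have heq := jostSol_unique hm hi hz hu hE hul hEl
  rw [mul_comm]
  refine (hul'.const_mul (Real.Gamma (a + 1) : ℂ)).congr' ?_
  filter_upwards [eventually_gt_atTop 0] with r hr
  have h1 : HasDerivAt u ((Real.Gamma (a + 1) : ℂ)⁻¹ * freeJostDeriv a z r) r :=
    (hE.hasDerivAt r hr).congr_of_eventuallyEq
      (heq.eventuallyEq_of_mem (Ioi_mem_nhds hr))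
  rw [(hu.hasDerivAt r hr).unique h1]
  field_simp

end

/-! ### The Jost function as a pairing of the free solution with a cut-off source -/

/-- The coefficient of `∂ᵣφ` in the commutator of the radial operator with a cutoff at `[1, 2]`. -/
def cutoffCoeff₁ (r : ℝ) : ℝ := if r ≤ 2 then 12 * (r - 1) * (2 - r) else 0

/-- The coefficient of `φ` for the same cutoff, together with the potential. -/
def cutoffCoeff₂ (V : ℝ → ℝ) (r : ℝ) : ℝ :=
  if r ≤ 2 then 18 - 12 * r + (r - 1) ^ 2 * (5 - 2 * r) * V r else V r

/-- The source `-(Hφ̃ - k²φ̃)` of the cut-off regular solution. -/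
def cutoffSource (V : ℝ → ℝ) (μ : ℝ) (z : ℂ) (r : ℝ) : ℂ :=
  cutoffCoeff₁ r * regularSolDeriv V μ (z ^ 2) r + cutoffCoeff₂ V r * regularSol V μ (z ^ 2) r

/-- The pairing of the free Jost solution with the source; up to normalization, the Jost function. -/
def jostPairing (V : ℝ → ℝ) (a μ : ℝ) (z : ℂ) : ℂ :=
  ∫ r in Ioi (1 : ℝ), freeJost a z r * cutoffSource V μ z r

lemma measurable_cutoffCoeff₁ : Measurable cutoffCoeff₁ :=
  Measurable.ite measurableSet_Iic (by fun_prop) (by fun_prop)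

lemma measurable_cutoffCoeff₂ {V : ℝ → ℝ} (hVm : Measurable V) : Measurable (cutoffCoeff₂ V) :=
  Measurable.ite measurableSet_Iic (by fun_prop) hVm

/-- The cutoff is θ = (r - 1)²(5 - 2r) on [1, 2], with 2θ' = 12(r - 1)(2 - r) and θ'' = 18 - 12r.
These are at most 12 and 6 in modulus, and |θ| ≤ 1. -/
lemma abs_cutoffCoeff₁_add_le (V : ℝ → ℝ) {r : ℝ} (hr : 1 < r) :
    |cutoffCoeff₁ r| + |cutoffCoeff₂ V r| ≤ (Ioc (1 : ℝ) 2).indicator (fun _ => 20) r + |V r| := by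
  rw [cutoffCoeff₁, cutoffCoeff₂]
  by_cases h : r ≤ 2
  · rw [if_pos h, if_pos h, indicator_of_mem (show r ∈ Ioc (1 : ℝ) 2 from ⟨hr, h⟩)]
    have h1 : |12 * (r - 1) * (2 - r)| ≤ 12 := by rw [abs_le]; constructor <;> nlinarith
    have h2 : |18 - 12 * r| ≤ 6 := by rw [abs_le]; constructor <;> linarith
    have h3 : |(r - 1) ^ 2 * (5 - 2 * r)| ≤ 1 := by
      rw [abs_le]
      constructor <;> nlinarith [sq_nonneg (r - 1),
        mul_nonneg (sq_nonneg (r - 2)) (by linarith : 0 ≤ 2 * r - 1),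
        mul_nonneg (sq_nonneg (r - 1)) (by linarith : 0 ≤ 2 - r)]
    have h4 := abs_add_le (18 - 12 * r) ((r - 1) ^ 2 * (5 - 2 * r) * V r)
    rw [abs_mul _ (V r)] at h4
    have h5 : |(r - 1) ^ 2 * (5 - 2 * r)| * |V r| ≤ 1 * |V r| := by gcongr
    linarith
  · rw [if_neg h, if_neg h, indicator_of_notMem fun h' => h h'.2]
    simp

section

variable {V : ℝ → ℝ} {a μ : ℝ} {z : ℂ}

lemma aestronglyMeasurable_pairing (ha : -1 < a) (hμ : 0 < μ) (hVm : Measurable V)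
    (hV : IntegrableOn (fun s => s * |V s|) (Ioi 0)) (hz : z ∈ Complex.slitPlane) :
    AEStronglyMeasurable (fun r => freeJost a z r * cutoffSource V μ z r)
      (volume.restrict (Ioi 1)) := by
  have hsub : Ioi (1 : ℝ) ⊆ Ioi 0 := Ioi_subset_Ioi zero_le_one
  have hs := isSol_regularSol hμ hVm hV (z ^ 2)
  have h1 : AEStronglyMeasurable (freeJost a z) (volume.restrict (Ioi 1)) :=
    ContinuousOn.aestronglyMeasurable (fun r hr =>
      (hasDerivAt_freeJost ha hz (hsub hr)).continuousAt.continuousWithinAt) measurableSet_Ioi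
  have h2 := (hs.continuousOn.mono hsub).aestronglyMeasurable (μ := volume) measurableSet_Ioi
  have h3 := (hs.continuousOn'.mono hsub).aestronglyMeasurable (μ := volume) measurableSet_Ioi
  exact h1.mul (((Complex.measurable_ofReal.comp
    measurable_cutoffCoeff₁).aestronglyMeasurable.mul h3).add
      ((Complex.measurable_ofReal.comp (measurable_cutoffCoeff₂ hVm)).aestronglyMeasurable.mul h2))

/-- Source of the half plane: e^{-Re z · r} e^{|Re z| r} ≤ e^{ηr} because |Re z| - Re z ≤ η when Re
z ≥ -η/2. -/
lemma exists_norm_pairing_le (ha : -1 < a) (hμ : 0 < μ) (hVm : Measurable V)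
    (hV : IntegrableOn (fun s => s * |V s|) (Ioi 0)) {δ : ℝ} (hδ : 0 < δ) (Λ : ℝ) :
    ∃ C, 0 ≤ C ∧ ∀ η : ℝ, 0 ≤ η → ∀ z : ℂ, δ ≤ ‖z‖ → ‖z‖ ≤ Λ → -(η / 2) ≤ z.re →
      ∀ r, 1 < r → ‖freeJost a z r * cutoffSource V μ z r‖ ≤
        C * (((Ioc (1 : ℝ) 2).indicator (fun _ => 20) r + |V r|) * Real.exp (η * r)) := by
  obtain ⟨C, hC, h1⟩ := exists_norm_freeJost_le ha hδ
  obtain ⟨D, hD, h2⟩ := exists_norm_regularSol_le_exp hμ hVm hV hδ Λ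
  refine ⟨C * D, by positivity, fun η hη z hz hz' hre r hr => ?_⟩
  obtain ⟨h3, h4⟩ := h2 z hz hz' r hr.le
  have h5 : ‖cutoffSource V μ z r‖ ≤
      (|cutoffCoeff₁ r| + |cutoffCoeff₂ V r|) * (D * Real.exp (|z.re| * r)) := by
    refine (norm_add_le _ _).trans ?_
    rw [norm_mul, norm_mul, Complex.norm_real, Complex.norm_real, add_mul]
    gcongr <;> exact le_rfl
  have h6 : Real.exp (-(z.re * r)) * Real.exp (|z.re| * r) ≤ Real.exp (η * r) := by
    rw [← Real.exp_add, Real.exp_le_exp]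
    have : |z.re| - z.re ≤ η := by
      rcases abs_cases z.re with ⟨h, _⟩ | ⟨h, _⟩ <;> rw [h] <;> linarith
    nlinarith
  have h7 := abs_cutoffCoeff₁_add_le V hr
  have h8 := le_trans (by positivity) h7
  rw [norm_mul]
  calc _ ≤ (C * Real.exp (-(z.re * r))) *
        ((|cutoffCoeff₁ r| + |cutoffCoeff₂ V r|) * (D * Real.exp (|z.re| * r))) := by
        gcongr; exact h1 z hz r hr.le
    _ = C * D * ((|cutoffCoeff₁ r| + |cutoffCoeff₂ V r|) *
        (Real.exp (-(z.re * r)) * Real.exp (|z.re| * r))) := by ring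
    _ ≤ _ := by gcongr

lemma integrableOn_pairing_bound {η : ℝ}
    (hVη : IntegrableOn (fun r => |V r| * Real.exp (η * r)) (Ioi 1))
    (C : ℝ) : IntegrableOn (fun r =>
      C * (((Ioc (1 : ℝ) 2).indicator (fun _ => 20) r + |V r|) * Real.exp (η * r))) (Ioi 1) := by
  refine Integrable.const_mul ?_ C
  have h1 : IntegrableOn (fun r : ℝ => 20 * Real.exp (η * r)) (Ioc 1 2) :=
    (Continuous.integrableOn_Icc (by fun_prop)).mono_set Ioc_subset_Icc_self
  have h2 := (h1.integrable_indicator measurableSet_Ioc).integrableOn (s := Ioi 1)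
  refine (h2.add hVη).congr (ae_of_all _ fun r => ?_)
  simp only [Pi.add_apply, add_mul]
  congr 1
  by_cases h : r ∈ Ioc (1 : ℝ) 2
  · simp only [indicator_of_mem h]
  · simp only [indicator_of_notMem h, zero_mul]

lemma differentiable_cutoffSource (hμ : 0 < μ) (hVm : Measurable V)
    (hV : IntegrableOn (fun s => s * |V s|) (Ioi 0)) {r : ℝ} (hr : 0 ≤ r) :
    Differentiable ℂ fun z => cutoffSource V μ z r := by
  obtain ⟨h1, h2⟩ := differentiable_regularSol hμ hVm hV hr
  exact ((h2.comp (differentiable_id.pow 2)).const_mul _).add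
    ((h1.comp (differentiable_id.pow 2)).const_mul _)

lemma norm_annulus_mem_nhds {z₀ : ℂ} (hz : z₀ ≠ 0) :
    {z : ℂ | ‖z₀‖ / 2 < ‖z‖} ∩ {z : ℂ | ‖z‖ < ‖z₀‖ + 1} ∈ 𝓝 z₀ :=
  inter_mem ((isOpen_lt continuous_const continuous_norm).mem_nhds
    (half_lt_self (norm_pos_iff.2 hz)))
    ((isOpen_lt continuous_norm continuous_const).mem_nhds (lt_add_one ‖z₀‖))

lemma differentiableOn_jostPairing (ha : -1 < a) (hμ : 0 < μ) (hVm : Measurable V)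
    (hV : IntegrableOn (fun s => s * |V s|) (Ioi 0)) {η : ℝ} (hη : 0 ≤ η)
    (hVη : IntegrableOn (fun r => |V r| * Real.exp (η * r)) (Ioi 1)) :
    DifferentiableOn ℂ (jostPairing V a μ) (Complex.slitPlane ∩ {z | -(η / 2) < z.re}) := by
  refine differentiableOn_integral_of_locally_dominated
    (Complex.isOpen_slitPlane.inter (isOpen_lt continuous_const Complex.continuous_re))
    (fun z hz => aestronglyMeasurable_pairing ha hμ hVm hV hz.1) ?_ fun z₀ hz₀ => ?_
  · filter_upwards [ae_restrict_mem measurableSet_Ioi] with r hr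
    have hr : 0 < r := one_pos.trans hr
    exact ((differentiableOn_freeJost ha hr).mono inter_subset_left).mul
      (differentiable_cutoffSource hμ hVm hV hr.le).differentiableOn
  · have hz0 := Complex.slitPlane_ne_zero hz₀.1
    obtain ⟨C, -, h⟩ := exists_norm_pairing_le ha hμ hVm hV
      (half_pos (norm_pos_iff.2 hz0)) (‖z₀‖ + 1)
    refine ⟨_, integrableOn_pairing_bound hVη C, _, inter_mem (norm_annulus_mem_nhds hz0)
      ((isOpen_lt continuous_const Complex.continuous_re).mem_nhds hz₀.2), ?_⟩
    filter_upwards [ae_restrict_mem measurableSet_Ioi] with r hr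
    rintro z ⟨⟨h1, h2⟩, h3⟩
    exact h η hη z (le_of_lt h1) (le_of_lt h2) (le_of_lt h3) r hr

/-- Limits of `jostPairing` from pointwise limits of the free solution. -/
lemma tendsto_jostPairing (ha : -1 < a) (hμ : 0 < μ) (hVm : Measurable V)
    (hV : IntegrableOn (fun s => s * |V s|) (Ioi 0)) {η : ℝ} (hη : 0 ≤ η)
    (hVη : IntegrableOn (fun r => |V r| * Real.exp (η * r)) (Ioi 1)) {z₀ : ℂ} (hz₀ : z₀ ≠ 0)
    {s : Set ℂ} (hs : ∀ᶠ z in 𝓝[s] z₀, z ∈ Complex.slitPlane ∧ -(η / 2) ≤ z.re) {e : ℝ → ℂ}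
    (he : ∀ r, 1 < r → Tendsto (fun z => freeJost a z r) (𝓝[s] z₀) (𝓝 (e r))) :
    Tendsto (jostPairing V a μ) (𝓝[s] z₀)
      (𝓝 (∫ r in Ioi (1 : ℝ), e r * cutoffSource V μ z₀ r)) := by
  obtain ⟨C, -, h⟩ := exists_norm_pairing_le ha hμ hVm hV
    (half_pos (norm_pos_iff.2 hz₀)) (‖z₀‖ + 1)
  refine tendsto_integral_filter_of_dominated_convergence _
    (hs.mono fun z hz => aestronglyMeasurable_pairing ha hμ hVm hV hz.1) ?_
    (integrableOn_pairing_bound hVη C) ?_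
  · filter_upwards [hs, mem_nhdsWithin_of_mem_nhds (norm_annulus_mem_nhds hz₀)] with z hz hz'
    filter_upwards [ae_restrict_mem measurableSet_Ioi] with r hr
    exact h η hη z (le_of_lt hz'.1) (le_of_lt hz'.2) hz.2 r hr
  · filter_upwards [ae_restrict_mem measurableSet_Ioi] with r hr
    exact (he r hr).mul (((differentiable_cutoffSource hμ hVm hV
      (zero_le_one.trans (le_of_lt hr))).continuous.tendsto z₀).mono_left nhdsWithin_le_nhds)

/-- Measurability and the bound pass to the limit along a sequence of admissible z, so nothing need
be known about the limit e beyond pointwise convergence. -/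
lemma integrableOn_pairing_limit (ha : -1 < a) (hμ : 0 < μ) (hVm : Measurable V)
    (hV : IntegrableOn (fun s => s * |V s|) (Ioi 0)) {η : ℝ} (hη : 0 ≤ η)
    (hVη : IntegrableOn (fun r => |V r| * Real.exp (η * r)) (Ioi 1)) {z₀ : ℂ} (hz₀ : z₀ ≠ 0)
    {s : Set ℂ} [(𝓝[s] z₀).NeBot]
    (hs : ∀ᶠ z in 𝓝[s] z₀, z ∈ Complex.slitPlane ∧ -(η / 2) ≤ z.re) {e : ℝ → ℂ}
    (he : ∀ r, 1 < r → Tendsto (fun z => freeJost a z r) (𝓝[s] z₀) (𝓝 (e r))) :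
    IntegrableOn (fun r => e r * cutoffSource V μ z₀ r) (Ioi 1) := by
  obtain ⟨C, -, h⟩ := exists_norm_pairing_le ha hμ hVm hV
    (half_pos (norm_pos_iff.2 hz₀)) (‖z₀‖ + 1)
  obtain ⟨u, hu, hu'⟩ := exists_seq_forall_of_frequently
    (hs.and (mem_nhdsWithin_of_mem_nhds (norm_annulus_mem_nhds hz₀))).frequently
  have hlim : ∀ r, 1 < r → Tendsto (fun n => freeJost a (u n) r * cutoffSource V μ (u n) r) atTop
      (𝓝 (e r * cutoffSource V μ z₀ r)) := fun r hr =>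
    ((he r hr).comp hu).mul ((((differentiable_cutoffSource hμ hVm hV
      (zero_le_one.trans hr.le)).continuous.tendsto z₀).mono_left nhdsWithin_le_nhds).comp hu)
  refine Integrable.mono' (integrableOn_pairing_bound hVη C)
    (aestronglyMeasurable_of_tendsto_ae atTop
      (fun n => aestronglyMeasurable_pairing ha hμ hVm hV (hu' n).1.1)
      ((ae_restrict_mem measurableSet_Ioi).mono hlim)) ?_
  filter_upwards [ae_restrict_mem measurableSet_Ioi] with r hr
  exact le_of_tendsto (hlim r hr).norm (Eventually.of_forall fun n =>
    h η hη (u n) (le_of_lt (hu' n).2.1) (le_of_lt (hu' n).2.2) (hu' n).1.2 r hr)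

lemma continuousOn_jostPairing (ha : -1 < a) (hμ : 0 < μ) (hVm : Measurable V)
    (hV : IntegrableOn (fun s => s * |V s|) (Ioi 0)) {η : ℝ} (hη : 0 ≤ η)
    (hVη : IntegrableOn (fun r => |V r| * Real.exp (η * r)) (Ioi 1)) :
    ContinuousOn (jostPairing V a μ) (Complex.slitPlane ∩ {z | -(η / 2) ≤ z.re}) := by
  intro z₀ hz₀
  refine tendsto_jostPairing ha hμ hVm hV hη hVη (Complex.slitPlane_ne_zero hz₀.1)
    eventually_mem_nhdsWithin fun r hr => ?_
  exact (((differentiableOn_freeJost ha (one_pos.trans hr)).differentiableAt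
    (Complex.isOpen_slitPlane.mem_nhds hz₀.1)).continuousAt.tendsto).mono_left nhdsWithin_le_nhds

end

section

variable {V : ℝ → ℝ} {a μ : ℝ} {z : ℂ}

lemma mem_slitPlane_of_re_nonneg (hz : 0 ≤ z.re) (hz0 : z ≠ 0) : z ∈ Complex.slitPlane := by
  rw [Complex.mem_slitPlane_iff]
  by_contra! h
  exact hz0 (Complex.ext (le_antisymm h.1 hz) h.2)

/-- The Wronskian of the free Jost solution with the regular solution. -/
def freeWronskian (V : ℝ → ℝ) (a μ : ℝ) (z : ℂ) (r : ℝ) : ℂ :=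
  freeJost a z r * regularSolDeriv V μ (z ^ 2) r - regularSol V μ (z ^ 2) r * freeJostDeriv a z r

lemma hasPrimitive_freeWronskian (ha : -1 < a) (haμ : μ ^ 2 - 1 / 4 = a * (a + 1)) (hμ : 0 < μ)
    (hVm : Measurable V) (hV : IntegrableOn (fun s => s * |V s|) (Ioi 0))
    (hz : z ∈ Complex.slitPlane) :
    HasPrimitive (freeWronskian V a μ z)
      (fun r => V r * (freeJost a z r * regularSol V μ (z ^ 2) r)) :=
  ((isSol_freeJost ha haμ hz).wronskian (isSol_regularSol hμ hVm hV (z ^ 2))).congr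
    (fun _ _ => rfl) fun r _ => by simp only [radialCoeff]; push_cast; ring

lemma integrableOn_pairing (ha : -1 < a) (hμ : 0 < μ) (hVm : Measurable V)
    (hV : IntegrableOn (fun s => s * |V s|) (Ioi 0)) {η : ℝ} (hη : 0 ≤ η)
    (hVη : IntegrableOn (fun r => |V r| * Real.exp (η * r)) (Ioi 1))
    (hz : z ∈ Complex.slitPlane) (hre : -(η / 2) ≤ z.re) :
    IntegrableOn (fun r => freeJost a z r * cutoffSource V μ z r) (Ioi 1) := by
  obtain ⟨C, -, h⟩ := exists_norm_pairing_le ha hμ hVm hV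
    (norm_pos_iff.2 (Complex.slitPlane_ne_zero hz)) ‖z‖
  refine Integrable.mono' (integrableOn_pairing_bound hVη C)
    (aestronglyMeasurable_pairing ha hμ hVm hV hz) ?_
  filter_upwards [ae_restrict_mem measurableSet_Ioi] with r hr using h η hη z le_rfl le_rfl hre r hr

/-- The integrand is the derivative of θW + θ'Eφ, with W the Wronskian of E and φ. At 1 both θ and
θ' vanish, and at 2 one has θ = 1 and θ' = 0. -/
lemma integral_pairing_cutoff (ha : -1 < a) (haμ : μ ^ 2 - 1 / 4 = a * (a + 1)) (hμ : 0 < μ)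
    (hVm : Measurable V) (hV : IntegrableOn (fun s => s * |V s|) (Ioi 0))
    (hz : z ∈ Complex.slitPlane) :
    ∫ r in (1 : ℝ)..2, freeJost a z r * cutoffSource V μ z r = freeWronskian V a μ z 2 := by
  have hE := isSol_freeJost ha haμ hz
  have hs := isSol_regularSol hμ hVm hV (z ^ 2)
  have hp : ∀ r : ℝ, 0 < r → HasDerivAt (fun r : ℝ => (((r - 1) ^ 2 * (5 - 2 * r) : ℝ) : ℂ))
      ((6 * (r - 1) * (2 - r) : ℝ) : ℂ) r := fun r _ => by
    refine HasDerivAt.ofReal_comp ((((((hasDerivAt_id r).sub_const 1).pow 2).mul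
      (((hasDerivAt_id r).const_mul 2).const_sub 5))).congr_deriv ?_)
    simp; ring
  have hq : ∀ r : ℝ, 0 < r → HasDerivAt (fun r : ℝ => ((6 * (r - 1) * (2 - r) : ℝ) : ℂ))
      ((18 - 12 * r : ℝ) : ℂ) r := fun r _ => by
    refine HasDerivAt.ofReal_comp ((((((hasDerivAt_id r).sub_const 1).const_mul 6).mul
      ((hasDerivAt_id r).const_sub 2))).congr_deriv ?_)
    simp; ring
  have hprod : ∀ r : ℝ, 0 < r → HasDerivAt
      (fun r : ℝ => freeJost a z r * regularSol V μ (z ^ 2) r)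
      (freeJostDeriv a z r * regularSol V μ (z ^ 2) r +
        freeJost a z r * regularSolDeriv V μ (z ^ 2) r) r := fun r hr =>
    (hE.hasDerivAt r hr).mul (hs.hasDerivAt r hr)
  have h1 := (hasPrimitive_freeWronskian ha haμ hμ hVm hV hz).mul hp (by fun_prop)
  have h2 := HasPrimitive.of_hasDerivAt (fun r hr => (hq r hr).mul (hprod r hr))
    ((ContinuousOn.mul (by fun_prop) (hE.continuousOn.mul hs.continuousOn)).add
      (ContinuousOn.mul (by fun_prop) ((hE.continuousOn'.mul hs.continuousOn).add
        (hE.continuousOn.mul hs.continuousOn'))))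
  have h3 := (h1.add h2).sub_eq one_pos two_pos
  norm_num at h3
  rw [h3]
  refine intervalIntegral.integral_congr fun r hr => ?_
  rw [uIcc_of_le one_le_two] at hr
  simp only [cutoffSource, cutoffCoeff₁, cutoffCoeff₂, if_pos hr.2, freeWronskian]
  push_cast; ring

/-- The limit at infinity of the Wronskian of the free Jost solution with the regular one. -/
lemma tendsto_freeWronskian (ha : -1 < a) (haμ : μ ^ 2 - 1 / 4 = a * (a + 1)) (hμ : 0 < μ)
    (hVm : Measurable V) (hV : IntegrableOn (fun s => s * |V s|) (Ioi 0))
    (hz : 0 ≤ z.re) (hz0 : z ≠ 0) :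
    Tendsto (freeWronskian V a μ z) atTop (𝓝 (jostPairing V a μ z)) := by
  have hzs := mem_slitPlane_of_re_nonneg hz hz0
  have hVη : IntegrableOn (fun r => |V r| * Real.exp (0 * r)) (Ioi 1) := by
    simpa [IntegrableOn] using (integrableOn_Ioi_one_potential hVm hV).abs
  have hint := integrableOn_pairing ha hμ hVm hV le_rfl hVη hzs (by simpa using hz)
  have h1 := integral_pairing_cutoff ha haμ hμ hVm hV hzs
  have h2 := intervalIntegral_tendsto_integral_Ioi 1 hint tendsto_id
  refine h2.congr' ?_
  filter_upwards [eventually_gt_atTop 2] with R hR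
  have hi : ∀ {c d : ℝ}, 1 ≤ c → c ≤ d → IntervalIntegrable
      (fun r => freeJost a z r * cutoffSource V μ z r) volume c d := fun hc hcd =>
    (intervalIntegrable_iff_integrableOn_Ioc_of_le hcd).2
      (hint.mono_set fun x hx => lt_of_le_of_lt hc hx.1)
  have h3 := (hasPrimitive_freeWronskian ha haμ hμ hVm hV hzs).sub_eq two_pos (two_pos.trans hR)
  -- Beyond 2 the cutoff is constant, and the source Vφ paired with E is the derivative of the
  -- Wronskian.
  have h4 : ∫ r in (2 : ℝ)..R, freeJost a z r * cutoffSource V μ z r =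
      ∫ r in (2 : ℝ)..R, V r * (freeJost a z r * regularSol V μ (z ^ 2) r) := by
    refine intervalIntegral.integral_congr_ae (ae_of_all _ fun r hr => ?_)
    rw [uIoc_of_le hR.le] at hr
    simp only [cutoffSource, cutoffCoeff₁, cutoffCoeff₂, if_neg (not_le.2 hr.1)]
    push_cast; ring
  rw [id, ← intervalIntegral.integral_add_adjacent_intervals (hi le_rfl one_le_two)
    (hi one_le_two hR.le), h1, h4, ← h3]
  ring

/-- The Wronskian of the Jost solution with the regular one, as a pairing of the explicit free
solution with the regular solution. -/
theorem wronskian_jost_regular (ha : -1 < a) (haμ : μ ^ 2 - 1 / 4 = a * (a + 1)) (hμ : 0 < μ)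
    (hVm : Measurable V) (hV : IntegrableOn (fun s => s * |V s|) (Ioi 0))
    (hz : 0 ≤ z.re) (hz0 : z ≠ 0) {u u' : ℝ → ℂ} (hu : IsSol (radialCoeff V μ (z ^ 2)) u u')
    (hul : Tendsto (fun r : ℝ => Complex.exp (z * r) * u r) atTop (𝓝 1))
    (hul' : Tendsto (fun r : ℝ => Complex.exp (z * r) * u' r) atTop (𝓝 (-z))) {r : ℝ}
    (hr : 0 < r) :
    Real.Gamma (a + 1) * (u r * regularSolDeriv V μ (z ^ 2) r -
      regularSol V μ (z ^ 2) r * u' r) = jostPairing V a μ z := by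
  have hs := isSol_regularSol hμ hVm hV (z ^ 2)
  obtain ⟨D, hD, hb⟩ := exists_norm_regularSol_le_exp hμ hVm hV (norm_pos_iff.2 hz0) ‖z‖
  -- An error of size o(e^{-Re z · r}) in the solution at infinity is harmless against growth e^{Re
  -- z · r} of the regular solution.
  have hbound : ∀ {f φ : ℝ → ℂ}, Tendsto (fun r : ℝ => Complex.exp (z * r) * f r) atTop (𝓝 0) →
      (∀ r, 1 ≤ r → ‖φ r‖ ≤ D * Real.exp (|z.re| * r)) →
      Tendsto (fun r => f r * φ r) atTop (𝓝 0) := by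
    intro f φ hf hφ
    have h1 := hf.norm.mul_const D
    rw [norm_zero, zero_mul] at h1
    refine squeeze_zero_norm' ?_ h1
    filter_upwards [eventually_ge_atTop 1] with s hs
    have h2 := hφ s hs
    rw [abs_of_nonneg hz] at h2
    rw [norm_mul, norm_mul, Complex.norm_exp]
    calc ‖f s‖ * ‖φ s‖ ≤ ‖f s‖ * (D * Real.exp (z.re * s)) := by gcongr
      _ = _ := by simp; ring
  have e1 : Tendsto (fun r : ℝ => Complex.exp (z * r) * (freeJost a z r - Real.Gamma (a + 1) * u r))
      atTop (𝓝 0) := by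
    have := (tendsto_freeJost ha hz0).sub (hul.const_mul (Real.Gamma (a + 1) : ℂ))
    rw [mul_one, sub_self] at this
    exact this.congr fun r => by ring
  have e2 : Tendsto (fun r : ℝ =>
      Complex.exp (z * r) * (freeJostDeriv a z r - Real.Gamma (a + 1) * u' r)) atTop (𝓝 0) := by
    have := (tendsto_freeJostDeriv ha haμ hz hz0).sub (hul'.const_mul (Real.Gamma (a + 1) : ℂ))
    rw [show -z * (Real.Gamma (a + 1) : ℂ) - Real.Gamma (a + 1) * -z = 0 by ring] at this
    exact this.congr fun r => by ring
  have h1 := hbound e1 fun r hr => (hb z le_rfl le_rfl r hr).2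
  have h2 := hbound e2 fun r hr => (hb z le_rfl le_rfl r hr).1
  have h3 := (tendsto_freeWronskian ha haμ hμ hVm hV hz hz0).sub (h1.sub h2)
  rw [sub_zero, sub_zero] at h3
  refine tendsto_nhds_unique (tendsto_const_nhds.congr' ?_) h3
  filter_upwards [eventually_gt_atTop 0] with s hs0
  rw [hu.wronskian_const hs hr hs0, freeWronskian]
  ring

/-- Boundary values of `jostPairing` on the cut. -/
lemma tendsto_jostPairing_boundary {σ : ℝ} (ha : -1 < a) (hμ : 0 < μ) (hVm : Measurable V)
    (hV : IntegrableOn (fun s => s * |V s|) (Ioi 0)) {η κ : ℝ} (hκ : 0 < κ) (hκη : κ < η / 2)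
    (hVη : IntegrableOn (fun r => |V r| * Real.exp (η * r)) (Ioi 1)) {s t : Set ℂ}
    [(𝓝[s] (-(κ : ℂ))).NeBot] (hs : ∀ z ∈ s, z.im ≠ 0) (hst : ∀ z ∈ s, ∀ r : ℝ, 0 < r → (2 * z * r)⁻¹ ∈ t)
    (ht : ∀ b : ℝ, 0 < b →
      Tendsto (hankelAmp a) (𝓝[t] (-(b : ℂ))) (𝓝 (hankelAmpBoundary σ a b))) :
    IntegrableOn (fun r : ℝ => Complex.exp (κ * r) * hankelAmpBoundary σ a (2 * κ * r)⁻¹ *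
        cutoffSource V μ κ r) (Ioi 1) ∧
      Tendsto (jostPairing V a μ) (𝓝[s] (-(κ : ℂ)))
        (𝓝 (∫ r in Ioi (1 : ℝ), Complex.exp (κ * r) * hankelAmpBoundary σ a (2 * κ * r)⁻¹ *
          cutoffSource V μ κ r)) := by
  have hκ0 : (κ : ℂ) ≠ 0 := by exact_mod_cast hκ.ne'
  -- The source depends on z only through z², so at -κ it coincides with the source at κ.
  have hsource : ∀ r, cutoffSource V μ (κ : ℂ) r = cutoffSource V μ (-(κ : ℂ)) r := fun r => by
    simp only [cutoffSource, neg_sq]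
  simp only [hsource]
  have hs' : ∀ᶠ z in 𝓝[s] (-(κ : ℂ)), z ∈ Complex.slitPlane ∧ -(η / 2) ≤ z.re := by
    have : {z : ℂ | -(η / 2) < z.re} ∈ 𝓝 (-(κ : ℂ)) :=
      (isOpen_lt continuous_const Complex.continuous_re).mem_nhds (by simpa using hκη)
    filter_upwards [mem_nhdsWithin_of_mem_nhds this, self_mem_nhdsWithin] with z h1 h2
    exact ⟨Complex.mem_slitPlane_iff.2 (Or.inr (hs z h2)), le_of_lt h1⟩
  have he : ∀ r : ℝ, 1 < r → Tendsto (fun z => freeJost a z r) (𝓝[s] (-(κ : ℂ)))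
      (𝓝 (Complex.exp (κ * r) * hankelAmpBoundary σ a (2 * κ * r)⁻¹)) := fun r hr => by
    have hr0 : 0 < r := one_pos.trans hr
    have hrc : (r : ℂ) ≠ 0 := by exact_mod_cast hr0.ne'
    refine Tendsto.mul ?_ ((ht (2 * κ * r)⁻¹ (by positivity)).comp (tendsto_nhdsWithin_iff.2
      ⟨?_, ?_⟩))
    · have : Continuous fun z : ℂ => Complex.exp (-(z * r)) := by fun_prop
      exact (this.tendsto' _ _ (by congr 1; ring)).mono_left nhdsWithin_le_nhds
    · have : ContinuousAt (fun z : ℂ => (2 * z * r)⁻¹) (-(κ : ℂ)) :=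
        ContinuousAt.inv₀ (by fun_prop) (by simp [hκ0, hrc])
      have h2 := this.tendsto
      rw [show (2 * -(κ : ℂ) * r)⁻¹ = -(((2 * κ * r)⁻¹ : ℝ) : ℂ) by
        push_cast; rw [← inv_neg]; congr 1; ring] at h2
      exact h2.mono_left nhdsWithin_le_nhds
    · filter_upwards [self_mem_nhdsWithin] with z hz using hst z hz r hr0
  exact ⟨integrableOn_pairing_limit ha hμ hVm hV (by linarith) hVη (neg_ne_zero.2 hκ0) hs' he,
    tendsto_jostPairing ha hμ hVm hV (by linarith) hVη (neg_ne_zero.2 hκ0) hs' he⟩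

lemma inv_two_mul_im (z : ℂ) (r : ℝ) :
    ((2 * z * r)⁻¹).im = -(2 * r * z.im) / Complex.normSq (2 * z * r) := by
  rw [Complex.inv_im]; congr 1; simp; ring

/-- `jostPairing` has boundary values on the two sides of the cut, and their difference is a
multiple of its value at the reflected point. -/
theorem exists_tendsto_jostPairing (ha : -1 < a) (hμ : 0 < μ) (hVm : Measurable V)
    (hV : IntegrableOn (fun s => s * |V s|) (Ioi 0)) {η κ : ℝ} (hκ : 0 < κ) (hκη : κ < η / 2)
    (hVη : IntegrableOn (fun r => |V r| * Real.exp (η * r)) (Ioi 1)) :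
    ∃ l₁ l₂ : ℂ,
      Tendsto (jostPairing V a μ) (𝓝[{z | 0 < z.im}] (-(κ : ℂ))) (𝓝 l₁) ∧
      Tendsto (jostPairing V a μ) (𝓝[{z | z.im < 0}] (-(κ : ℂ))) (𝓝 l₂) ∧
      l₁ - l₂ = (Complex.exp (Real.pi * (a + 1) * Complex.I) -
        Complex.exp (-(Real.pi * (a + 1) * Complex.I))) * jostPairing V a μ κ := by
  have hnorm : ∀ z : ℂ, z.im ≠ 0 → ∀ r : ℝ, 0 < r → 0 < Complex.normSq (2 * z * r) :=
    fun z hz r hr => Complex.normSq_pos.2 (by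
      have : z ≠ 0 := fun h => hz (by simp [h])
      simp [this, hr.ne'])
  -- The map z ↦ 1/(2zr) exchanges the half planes: z above the cut sends the amplitude's argument
  -- below its own cut.
  have hup : ∀ b : ℝ, 0 < b → Tendsto (hankelAmp a) (𝓝[{w | w.im < 0}] (-(b : ℂ)))
      (𝓝 (hankelAmpBoundary (-1) a b)) := fun b hb =>
    tendsto_hankelAmp_boundary ha hb
      (fun t ht w hw => by
        have hw : w.im < 0 := hw
        change (1 + (t : ℂ) * w).im < 0
        simp; nlinarith)
      fun d x hx => tendsto_cpow_boundaryPow_lower hx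
  have hlow : ∀ b : ℝ, 0 < b → Tendsto (hankelAmp a) (𝓝[{w | 0 < w.im}] (-(b : ℂ)))
      (𝓝 (hankelAmpBoundary 1 a b)) := fun b hb =>
    tendsto_hankelAmp_boundary ha hb
      (fun t ht w hw => by
        have hw : 0 < w.im := hw
        change 0 < (1 + (t : ℂ) * w).im
        simp; positivity)
      fun d x hx => tendsto_cpow_boundaryPow_upper hx
  have : (𝓝[{z : ℂ | 0 < z.im}] (-(κ : ℂ))).NeBot := mem_closure_iff_nhdsWithin_neBot.1 (by
    rw [Complex.closure_setOfPred_lt_im]; simp)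
  have : (𝓝[{z : ℂ | z.im < 0}] (-(κ : ℂ))).NeBot := mem_closure_iff_nhdsWithin_neBot.1 (by
    rw [Complex.closure_setOfPred_im_lt]; simp)
  obtain ⟨i1, l1⟩ := tendsto_jostPairing_boundary (s := {z : ℂ | 0 < z.im}) ha hμ hVm hV hκ
    hκη hVη
    (fun z (hz : 0 < z.im) => hz.ne')
    (fun z (hz : 0 < z.im) r hr => by
      change ((2 * z * r)⁻¹).im < 0
      rw [inv_two_mul_im]
      exact div_neg_of_neg_of_pos (by simp; positivity) (hnorm z hz.ne' r hr)) hup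
  obtain ⟨i2, l2⟩ := tendsto_jostPairing_boundary (s := {z : ℂ | z.im < 0}) ha hμ hVm hV hκ
    hκη hVη
    (fun z (hz : z.im < 0) => hz.ne)
    (fun z (hz : z.im < 0) r hr => by
      change 0 < ((2 * z * r)⁻¹).im
      rw [inv_two_mul_im]
      exact div_pos (by nlinarith) (hnorm z hz.ne r hr)) hlow
  refine ⟨_, _, l1, l2, ?_⟩
  rw [← integral_sub i1 i2, jostPairing, ← integral_const_mul]
  refine setIntegral_congr_fun measurableSet_Ioi fun r hr => ?_
  have hr : (0 : ℝ) < r := one_pos.trans hr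
  have hj := hankelAmpBoundary_sub ha (b := (2 * κ * r)⁻¹) (by positivity)
  -- With 1/b = 2κr the jump factor turns the growing e^{κr} into e^{-κr}, which is the free
  -- solution at κ.
  have he : Complex.exp (κ * r) * (Real.exp (-(1 / (2 * κ * r)⁻¹)) : ℝ) =
      Complex.exp (-(κ * r)) := by
    rw [one_div, inv_inv, Complex.ofReal_exp, ← Complex.exp_add]
    congr 1; push_cast; ring
  have e3 : (((2 * κ * r)⁻¹ : ℝ) : ℂ) = (2 * (κ : ℂ) * (r : ℂ))⁻¹ := by push_cast; rfl
  rw [e3] at hj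
  simp only [freeJost]
  rw [← he]
  linear_combination Complex.exp (κ * r) * cutoffSource V μ κ r * hj

end

/-! ### Normalizations and the Jost function in the variable k -/

section

variable {V : ℝ → ℝ} {μ : ℝ} {k : ℂ}

/-- The factor between the normalization of the regular solution and that of `regularSol`. -/
def regularNorm (μ : ℝ) (k : ℂ) : ℂ :=
  ((Real.Gamma (μ + 1) / √Real.pi : ℝ) : ℂ)⁻¹ * (k / 2) ^ ((μ : ℂ) + 1 / 2)

/-- The phase in the normalization of the Jost solution. -/
def jostPhase (μ : ℝ) : ℂ :=
  Complex.exp (Complex.I * (-((Real.pi : ℂ) / 2 * μ) + (Real.pi : ℂ) / 4))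

lemma gamma_div_sqrt_pi_ne_zero (hμ : 0 < μ) :
    ((Real.Gamma (μ + 1) / √Real.pi : ℝ) : ℂ) ≠ 0 := by
  have := Real.Gamma_pos_of_pos (by linarith : 0 < μ + 1)
  have := Real.pi_pos
  exact_mod_cast (by positivity : 0 < Real.Gamma (μ + 1) / √Real.pi).ne'

lemma regularNorm_ne_zero (hμ : 0 < μ) (hk : k ≠ 0) : regularNorm μ k ≠ 0 :=
  mul_ne_zero (inv_ne_zero (gamma_div_sqrt_pi_ne_zero hμ)) (by
    rw [Ne, Complex.cpow_eq_zero_iff]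
    exact fun h => hk (by simpa using h.1))

lemma isRadialSolution_iff_radialCoeff {ψ : ℝ → ℂ} :
    IsRadialSolution V μ k ψ ↔ IsSol (radialCoeff V μ ((-Complex.I * k) ^ 2)) ψ (deriv ψ) := by
  have e : (fun r : ℝ => (((μ ^ 2 - 1 / 4) / r ^ 2 + V r : ℝ) - k ^ 2 : ℂ)) =
      radialCoeff V μ ((-Complex.I * k) ^ 2) := by
    ext r
    rw [radialCoeff, mul_pow, neg_sq, Complex.I_sq]; ring
  rw [isRadialSolution_iff, e]

lemma regular_normalization_eq (hk : k ≠ 0) {r : ℝ} (hr : 0 < r) (x : ℂ) :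
    ((k * (r : ℂ) / 2) ^ ((μ : ℂ) + 1 / 2))⁻¹ *
        ((Real.Gamma (μ + 1) / √Real.pi : ℝ) : ℂ) * x =
      (regularNorm μ k)⁻¹ * x / (r ^ (1 / 2 + μ) : ℝ) := by
  have hk2 : k / 2 ≠ 0 := by simpa using hk
  have hr0 : (r : ℂ) ≠ 0 := by exact_mod_cast hr.ne'
  have h1 : (k * (r : ℂ) / 2) ^ ((μ : ℂ) + 1 / 2) =
      ((r ^ (1 / 2 + μ) : ℝ) : ℂ) * (k / 2) ^ ((μ : ℂ) + 1 / 2) := by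
    rw [show k * (r : ℂ) / 2 = r * (k / 2) by ring, Complex.cpow_def_of_ne_zero (mul_ne_zero hr0 hk2),
      Complex.cpow_def_of_ne_zero hk2, Complex.log_ofReal_mul hr hk2, Real.rpow_def_of_pos hr,
      Complex.ofReal_exp, ← Complex.exp_add]
    congr 1; push_cast; ring
  rw [h1, regularNorm, mul_inv, mul_inv, inv_inv]
  ring

lemma isRegularSolution_regularSol (hμ : 0 < μ) (hVm : Measurable V)
    (hV : IntegrableOn (fun s => s * |V s|) (Ioi 0)) (hk : k ≠ 0) :
    IsRegularSolution V μ k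
      (fun r => regularNorm μ k * regularSol V μ ((-Complex.I * k) ^ 2) r) := by
  have hN := regularNorm_ne_zero hμ hk
  refine ⟨isRadialSolution_iff_radialCoeff.2
    ((isSol_regularSol hμ hVm hV _).const_mul _).deriv_right,
    (tendsto_regularFactor hμ hVm hV ((-Complex.I * k) ^ 2)).congr' ?_⟩
  filter_upwards [self_mem_nhdsWithin] with r hr
  have hr : 0 < r := hr
  have hp : ((r ^ (1 / 2 + μ) : ℝ) : ℂ) ≠ 0 := by
    exact_mod_cast (Real.rpow_pos_of_pos hr _).ne'
  rw [regular_normalization_eq hk hr, regularSol_eq hμ hVm hV _ hr, inv_mul_cancel_left₀ hN,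
    mul_div_cancel_left₀ _ hp]

lemma IsRegularSolution.eqOn (hμ : 0 < μ) (hVm : Measurable V)
    (hV : IntegrableOn (fun s => s * |V s|) (Ioi 0)) (hk : k ≠ 0) {φ : ℝ → ℂ}
    (h : IsRegularSolution V μ k φ) :
    EqOn φ (fun r => regularNorm μ k * regularSol V μ ((-Complex.I * k) ^ 2) r) (Ioi 0) := by
  have hN := regularNorm_ne_zero hμ hk
  have hlim : ∀ {ψ : ℝ → ℂ}, IsRegularSolution V μ k ψ → Tendsto
      (fun r : ℝ => (regularNorm μ k)⁻¹ * ψ r / (r ^ (1 / 2 + μ) : ℝ)) (𝓝[>] 0) (𝓝 1) :=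
    fun hψ => hψ.2.congr' (by
      filter_upwards [self_mem_nhdsWithin] with r hr using regular_normalization_eq hk hr _)
  have h' := isRegularSolution_regularSol hμ hVm hV hk
  intro r hr
  exact mul_left_cancel₀ (inv_ne_zero hN) (regularSol_unique hμ hVm hV
    ((isRadialSolution_iff_radialCoeff.1 h.1).const_mul (regularNorm μ k)⁻¹)
    ((isRadialSolution_iff_radialCoeff.1 h'.1).const_mul (regularNorm μ k)⁻¹)
    (hlim h) (hlim h') hr)

lemma jost_normalization_eq (r : ℝ) (x : ℂ) :
    Complex.exp (-Complex.I * (k * (r : ℂ) - (Real.pi : ℂ) / 2 * (μ : ℂ) + (Real.pi : ℂ) / 4)) * x =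
      Complex.exp (-Complex.I * k * r) * ((jostPhase μ)⁻¹ * x) := by
  rw [jostPhase, ← Complex.exp_neg, ← mul_assoc, ← Complex.exp_add]
  congr 2; ring

lemma isJostSolution_iff {χ : ℝ → ℂ} : IsJostSolution V μ k χ ↔
    IsSol (radialCoeff V μ ((-Complex.I * k) ^ 2)) χ (deriv χ) ∧
      Tendsto (fun r : ℝ => Complex.exp (-Complex.I * k * r) * ((jostPhase μ)⁻¹ * χ r)) atTop
        (𝓝 1) := by
  simp only [IsJostSolution, isRadialSolution_iff_radialCoeff, jost_normalization_eq]

/-- The Jost function, in terms of `jostPairing`. -/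
def jostFun (V : ℝ → ℝ) (μ : ℝ) (k : ℂ) : ℂ :=
  k⁻¹ * (jostPhase μ * ((Real.Gamma (μ + 1) / √Real.pi : ℝ) : ℂ)⁻¹ *
    Complex.exp (((Real.log (1 / 2) : ℝ) + Real.pi / 2 * Complex.I) * ((μ : ℂ) + 1 / 2)) *
    (Real.Gamma (μ + 1 / 2) : ℂ)⁻¹ *
    ((-Complex.I * k) ^ ((μ : ℂ) + 1 / 2) * jostPairing V (μ - 1 / 2) μ (-Complex.I * k)))

lemma neg_I_mul_re (k : ℂ) : (-Complex.I * k).re = k.im := by simp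

lemma neg_I_mul_im (k : ℂ) : (-Complex.I * k).im = -k.re := by simp

/-- With k = iz and |arg z| ≤ π/2 no argument wraps around, so the power factors. The principal
power of z on the right is cut along z < 0, that is along the negative imaginary k axis, and thus
provides the continuation. -/
lemma half_cpow_eq (hk : 0 ≤ k.im) (hk0 : k ≠ 0) : (k / 2) ^ ((μ : ℂ) + 1 / 2) =
    Complex.exp (((Real.log (1 / 2) : ℝ) + Real.pi / 2 * Complex.I) * ((μ : ℂ) + 1 / 2)) *
      (-Complex.I * k) ^ ((μ : ℂ) + 1 / 2) := by
  set z := -Complex.I * k with hz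
  have hz0 : z ≠ 0 := by simp [hz, hk0]
  have hkz : k = Complex.I * z := by rw [hz, ← mul_assoc]; simp
  have harg : |z.arg| ≤ Real.pi / 2 := by
    rw [Complex.abs_arg_le_pi_div_two_iff, hz, neg_I_mul_re]; exact hk
  have h1 : Complex.log (Complex.I * z) = Complex.log Complex.I + Complex.log z := by
    rw [Complex.log_mul_eq_add_log_iff Complex.I_ne_zero hz0, Complex.arg_I]
    have := abs_le.1 harg
    have := Real.pi_pos
    constructor <;> linarith
  rw [show k / 2 = ((1 / 2 : ℝ) : ℂ) * k by push_cast; ring, hkz,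
    Complex.cpow_def_of_ne_zero (by simp [hz0]), Complex.cpow_def_of_ne_zero hz0,
    Complex.log_ofReal_mul (by norm_num) (by simp [hz0]), h1, Complex.log_I, ← Complex.exp_add]
  congr 1; ring

theorem isJostFunction_jostFun (hμ : 0 < μ) (hVm : Measurable V)
    (hV : IntegrableOn (fun s => s * |V s|) (Ioi 0)) : IsJostFunction V μ (jostFun V μ) := by
  rintro k ⟨hk, hk0⟩
  have hz : 0 ≤ (-Complex.I * k).re := by rwa [neg_I_mul_re]
  have hz0 : -Complex.I * k ≠ 0 := by simp [hk0]
  have hc : jostPhase μ ≠ 0 := Complex.exp_ne_zero _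
  obtain ⟨u, u', hu, hul, hul'⟩ := exists_jostSol (μ := μ) hVm hV hz hz0
  have hjost : ∀ χ, IsJostSolution V μ k χ → EqOn χ (fun r => jostPhase μ * u r) (Ioi 0) := by
    intro χ hχ r hr
    rw [isJostSolution_iff] at hχ
    have := jostSol_unique hVm hV hz (hχ.1.const_mul (jostPhase μ)⁻¹) hu hχ.2 hul hr
    simp only at this ⊢
    rw [← this, mul_inv_cancel_left₀ hc]
  refine ⟨⟨_, isRegularSolution_regularSol hμ hVm hV hk0, fun φ hφ => hφ.eqOn hμ hVm hV hk0⟩,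
    ⟨_, isJostSolution_iff.2 ⟨(hu.const_mul (jostPhase μ)).deriv_right, ?_⟩, hjost⟩, ?_⟩
  · simpa only [inv_mul_cancel_left₀ hc] using hul
  intro φ χ hφ hχ r hr
  have e1 := hφ.eqOn hμ hVm hV hk0
  have e2 := hjost χ hχ
  have d1 : deriv φ r = regularNorm μ k * regularSolDeriv V μ ((-Complex.I * k) ^ 2) r :=
    ((((isSol_regularSol hμ hVm hV _).hasDerivAt r hr).const_mul _).congr_of_eventuallyEq
      (e1.eventuallyEq_of_mem (Ioi_mem_nhds hr))).deriv
  have d2 : deriv χ r = jostPhase μ * u' r :=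
    (((hu.hasDerivAt r hr).const_mul _).congr_of_eventuallyEq
      (e2.eventuallyEq_of_mem (Ioi_mem_nhds hr))).deriv
  have hW := wronskian_jost_regular (a := μ - 1 / 2) (by linarith) (by ring) hμ hVm hV hz hz0 hu
    hul hul' hr
  rw [show μ - 1 / 2 + 1 = μ + 1 / 2 by ring] at hW
  have hG : (Real.Gamma (μ + 1 / 2) : ℂ) ≠ 0 := by
    exact_mod_cast (Real.Gamma_pos_of_pos (by linarith)).ne'
  rw [wronskianAt, d1, d2, e1 hr, e2 hr, jostFun, ← hW, regularNorm, half_cpow_eq hk hk0]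
  linear_combination k⁻¹ * jostPhase μ * ((Real.Gamma (μ + 1) / √Real.pi : ℝ) : ℂ)⁻¹ *
    Complex.exp (((Real.log (1 / 2) : ℝ) + Real.pi / 2 * Complex.I) * ((μ : ℂ) + 1 / 2)) *
    (-Complex.I * k) ^ ((μ : ℂ) + 1 / 2) *
    (u r * regularSolDeriv V μ ((-Complex.I * k) ^ 2) r -
      regularSol V μ ((-Complex.I * k) ^ 2) r * u' r) * inv_mul_cancel₀ hG

lemma isOpen_cutHalfPlane (η : ℝ) : IsOpen (cutHalfPlane η) :=
  (isOpen_lt continuous_const Complex.continuous_im).sdiff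
    ((isClosed_eq Complex.continuous_re continuous_const).inter
      (isClosed_le Complex.continuous_im continuous_const))

lemma neg_I_mul_mem_slitPlane (h : 0 < k.im ∨ k.re ≠ 0) : -Complex.I * k ∈ Complex.slitPlane := by
  rw [Complex.mem_slitPlane_iff, neg_I_mul_re, neg_I_mul_im, neg_ne_zero]; exact h

lemma differentiableOn_jostFun (hμ : 0 < μ) (hVm : Measurable V)
    (hV : IntegrableOn (fun s => s * |V s|) (Ioi 0)) {η : ℝ} (hη : 0 ≤ η)
    (hVη : IntegrableOn (fun r => |V r| * Real.exp (η * r)) (Ioi 1)) :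
    DifferentiableOn ℂ (jostFun V μ) (cutHalfPlane η) := by
  have hmem : ∀ k ∈ cutHalfPlane η, -Complex.I * k ∈
      Complex.slitPlane ∩ {z | -(η / 2) < z.re} := by
    rintro k ⟨h1, h2⟩
    refine ⟨neg_I_mul_mem_slitPlane ?_, ?_⟩
    · by_contra! h
      exact h2 ⟨h.2, h.1⟩
    · change -(η / 2) < (-Complex.I * k).re
      rwa [neg_I_mul_re]
  have hk0 : ∀ k ∈ cutHalfPlane η, k ≠ 0 := fun k hk h =>
    Complex.slitPlane_ne_zero (hmem k hk).1 (by simp [h])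
  have hlin : Differentiable ℂ fun k : ℂ => -Complex.I * k := by fun_prop
  refine DifferentiableOn.mul (differentiableOn_inv.mono hk0) (DifferentiableOn.const_mul ?_ _)
  refine DifferentiableOn.mul (fun k hk => ?_) ((differentiableOn_jostPairing (by linarith) hμ hVm
    hV hη hVη).comp hlin.differentiableOn hmem)
  exact ((hlin k).cpow_const (hmem k hk).1).differentiableWithinAt

/-- With exponential rate 0 the pairing is still dominated on Re z ≥ 0, which includes real k; the
origin alone is excluded. -/
lemma continuousOn_jostFun (hμ : 0 < μ) (hVm : Measurable V)
    (hV : IntegrableOn (fun s => s * |V s|) (Ioi 0)) :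
    ContinuousOn (jostFun V μ) closedUpperPunctured := by
  have hVη : IntegrableOn (fun r => |V r| * Real.exp (0 * r)) (Ioi 1) := by
    simpa [IntegrableOn] using (integrableOn_Ioi_one_potential hVm hV).abs
  have hmem : ∀ k ∈ closedUpperPunctured, -Complex.I * k ∈
      Complex.slitPlane ∩ {z | -((0 : ℝ) / 2) ≤ z.re} := by
    rintro k ⟨h1, h2⟩
    have h : 0 ≤ (-Complex.I * k).re := by rwa [neg_I_mul_re]
    exact ⟨mem_slitPlane_of_re_nonneg h (by simp [h2]), by simpa using h1⟩
  have hlin : Continuous fun k : ℂ => -Complex.I * k := by fun_prop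
  refine ContinuousOn.mul (continuousOn_inv₀.mono fun k hk => hk.2) (ContinuousOn.const_mul ?_ _)
  refine ContinuousOn.mul (fun k hk => ?_) ((continuousOn_jostPairing (by linarith) hμ hVm
    hV le_rfl hVη).comp hlin.continuousOn hmem)
  exact ((continuousAt_cpow_const (hmem k hk).1).comp
    (f := fun k : ℂ => -Complex.I * k) hlin.continuousAt).continuousWithinAt

lemma tendsto_jostFun_of_tendsto {κ θ : ℝ} (hκ : 0 < κ) {s t : Set ℂ} {l : ℂ}
    (hst : ∀ k ∈ s, -Complex.I * k ∈ t)
    (hpow : Tendsto (fun y : ℂ => y ^ (((μ + 1 / 2 : ℝ)) : ℂ)) (𝓝[t] ((-κ : ℝ) : ℂ))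
      (𝓝 (boundaryPow θ (μ + 1 / 2) (-κ))))
    (hl : Tendsto (jostPairing V (μ - 1 / 2) μ) (𝓝[t] (-(κ : ℂ))) (𝓝 l)) :
    Tendsto (jostFun V μ) (𝓝[s] (-(Complex.I * κ))) (𝓝 ((-(Complex.I * κ))⁻¹ *
      (jostPhase μ * ((Real.Gamma (μ + 1) / √Real.pi : ℝ) : ℂ)⁻¹ *
      Complex.exp (((Real.log (1 / 2) : ℝ) + Real.pi / 2 * Complex.I) * ((μ : ℂ) + 1 / 2)) *
      (Real.Gamma (μ + 1 / 2) : ℂ)⁻¹ * (((κ ^ (μ + 1 / 2) : ℝ) : ℂ) *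
        Complex.exp (θ * Real.pi * ((μ : ℂ) + 1 / 2) * Complex.I) * l)))) := by
  have hκ0 : (κ : ℂ) ≠ 0 := by exact_mod_cast hκ.ne'
  have hlin : Continuous fun k : ℂ => -Complex.I * k := by fun_prop
  have hmap : Tendsto (fun k : ℂ => -Complex.I * k) (𝓝[s] (-(Complex.I * κ))) (𝓝[t] (-(κ : ℂ))) := by
    refine tendsto_nhdsWithin_iff.2 ⟨(hlin.tendsto' _ _ ?_).mono_left nhdsWithin_le_nhds, ?_⟩
    · rw [neg_mul_neg, ← mul_assoc, Complex.I_mul_I, neg_one_mul]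
    · filter_upwards [self_mem_nhdsWithin] with k hk using hst k hk
  rw [boundaryPow, if_neg (by linarith), abs_neg, abs_of_pos hκ] at hpow
  push_cast at hpow
  have hinv : Tendsto (fun k : ℂ => k⁻¹) (𝓝[s] (-(Complex.I * κ))) (𝓝 (-(Complex.I * κ))⁻¹) :=
    (continuousAt_inv₀ (by simp [hκ0])).tendsto.mono_left nhdsWithin_le_nhds
  have h := hinv.mul (((hpow.comp hmap).mul (hl.comp hmap)).const_mul
    (jostPhase μ * ((Real.Gamma (μ + 1) / √Real.pi : ℝ) : ℂ)⁻¹ *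
      Complex.exp (((Real.log (1 / 2) : ℝ) + Real.pi / 2 * Complex.I) * ((μ : ℂ) + 1 / 2)) *
      (Real.Gamma (μ + 1 / 2) : ℂ)⁻¹))
  exact h

theorem exists_tendsto_jostFun (hμ : 0 < μ) (hVm : Measurable V)
    (hV : IntegrableOn (fun s => s * |V s|) (Ioi 0)) {η κ : ℝ} (hκ : 0 < κ) (hκη : κ < η / 2)
    (hVη : IntegrableOn (fun r => |V r| * Real.exp (η * r)) (Ioi 1)) :
    ∃ Fleft Fright : ℂ,
      Tendsto (jostFun V μ) (𝓝[{z : ℂ | z.re < 0}] (-(Complex.I * (κ : ℂ)))) (𝓝 Fleft) ∧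
      Tendsto (jostFun V μ) (𝓝[{z : ℂ | 0 < z.re}] (-(Complex.I * (κ : ℂ)))) (𝓝 Fright) ∧
      Fleft = -Complex.exp (2 * Complex.I * (Real.pi : ℂ) * (μ : ℂ)) * Fright +
        2 * (Real.cos (Real.pi * μ) : ℂ) *
          Complex.exp (Complex.I * (Real.pi : ℂ) * (μ : ℂ)) *
            jostFun V μ (Complex.I * (κ : ℂ)) := by
  obtain ⟨l₁, l₂, h₁, h₂, h⟩ := exists_tendsto_jostPairing (a := μ - 1 / 2) (by linarith) hμ hVm hV
    hκ hκη hVη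
  refine ⟨_, _, tendsto_jostFun_of_tendsto (θ := 1) hκ (fun k (hk : k.re < 0) => ?_)
    (tendsto_cpow_boundaryPow_upper (by linarith)) h₁,
    tendsto_jostFun_of_tendsto (θ := -1) hκ (fun k (hk : 0 < k.re) => ?_)
    (tendsto_cpow_boundaryPow_lower (by linarith)) h₂, ?_⟩
  · change 0 < (-Complex.I * k).im
    rw [neg_I_mul_im]; linarith
  · change (-Complex.I * k).im < 0
    rw [neg_I_mul_im]; linarith
  have hκ0 : (κ : ℂ) ≠ 0 := by exact_mod_cast hκ.ne'
  have hI : -Complex.I * (Complex.I * κ) = κ := by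
    rw [neg_mul, ← mul_assoc, Complex.I_mul_I]; ring
  have hpow : (κ : ℂ) ^ ((μ : ℂ) + 1 / 2) = ((κ ^ (μ + 1 / 2) : ℝ) : ℂ) := by
    rw [Complex.ofReal_cpow hκ.le]; push_cast; rfl
  rw [jostFun, hI, hpow]
  -- In terms of x = e^{iπμ} and y = 1/x, the powers at -κ carry the phases ix on the left and -iy
  -- on the right; the pairing jumps by i(x + y) times its value at κ, and 2cos(πμ) = x + y.
  set x := Complex.exp (Complex.I * Real.pi * μ) with hx
  set y := Complex.exp (-(Complex.I * Real.pi * μ)) with hy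
  have hxy : x * y = 1 := by rw [hx, hy, ← Complex.exp_add, add_neg_cancel, Complex.exp_zero]
  have hi1 : Complex.exp (Real.pi / 2 * Complex.I) = Complex.I := Complex.exp_pi_div_two_mul_I
  have hi2 : Complex.exp (-(Real.pi / 2 * Complex.I)) = -Complex.I := by
    rw [Complex.exp_neg, hi1, Complex.inv_I]
  have E1 : Complex.exp (((1 : ℝ) : ℂ) * Real.pi * ((μ : ℂ) + 1 / 2) * Complex.I) =
      x * Complex.I := by
    rw [show x * Complex.I = x * Complex.exp (Real.pi / 2 * Complex.I) by rw [hi1], hx,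
      ← Complex.exp_add]
    congr 1; push_cast; ring
  have E2 : Complex.exp (((-1 : ℝ) : ℂ) * Real.pi * ((μ : ℂ) + 1 / 2) * Complex.I) =
      -(y * Complex.I) := by
    rw [← mul_neg, ← hi2, hy, ← Complex.exp_add]
    congr 1; push_cast; ring
  have E3 : Complex.exp (2 * Complex.I * Real.pi * μ) = x ^ 2 := by
    rw [hx, ← Complex.exp_nat_mul]; congr 1; push_cast; ring
  have E4 : 2 * (Real.cos (Real.pi * μ) : ℂ) = x + y := by
    rw [Complex.ofReal_cos, Complex.two_cos, hx, hy]
    congr 2 <;> · push_cast; ring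
  have E5 : Complex.exp (Real.pi * ((μ - 1 / 2 : ℝ) + 1) * Complex.I) = x * Complex.I := by
    rw [← E1]; congr 1; push_cast; ring
  have E6 : Complex.exp (-(Real.pi * ((μ - 1 / 2 : ℝ) + 1) * Complex.I)) = -(y * Complex.I) := by
    rw [← E2]; congr 1; push_cast; ring
  rw [E5, E6] at h
  rw [E1, E2, E3, E4, inv_neg]
  generalize jostPhase μ * _ * _ * _ = c
  generalize ((κ ^ (μ + 1 / 2) : ℝ) : ℂ) = P
  generalize jostPairing V (μ - 1 / 2) μ κ = Φ at h ⊢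
  generalize (Complex.I * (κ : ℂ))⁻¹ = q
  -- The boundary value l₁ is eliminated through the jump relation, and xy = 1 turns the phase ratio
  -- of the two sides into x² = e^{2πiμ}.
  linear_combination -(q * c * P * x * Complex.I) * h + q * c * P * x * Complex.I * l₂ * hxy -
    q * c * P * x * (x + y) * Φ * Complex.I_mul_I

end

/-! ### Almost everywhere defined potentials and conclusion -/

/-- The potential enters the definition of a solution only through integrals over compact
subintervals of the half line, so it may be replaced by a measurable representative. -/
lemma isRadialSolution_congr_ae {V W : ℝ → ℝ} (h : V =ᵐ[volume.restrict (Ioi 0)] W) :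
    IsRadialSolution V = IsRadialSolution W := by
  funext μ k ψ
  have key : ∀ a b : ℝ, 0 < a → a ≤ b →
      (fun r : ℝ => (((μ ^ 2 - 1 / 4) / r ^ 2 + V r : ℝ) - k ^ 2 : ℂ) * ψ r)
        =ᵐ[volume.restrict (uIoc a b)]
      fun r : ℝ => (((μ ^ 2 - 1 / 4) / r ^ 2 + W r : ℝ) - k ^ 2 : ℂ) * ψ r := fun a b ha hab => by
    have hsub : uIoc a b ⊆ Ioi 0 := uIoc_subset_uIcc.trans
      (uIcc_subset_Ioi_zero ha (ha.trans_le hab))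
    filter_upwards [ae_restrict_of_ae_restrict_of_subset hsub h] with r hr
    rw [hr]
  refine propext (and_congr_right' (forall₄_congr fun a b ha hab => ?_))
  rw [intervalIntegrable_congr_ae (key a b ha hab),
    intervalIntegral.integral_congr_ae_restrict (key a b ha hab)]

lemma integrableOn_congr_potential {V W : ℝ → ℝ} (h : V =ᵐ[volume.restrict (Ioi 0)] W)
    {f : ℝ → ℝ → ℝ} (hf : IntegrableOn (fun r => f r (V r)) (Ioi 0)) :
    IntegrableOn (fun r => f r (W r)) (Ioi 0) :=
  hf.congr (h.mono fun r hr => by simp only [hr])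

end

theorem mainTheorem3 (V : ℝ → ℝ) (μ : ℝ) (hμ : 0 < μ)
    (hVmeas : AEMeasurable V (volume.restrict (Ioi 0)))
    (hV : IntegrableOn (fun r : ℝ => r * (1 + r) * |V r|) (Ioi 0) volume) :
    ∃ F : ℂ → ℂ, IsJostFunction V μ F ∧
      AnalyticOnNhd ℂ F {k : ℂ | 0 < k.im} ∧
      ContinuousOn F closedUpperPunctured ∧
      ∀ η : ℝ, 0 < η →
        IntegrableOn (fun r : ℝ => r * |V r| * Real.exp (η * r)) (Ioi 0) volume →
        ∃ G : ℂ → ℂ, AnalyticOnNhd ℂ G (cutHalfPlane η) ∧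
          EqOn G F closedUpperPunctured ∧
          ∀ κ : ℝ, 0 < κ → κ < η / 2 →
            ∃ Fleft Fright : ℂ,
              Tendsto G (𝓝[{z : ℂ | z.re < 0}] (-(Complex.I * (κ : ℂ)))) (𝓝 Fleft) ∧
              Tendsto G (𝓝[{z : ℂ | 0 < z.re}] (-(Complex.I * (κ : ℂ)))) (𝓝 Fright) ∧
              Fleft = -Complex.exp (2 * Complex.I * (Real.pi : ℂ) * (μ : ℂ)) * Fright +
                2 * (Real.cos (Real.pi * μ) : ℂ) *
                  Complex.exp (Complex.I * (Real.pi : ℂ) * (μ : ℂ)) * G (Complex.I * (κ : ℂ)) := by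
  set W := hVmeas.mk V
  have hVW : V =ᵐ[volume.restrict (Ioi 0)] W := hVmeas.ae_eq_mk
  have hWm : Measurable W := hVmeas.measurable_mk
  have hW : IntegrableOn (fun s => s * |W s|) (Ioi 0) := by
    refine Integrable.mono' (integrableOn_congr_potential (f := fun r v => r * (1 + r) * |v|) hVW hV)
      (measurable_id.mul hWm.abs).aestronglyMeasurable ?_
    filter_upwards [ae_restrict_mem measurableSet_Ioi] with s hs
    have hs : 0 < s := hs
    rw [Real.norm_of_nonneg (by positivity)]
    gcongr
    nlinarith
  have hexp : ∀ η : ℝ, IntegrableOn (fun r : ℝ => r * |V r| * Real.exp (η * r)) (Ioi 0) volume →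
      IntegrableOn (fun r => |W r| * Real.exp (η * r)) (Ioi 1) := by
    intro η hη
    refine Integrable.mono' ((integrableOn_congr_potential
      (f := fun r v => r * |v| * Real.exp (η * r)) hVW hη).mono_set
        (Ioi_subset_Ioi zero_le_one)) (hWm.abs.mul (by fun_prop)).aestronglyMeasurable ?_
    filter_upwards [ae_restrict_mem measurableSet_Ioi] with s hs
    rw [Real.norm_of_nonneg (by positivity)]
    gcongr
    exact le_mul_of_one_le_left (abs_nonneg _) (le_of_lt hs)
  -- F and its continuation are the same global formula for every η; only the domain of analyticity
  -- depends on η.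
  refine ⟨jostFun W μ, ?_, ?_, continuousOn_jostFun hμ hWm hW, fun η hη hVη => ⟨jostFun W μ,
    (differentiableOn_jostFun hμ hWm hW hη.le (hexp η hVη)).analyticOnNhd
      (isOpen_cutHalfPlane η), fun _ _ => rfl, fun κ hκ hκη =>
    exists_tendsto_jostFun hμ hWm hW hκ hκη (hexp η hVη)⟩⟩
  · have := isJostFunction_jostFun hμ hWm hW
    simpa only [IsJostFunction, IsRegularSolution, IsJostSolution,
      isRadialSolution_congr_ae hVW] using this
  -- Rate 0 gives analyticity on the open upper half plane, without exponential decay of the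
  -- potential.
  · have h0 : IntegrableOn (fun r => |W r| * Real.exp (0 * r)) (Ioi 1) := by
      simpa [IntegrableOn] using (integrableOn_Ioi_one_potential hWm hW).abs
    refine ((differentiableOn_jostFun hμ hWm hW le_rfl h0).analyticOnNhd
      (isOpen_cutHalfPlane 0)).mono fun k hk => ?_
    have hk : 0 < k.im := hk
    exact ⟨by simpa using hk, fun h => not_lt.2 h.2 hk⟩
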